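/- Let $n,k,m\ge 0$. Consider Kähler metrics $g=(g_{i\bar j})$ and smooth complex-valued functions $f$ in local holomorphic coordinates on open subsets of $\mathbb C^n$. Write $g^{i\bar j}$ for the inverse metric, $\sum_j g^{i\bar j}g_{l\bar j}=\delta_{il}$; for multisets $A,B$ of indices write $f_{A\bar B}=\partial_A\partial_{\bar B}f$ and $g_{A\bar B}=\partial_{A\setminus i}\,\partial_{\bar B\setminus \bar j}\,g_{i\bar j}$ for any $i\in A$, $j\in B$ (well defined by the Kähler condition). A family $P=(P_{a_1\cdots a_k\bar b_1\cdots\bar b_m})$ of complex polynomials in the variables $g^{i\bar j}$, $g_{A\bar B}$ (with $|A|,|B|\ge1$, $|A|+|B|\ge3$) and $f_{A\bar B}$ is called *invariant* if its values form a covariant tensor with these indices: for every biholomorphic change of coordinates $\varphi$, $$P_{a\bar b}(\varphi^*g,f\circ\varphi)(x)=\sum_{c,d}\ \prod_{i=1}^k\partial_{a_i}\varphi_{c_i}(x)\ \prod_{j=1}^m\overline{\partial_{b_j}\varphi_{d_j}(x)}\ P_{c\bar d}(g,f)(\varphi(x)).$$ A point $x$ is the center of a normal coordinate system of order $N$ if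 $g_{i\bar j}(x)=\delta_{ij}$ and $g_{i\bar j l_1\cdots l_r}(x)=g_{i\bar j\bar l_1\cdots\bar l_r}(x)=0$ for $1\le r\le N$. The canonical invariant $D(f_{a_1\cdots a_k\bar b_1\cdots\bar b_m})$ is the invariant family of polynomials which equals $f_{a_1\cdots a_k\bar b_1\cdots\bar b_m}$ at the center of every normal coordinate system of sufficiently high order. A *pointed tree* is a finite directed tree with one distinguished vertex $\bullet$, labeled by $f$, and a finite set $V$ of ordinary vertices, whose vertices carry outward external legs labeled $a_1,\dots,a_k$ and inward external legs labeled $\bar b_1,\dots,\bar b_m$ (each label is used exactly once). Let $\deg^+(v)$ and $\deg^-(v)$ be the numbers of outward and inward half-edges at $v$ (ends of edges, and legs). The tree is *semistable* if every $v\in V$ has $\deg^+(v)\ge1$, $\deg^-(v)\ge1$ and $\deg^+(v)+\deg^-(v)\ge3$. It is *contractible* if for every directed edge $uv$, either $u\in V$ and $\deg^+(u)=1$, or $v\in V$ and $\deg^-(v)=1$. Let $\mathscr T_f(a_1\cdots a_k|\bar b_1\cdots\bar b_m)$ be the (finite) set of isomorphism classes of contractible semistable pointed trees, where isomorphisms fix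 $\bullet$ and the labels of the legs. For such a tree $T$ the polynomial $f_T$ is obtained by placing a derivative of $f$ at $\bullet$ and a derivative $g_{A\bar B}$ of the metric at each ordinary vertex, with unbarred (barred) indices at the outward (inward) half-edges, and by contracting each edge with $g^{r\bar s}$, with $r$ at its tail and $\bar s$ at its head. **Theorem.** The canonical invariant $D(f_{a_1\cdots a_k\bar b_1\cdots\bar b_m})$ exists, is unique (as a function of $g$, $f$ and the point), and $$D(f_{a_1\cdots a_k\bar b_1\cdots\bar b_m})=\sum_{T=(V\cup\{\bullet\})\in\mathscr T_f(a_1\cdots a_k|\bar b_1\cdots\bar b_m)}(-1)^{|V|}f_T .$$ -/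

import Mathlib

open scoped ContDiff ComplexConjugate ComplexOrder

namespace KahlerJets

noncomputable section

/-! ### Coordinate derivatives on `ℂⁿ` -/

/-- The derivative `∂h/∂zᵢ = (∂h/∂xᵢ - √-1 ∂h/∂yᵢ)/2`, where `zᵢ = xᵢ + √-1 yᵢ`. -/
def dz {n : ℕ} (i : Fin n) (h : (Fin n → ℂ) → ℂ) : (Fin n → ℂ) → ℂ := fun z =>
  (fderiv ℝ h z (Pi.single i 1) - Complex.I * fderiv ℝ h z (Pi.single i Complex.I)) / 2

/-- The derivative `∂h/∂z̄ᵢ = (∂h/∂xᵢ + √-1 ∂h/∂yᵢ)/2`. -/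
def dzbar {n : ℕ} (i : Fin n) (h : (Fin n → ℂ) → ℂ) : (Fin n → ℂ) → ℂ := fun z =>
  (fderiv ℝ h z (Pi.single i 1) + Complex.I * fderiv ℝ h z (Pi.single i Complex.I)) / 2

/-- The iterated derivative of `h` along the unbarred indices `A` and the barred indices `B`. -/
def iterD {n : ℕ} (A B : List (Fin n)) (h : (Fin n → ℂ) → ℂ) : (Fin n → ℂ) → ℂ :=
  A.foldr dz (B.foldr dzbar h)

/-! ### Kähler metrics in local holomorphic coordinates -/

/-- `g = (g_{i j̄})` is (the coordinate expression of) a Kähler metric on the open set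
`U ⊆ ℂⁿ`: smooth, Hermitian positive definite, with closed Kähler form
`√-1 ∑ g_{i j̄} dzᵢ ∧ dz̄ⱼ`. -/
structure IsKahlerOn {n : ℕ} (U : Set (Fin n → ℂ))
    (g : (Fin n → ℂ) → Matrix (Fin n) (Fin n) ℂ) : Prop where
  isOpen : IsOpen U
  smooth : ∀ i j, ContDiffOn ℝ ∞ (fun z => g z i j) U
  posDef : ∀ z ∈ U, (g z).PosDef
  closed : ∀ z ∈ U, ∀ i j l, dz l (fun w => g w i j) z = dz i (fun w => g w l j) z
  closed_bar : ∀ z ∈ U, ∀ i j l, dzbar l (fun w => g w i j) z = dzbar j (fun w => g w i l) z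

/-- `x` is the center of a normal coordinate system of order `N` for the metric `g`:
`g_{i j̄}(x) = δ_{ij}`, and at `x` all derivatives
`g_{i j̄ l₁ ⋯ l_r}` and `g_{i j̄ l̄₁ ⋯ l̄_r}` with `1 ≤ r ≤ N` vanish. -/
def IsNormalAt {n : ℕ} (N : ℕ) (g : (Fin n → ℂ) → Matrix (Fin n) (Fin n) ℂ)
    (x : Fin n → ℂ) : Prop :=
  g x = 1 ∧ ∀ (i j : Fin n) (L : List (Fin n)), 1 ≤ L.length → L.length ≤ N →
    iterD L [] (fun z => g z i j) x = 0 ∧ iterD [] L (fun z => g z i j) x = 0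

/-! ### Polynomials in the partial derivatives of the metric and of the function -/

/-- The variables: the entries `g^{i j̄}` of the inverse metric; the derivatives `g_{A B̄}` of
the metric, `A` and `B` being the multisets of all unbarred and of all barred indices
(at least one of each kind, and at least one of them a genuine derivative); and the derivatives
`f_{A B̄}` of the function. -/
inductive JetVar (n : ℕ) : Type
  | inv (i j : Fin n) : JetVar n
  | metric (A B : Multiset (Fin n))
      (h : 1 ≤ A.card ∧ 1 ≤ B.card ∧ 3 ≤ A.card + B.card) : JetVar n
  | func (A B : Multiset (Fin n)) : JetVar n

/-- `g_{A B̄}` for lists: the first index of each kind is an index of the metric coefficient,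
the others are derivatives. -/
def metricJet {n : ℕ} (g : (Fin n → ℂ) → Matrix (Fin n) (Fin n) ℂ) :
    List (Fin n) → List (Fin n) → (Fin n → ℂ) → ℂ
  | i :: A, j :: B => iterD A B (fun z => g z i j)
  | _, _ => 0

/-- The values of the variables at the point `x`. The multisets of indices are listed in
increasing order; for a Kähler metric, respectively a smooth function, any other order gives the
same values. The inverse metric is normalized by `∑ⱼ g^{i j̄} g_{l j̄} = δ_{il}`. -/
def jetValue {n : ℕ} (g : (Fin n → ℂ) → Matrix (Fin n) (Fin n) ℂ) (f : (Fin n → ℂ) → ℂ)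
    (x : Fin n → ℂ) : JetVar n → ℂ
  | .inv i j => (g x)⁻¹ j i
  | .metric A B _ => metricJet g (A.sort (· ≤ ·)) (B.sort (· ≤ ·)) x
  | .func A B => iterD (A.sort (· ≤ ·)) (B.sort (· ≤ ·)) f x

/-- A family of polynomials with indices `a₁ ⋯ a_k, b̄₁ ⋯ b̄_m` in dimension `n`. -/
abbrev PolyTensor (n k m : ℕ) : Type :=
  (Fin k → Fin n) → (Fin m → Fin n) → MvPolynomial (JetVar n) ℂ

/-- The value at `x` of a polynomial for the metric `g` and the function `f`. -/
def evalAt {n : ℕ} (g : (Fin n → ℂ) → Matrix (Fin n) (Fin n) ℂ) (f : (Fin n → ℂ) → ℂ)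
    (x : Fin n → ℂ) (P : MvPolynomial (JetVar n) ℂ) : ℂ :=
  MvPolynomial.eval (jetValue g f x) P

/-- The index multiset of a tuple of indices. -/
def indices {n k : ℕ} (a : Fin k → Fin n) : Multiset (Fin n) :=
  (Finset.univ : Finset (Fin k)).val.map a

/-! ### Changes of coordinates and invariance -/

/-- The metric `∑ g_{p q̄}(φ(z)) (∂ᵢ φ_p) (∂ⱼ φ_q)‾`. -/
def pullbackMetric {n : ℕ} (φ : (Fin n → ℂ) → (Fin n → ℂ))
    (g : (Fin n → ℂ) → Matrix (Fin n) (Fin n) ℂ) :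
    (Fin n → ℂ) → Matrix (Fin n) (Fin n) ℂ := fun z => Matrix.of fun i j =>
  ∑ p, ∑ q, g (φ z) p q * dz i (fun w => φ w p) z * conj (dz j (fun w => φ w q) z)

/-- `P` is invariant, that is, a covariant tensor with indices `a₁ ⋯ a_k, b̄₁ ⋯ b̄_m`: it has
the tensorial transformation law under every biholomorphic change of coordinates `φ`, for all
Kähler metrics and all smooth functions. -/
def IsInvariant {n k m : ℕ} (P : PolyTensor n k m) : Prop :=
  ∀ (φ : OpenPartialHomeomorph (Fin n → ℂ) (Fin n → ℂ)),
    AnalyticOnNhd ℂ φ φ.source → AnalyticOnNhd ℂ φ.symm φ.target →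
  ∀ (g : (Fin n → ℂ) → Matrix (Fin n) (Fin n) ℂ) (f : (Fin n → ℂ) → ℂ),
    IsKahlerOn φ.target g → ContDiffOn ℝ ∞ f φ.target →
  ∀ x ∈ φ.source, ∀ (a : Fin k → Fin n) (b : Fin m → Fin n),
    evalAt (pullbackMetric φ g) (f ∘ φ) x (P a b) =
      ∑ c : Fin k → Fin n, ∑ d : Fin m → Fin n,
        (∏ i, dz (a i) (fun w => φ w (c i)) x) *
        (∏ j, conj (dz (b j) (fun w => φ w (d j)) x)) *
        evalAt g f (φ x) (P c d)

/-- `P` is the canonical invariant `D(f_{a₁ ⋯ a_k b̄₁ ⋯ b̄_m})`: it is invariant, and it equals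
`f_{a₁ ⋯ a_k b̄₁ ⋯ b̄_m}` at the center of every normal coordinate system (of sufficiently high
order). -/
def IsCanonicalInvariant {n k m : ℕ} (P : PolyTensor n k m) : Prop :=
  IsInvariant P ∧
  ∃ N : ℕ, ∀ (U : Set (Fin n → ℂ)) (g : (Fin n → ℂ) → Matrix (Fin n) (Fin n) ℂ)
    (f : (Fin n → ℂ) → ℂ), IsKahlerOn U g → ContDiffOn ℝ ∞ f U →
    ∀ x ∈ U, IsNormalAt N g x → ∀ (a : Fin k → Fin n) (b : Fin m → Fin n),
      evalAt g f x (P a b) = evalAt g f x (MvPolynomial.X (.func (indices a) (indices b)))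

/-! ### Pointed trees -/

/-- A pointed tree with `k` outward external legs (the unbarred indices) and `m` inward external
legs (the barred indices). The vertices are the distinguished vertex `none` (labeled by `f`) and
`N` ordinary vertices `some v`; `(u, v) ∈ edges` is an edge directed from `u` to `v`. Each pair
of adjacent vertices is joined by a single edge with one direction, there are no loops, and the
underlying graph is a tree. -/
structure PointedTree (k m : ℕ) where
  N : ℕ
  edges : Finset (Option (Fin N) × Option (Fin N))
  outLeg : Fin k → Option (Fin N)
  inLeg : Fin m → Option (Fin N)
  asymm : ∀ u v, (u, v) ∈ edges → (v, u) ∉ edges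
  isTree : (SimpleGraph.fromRel fun u v => (u, v) ∈ edges).IsTree

namespace PointedTree

variable {k m : ℕ}

/-- The number of outward half-edges at `v`: tails of edges and outward legs. -/
def outDeg (T : PointedTree k m) (v : Option (Fin T.N)) : ℕ :=
  (Finset.univ.filter fun e : T.edges => e.1.1 = v).card +
    (Finset.univ.filter fun l : Fin k => T.outLeg l = v).card

/-- The number of inward half-edges at `v`: heads of edges and inward legs. -/
def inDeg (T : PointedTree k m) (v : Option (Fin T.N)) : ℕ :=
  (Finset.univ.filter fun e : T.edges => e.1.2 = v).card +
    (Finset.univ.filter fun l : Fin m => T.inLeg l = v).card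

/-- Every ordinary vertex is semistable. -/
def Semistable (T : PointedTree k m) : Prop :=
  ∀ v : Fin T.N, 1 ≤ T.outDeg (some v) ∧ 1 ≤ T.inDeg (some v) ∧
    3 ≤ T.outDeg (some v) + T.inDeg (some v)

/-- Every edge is contractible. -/
def Contractible (T : PointedTree k m) : Prop :=
  ∀ u v, (u, v) ∈ T.edges →
    (u ≠ none ∧ T.outDeg u = 1) ∨ (v ≠ none ∧ T.inDeg v = 1)

/-- Isomorphism of pointed trees: it fixes the distinguished vertex and respects the directed
edges and the labels of the legs. -/
def Iso (T T' : PointedTree k m) : Prop :=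
  ∃ σ : Fin T.N ≃ Fin T'.N,
    (∀ u v, (u, v) ∈ T.edges ↔ (u.map σ, v.map σ) ∈ T'.edges) ∧
    (∀ l, T'.outLeg l = (T.outLeg l).map σ) ∧ (∀ l, T'.inLeg l = (T.inLeg l).map σ)

theorem Iso.refl (T : PointedTree k m) : T.Iso T :=
  ⟨Equiv.refl _, by simp, by simp, by simp⟩

theorem Iso.symm {T T' : PointedTree k m} (h : T.Iso T') : T'.Iso T := by
  obtain ⟨σ, h1, h2, h3⟩ := h
  refine ⟨σ.symm, fun u v => ?_, fun l => ?_, fun l => ?_⟩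
  · rw [h1]; simp [Option.map_map]
  · rw [h2]; simp [Option.map_map]
  · rw [h3]; simp [Option.map_map]

theorem Iso.trans {T T' T'' : PointedTree k m} (h : T.Iso T') (h' : T'.Iso T'') :
    T.Iso T'' := by
  obtain ⟨σ, h1, h2, h3⟩ := h
  obtain ⟨τ, t1, t2, t3⟩ := h'
  refine ⟨σ.trans τ, fun u v => ?_, fun l => ?_, fun l => ?_⟩
  · rw [h1, t1]; simp [Option.map_map]
  · rw [t2, h2]; simp [Option.map_map]
  · rw [t3, h3]; simp [Option.map_map]

/-- The unbarred indices at the vertex `v`, if the tail of each edge `e` carries the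
index `r e` and the outward legs carry the indices `a`. -/
def outIndices {n : ℕ} (T : PointedTree k m) (a : Fin k → Fin n) (r : T.edges → Fin n)
    (v : Option (Fin T.N)) : Multiset (Fin n) :=
  (Finset.univ.filter fun e : T.edges => e.1.1 = v).val.map r +
    (Finset.univ.filter fun l : Fin k => T.outLeg l = v).val.map a

/-- The barred indices at the vertex `v`, if the head of each edge `e` carries the
index `s e` and the inward legs carry the indices `b`. -/
def inIndices {n : ℕ} (T : PointedTree k m) (b : Fin m → Fin n) (s : T.edges → Fin n)
    (v : Option (Fin T.N)) : Multiset (Fin n) :=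
  (Finset.univ.filter fun e : T.edges => e.1.2 = v).val.map s +
    (Finset.univ.filter fun l : Fin m => T.inLeg l = v).val.map b

theorem card_outIndices {n : ℕ} (T : PointedTree k m) (a : Fin k → Fin n)
    (r : T.edges → Fin n) (v : Option (Fin T.N)) :
    (T.outIndices a r v).card = T.outDeg v := by
  simp only [outIndices, outDeg, Multiset.card_add, Multiset.card_map]
  rfl

theorem card_inIndices {n : ℕ} (T : PointedTree k m) (b : Fin m → Fin n)
    (s : T.edges → Fin n) (v : Option (Fin T.N)) :
    (T.inIndices b s v).card = T.inDeg v := by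
  simp only [inIndices, inDeg, Multiset.card_add, Multiset.card_map]
  rfl

/-- The polynomial `f_T` of a semistable pointed tree `T`: an ordinary vertex is a derivative
`g_{A B̄}`, the distinguished vertex is a derivative `f_{A B̄}`, where `A` (resp. `B`) collects
the indices at the outward (resp. inward) half-edges, and each edge is a contraction
with `g^{r s̄}`. -/
def poly {n : ℕ} (T : PointedTree k m) (hT : T.Semistable) (a : Fin k → Fin n)
    (b : Fin m → Fin n) : MvPolynomial (JetVar n) ℂ :=
  ∑ r : T.edges → Fin n, ∑ s : T.edges → Fin n,
    (∏ e, MvPolynomial.X (.inv (r e) (s e))) *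
    (∏ v : Fin T.N, MvPolynomial.X
      (.metric (T.outIndices a r (some v)) (T.inIndices b s (some v))
        (by rw [card_outIndices, card_inIndices]; exact hT v))) *
    MvPolynomial.X (.func (T.outIndices a r none) (T.inIndices b s none))

theorem metric_congr {n : ℕ} {A A' B B' : Multiset (Fin n)} (hA : A = A') (hB : B = B')
    (h : 1 ≤ A.card ∧ 1 ≤ B.card ∧ 3 ≤ A.card + B.card)
    (h' : 1 ≤ A'.card ∧ 1 ≤ B'.card ∧ 3 ≤ A'.card + B'.card) :
    JetVar.metric A B h = JetVar.metric A' B' h' := by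
  subst hA; subst hB; rfl

theorem filter_map_comp {α β γ : Type*} [Fintype α] [Fintype β] (E : α ≃ β) (p : α → Prop)
    (q : β → Prop) [DecidablePred p] [DecidablePred q] (h : ∀ x, p x ↔ q (E x)) (r : β → γ) :
    (Finset.univ.filter p).val.map (r ∘ E) = (Finset.univ.filter q).val.map r := by
  have : Finset.univ.filter q = (Finset.univ.filter p).map E.toEmbedding := by
    ext y
    simp only [Finset.mem_filter, Finset.mem_univ, true_and, Finset.mem_map,
      Equiv.coe_toEmbedding]
    constructor
    · intro hy
      exact ⟨E.symm y, by rw [h]; simpa using hy, by simp⟩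
    · rintro ⟨x, hx, rfl⟩
      exact (h x).1 hx
  rw [this, Finset.map_val, Multiset.map_map]
  rfl

theorem poly_iso {n : ℕ} {T T' : PointedTree k m} (h : T.Iso T') (hT : T.Semistable)
    (hT' : T'.Semistable) (a : Fin k → Fin n) (b : Fin m → Fin n) :
    T.poly hT a b = T'.poly hT' a b := by
  obtain ⟨σ, h1, h2, h3⟩ := h
  have inj : Function.Injective (Option.map σ) := Option.map_injective σ.injective
  let E : T.edges ≃ T'.edges :=
    { toFun := fun e => ⟨(e.1.1.map σ, e.1.2.map σ), (h1 _ _).1 e.2⟩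
      invFun := fun e => ⟨(e.1.1.map σ.symm, e.1.2.map σ.symm), by
        rw [h1]; simp [Option.map_map]⟩
      left_inv := fun e => by ext1; simp [Option.map_map]
      right_inv := fun e => by ext1; simp [Option.map_map] }
  have out : ∀ (r : T'.edges → Fin n) (v : Option (Fin T.N)),
      T.outIndices a (r ∘ E) v = T'.outIndices a r (v.map σ) := by
    intro r v
    unfold outIndices
    congr 1
    · exact filter_map_comp E _ _ (fun e => inj.eq_iff.symm) r
    · exact filter_map_comp (Equiv.refl _) _ _
        (fun l => by rw [Equiv.refl_apply, h2]; exact inj.eq_iff.symm) a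
  have inn : ∀ (s : T'.edges → Fin n) (v : Option (Fin T.N)),
      T.inIndices b (s ∘ E) v = T'.inIndices b s (v.map σ) := by
    intro s v
    unfold inIndices
    congr 1
    · exact filter_map_comp E _ _ (fun e => inj.eq_iff.symm) s
    · exact filter_map_comp (Equiv.refl _) _ _
        (fun l => by rw [Equiv.refl_apply, h3]; exact inj.eq_iff.symm) b
  unfold poly
  refine (Fintype.sum_equiv (E.arrowCongr (Equiv.refl (Fin n))).symm _ _ fun r => ?_).symm
  refine Fintype.sum_equiv (E.arrowCongr (Equiv.refl (Fin n))).symm _ _ fun s => ?_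
  have hr : (E.arrowCongr (Equiv.refl (Fin n))).symm r = r ∘ E := by ext; rfl
  have hs : (E.arrowCongr (Equiv.refl (Fin n))).symm s = s ∘ E := by ext; rfl
  rw [hr, hs]
  congr 1
  · congr 1
    · exact (Fintype.prod_equiv E _ _ fun e => rfl).symm
    · refine (Fintype.prod_equiv σ _ _ fun v => ?_).symm
      congr 1
      exact metric_congr (out r (some v)) (inn s (some v)) _ _
  · rw [out, inn]; rfl

/-- A semistable pointed tree has at most `k + m` ordinary vertices. -/
theorem Semistable.N_le {T : PointedTree k m} (hT : T.Semistable) : T.N ≤ k + m := by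
  classical
  have hE : T.edges.card ≤ T.N := by
    have h1 := T.isTree.card_edgeFinset
    rw [Fintype.card_option, Fintype.card_fin] at h1
    have h2 : T.edges.card ≤
        (SimpleGraph.fromRel fun u v => (u, v) ∈ T.edges).edgeFinset.card := by
      refine Finset.card_le_card_of_injOn (fun e => s(e.1, e.2)) ?_ ?_
      · rintro ⟨u, v⟩ he
        have he' : (u, v) ∈ T.edges := he
        simp only [SimpleGraph.coe_edgeFinset, SimpleGraph.mem_edgeSet,
          SimpleGraph.fromRel_adj]
        refine ⟨?_, Or.inl he'⟩
        rintro rfl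
        exact T.asymm _ _ he' he'
      · rintro ⟨u, v⟩ he ⟨u', v'⟩ he' h
        have e1 : (u, v) ∈ T.edges := he
        have e2 : (u', v') ∈ T.edges := he'
        rcases Sym2.eq_iff.1 h with ⟨rfl, rfl⟩ | ⟨rfl, rfl⟩
        · rfl
        · exact absurd e2 (T.asymm _ _ e1)
    omega
  have hout : ∑ v, T.outDeg v = T.edges.card + k := by
    simp only [outDeg, Finset.sum_add_distrib]
    rw [← Finset.card_eq_sum_card_fiberwise (f := fun e : T.edges => e.1.1)
      (fun _ _ => Finset.mem_coe.2 (Finset.mem_univ _)),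
      ← Finset.card_eq_sum_card_fiberwise (f := T.outLeg)
      (fun _ _ => Finset.mem_coe.2 (Finset.mem_univ _))]
    simp
  have hin : ∑ v, T.inDeg v = T.edges.card + m := by
    simp only [inDeg, Finset.sum_add_distrib]
    rw [← Finset.card_eq_sum_card_fiberwise (f := fun e : T.edges => e.1.2)
      (fun _ _ => Finset.mem_coe.2 (Finset.mem_univ _)),
      ← Finset.card_eq_sum_card_fiberwise (f := T.inLeg)
      (fun _ _ => Finset.mem_coe.2 (Finset.mem_univ _))]
    simp
  rw [Fintype.sum_option] at hout hin
  have h3 : ∑ _v : Fin T.N, 3 ≤ ∑ v : Fin T.N, (T.outDeg (some v) + T.inDeg (some v)) :=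
    Finset.sum_le_sum fun v _ => (hT v).2.2
  rw [Finset.sum_add_distrib] at h3
  simp only [Finset.sum_const, Finset.card_univ, Fintype.card_fin, smul_eq_mul] at h3
  omega

end PointedTree

/-- The contractible semistable pointed trees with the given external legs. -/
abbrev ContractibleTree (k m : ℕ) : Type :=
  {T : PointedTree k m // T.Semistable ∧ T.Contractible}

/-- Isomorphism of contractible semistable pointed trees. -/
instance treeSetoid (k m : ℕ) : Setoid (ContractibleTree k m) where
  r T T' := T.1.Iso T'.1
  iseqv := ⟨fun T => .refl T.1, fun h => h.symm, fun h h' => h.trans h'⟩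

/-- The set `𝒯_f(a₁ ⋯ a_k | b̄₁ ⋯ b̄_m)` of isomorphism classes of contractible
semistable pointed trees. -/
abbrev TreeClass (k m : ℕ) : Type := Quotient (treeSetoid k m)

instance finite_contractibleTree (k m : ℕ) : Finite (ContractibleTree k m) := by
  let F : ContractibleTree k m → Σ N : Fin (k + m + 1),
      Finset (Option (Fin N) × Option (Fin N)) × (Fin k → Option (Fin N)) ×
        (Fin m → Option (Fin N)) := fun T =>
    ⟨⟨T.1.N, Nat.lt_succ_of_le T.2.1.N_le⟩, T.1.edges, T.1.outLeg, T.1.inLeg⟩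
  refine Finite.of_injective F ?_
  rintro ⟨⟨N, E, o, i, h1, h2⟩, hT⟩ ⟨⟨N', E', o', i', h1', h2'⟩, hT'⟩ h
  simp only [F, Sigma.mk.injEq, Fin.mk.injEq] at h
  obtain ⟨rfl, h⟩ := h
  have h' := eq_of_heq h
  simp only [Prod.mk.injEq] at h'
  obtain ⟨rfl, rfl, rfl⟩ := h'
  rfl

instance fintype_treeClass (k m : ℕ) : Fintype (TreeClass k m) := Fintype.ofFinite _

/-- The number `|V|` of ordinary vertices of an isomorphism class of trees. -/
def TreeClass.numVertices {k m : ℕ} (t : TreeClass k m) : ℕ :=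
  Quotient.lift (fun T : ContractibleTree k m => T.1.N)
    (fun T T' (h : T.1.Iso T'.1) => by
      obtain ⟨σ, -⟩ := h
      simpa using Fintype.card_congr σ) t

/-- The polynomial `f_T` of an isomorphism class of trees `T`. -/
def TreeClass.poly {n k m : ℕ} (t : TreeClass k m) (a : Fin k → Fin n) (b : Fin m → Fin n) :
    MvPolynomial (JetVar n) ℂ :=
  Quotient.lift (fun T : ContractibleTree k m => T.1.poly T.2.1 a b)
    (fun T T' (h : T.1.Iso T'.1) => PointedTree.poly_iso h T.2.1 T'.2.1 a b) t

/-- The sum `∑ (-1)^{|V|} f_T` over all contractible semistable pointed trees. -/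
def treeSum (n k m : ℕ) : PolyTensor n k m := fun a b =>
  ∑ t : TreeClass k m, (-1) ^ t.numVertices * t.poly a b

end

end KahlerJets

set_option linter.unusedSectionVars false

/-! Let `ψ` be a chart near `x` with inverse `φ`, in which the metric `G` is normal at `ψ x`, and
let `F = f ∘ φ`. A canonical invariant equals `F_{c d̄}` at `ψ x`, so by invariance its value at `x`
is this tensor transported by the Jacobian of `ψ`. As normal charts of every order exist, uniqueness
follows, and it remains to express the transported tensor through the jets of `g` and `f` at `x` and
to recognise the sum over trees.

Analytic side. The transported tensor is an iterated derivative of `f ∘ φ` along vectors that are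
constant in the normal chart. The chain rule expands it over set partitions of the labels, with
derivatives of `φ` as coefficients. These are eliminated by Lagrange inversion: let `y i` be the
linear combinations of the components of `ψ` with `∂_j (y i) = δ_ij` at `x`. Since `y i ∘ φ` is
affine, its derivatives of order at least 2 vanish, and solving these relations recursively writes
the derivatives of `φ` as sums over rooted trees with a factor `-∂_A (y i)` at each vertex
(`eq_branchSum_of_rec`, `iterOn_comp`). Trees with labelled leaves are encoded by laminar families
of leaf sets; the cancellation needed is `forestSum_vertex`. As `φ` is holomorphic, barred and
unbarred derivatives do not interfere, and the result is a double sum over forests, one on the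
labels `a` and one on the labels `b` (`HolMap.iterOn_eq_forestSum`).

The weights are metric derivatives. Up to terms whose unbarred derivatives vanish to high order, `G`
is the identity, so `g_{A j̄} = ∑_p ∂_A ψ_p conj (∂_j ψ_p)` at `x`. Contracting with the inverse
metric gives `∑_j g^{i j̄} g_{A j̄} = ∂_A (y i)`, which is one ordinary vertex together with one
edge. Vertices with one unbarred index are the complex conjugates.

Combinatorial side. An edge leaving `•` can be contractible only through its head, so the head has
inward degree 1; semistability gives it outward degree at least 2, so the edges leaving it are again
contractible only through their heads. Hence a contractible semistable tree is `•` with one forest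
directed away from it and one directed towards it, each vertex having at least two children
(`PointedTree.exists_forests`). Such pairs of forests are the pairs of laminar families, and
`eval_treeSum` rewrites the tree sum accordingly. `HolMap.evalAt_treeSum` joins the two sides.

Invariance follows because a normal chart for `g`, composed with a change of coordinates, is a
normal chart for the pulled back metric. Normal charts exist because closedness makes the
derivatives of `g_{i q̄}` at `x` symmetric in all unbarred indices, so they are the derivatives `∂_i
w_q` of polynomials `w_q`; suitable linear combinations of the `w_q` are the new coordinates. -/

namespace KahlerJets

noncomputable section

/-! ### Sums over the index assignments of a forest -/

section Forest

open Finset Sum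

variable {n : ℕ} {ι : Type*}

/-- The multiset of the indices at the children of the node `o` of a forest with vertex set `V`,
parent maps `p` (on vertices) and `q` (on leaves), leaves `R`, where the leaf `l` carries the
index `a l` and the edge above the vertex `v` carries the index `ρ v`. -/
def childIdx {V : Type*} [Fintype V] [DecidableEq V] (p : V → Option V) (q : ι → Option V)
    (R : Finset ι) (a : ι → Fin n) (ρ : V → Fin n) (o : Option V) : Multiset (Fin n) :=
  (∑ v, if p v = o then {ρ v} else 0) + ∑ l ∈ R, if q l = o then {a l} else 0

/-- The contraction of tensors `W` at the vertices and of the jet `h` at the root of a forest. -/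
def forestVal {V : Type*} [Fintype V] [DecidableEq V] (p : V → Option V) (q : ι → Option V)
    (R : Finset ι) (a : ι → Fin n) (W : Fin n → Multiset (Fin n) → ℂ)
    (h : Multiset (Fin n) → ℂ) : ℂ :=
  ∑ ρ : V → Fin n, (∏ v, W (ρ v) (childIdx p q R a ρ (some v))) * h (childIdx p q R a ρ none)

variable {V V₁ V₂ : Type*} [Fintype V] [DecidableEq V] [Fintype V₁] [DecidableEq V₁]
  [Fintype V₂] [DecidableEq V₂]

/-- A forest in which a vertex is attached to the root is cut into the branch at this vertex and
the rest. -/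
theorem forestVal_graft [DecidableEq ι] (e : Option V₁ ⊕ V₂ ≃ V) {p : V → Option V}
    {q : ι → Option V}
    {p₁ : V₁ → Option V₁} {q₁ : ι → Option V₁} {p₂ : V₂ → Option V₂} {q₂ : ι → Option V₂}
    {R S : Finset ι} (hS : S ⊆ R)
    (hp0 : p (e (inl none)) = none)
    (hp1 : ∀ v, p (e (inl (some v))) = some (e (inl (p₁ v))))
    (hp2 : ∀ v, p (e (inr v)) = (p₂ v).map fun w => e (inr w))
    (hq1 : ∀ l ∈ S, q l = some (e (inl (q₁ l))))
    (hq2 : ∀ l ∈ R \ S, q l = (q₂ l).map fun w => e (inr w))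
    (a : ι → Fin n) (W : Fin n → Multiset (Fin n) → ℂ) (h : Multiset (Fin n) → ℂ) :
    forestVal p q R a W h = ∑ i, forestVal p₁ q₁ S a W (W i) *
      forestVal p₂ q₂ (R \ S) a W fun A => h (i ::ₘ A) := by
  -- An index assignment consists of the index above the branch vertex `e (inl none)`, those inside
  -- the branch and those in the rest.
  let Φ : (Fin n × (V₁ → Fin n)) × (V₂ → Fin n) ≃ (V → Fin n) :=
    { toFun := fun x v => Sum.elim (fun o => o.elim x.1.1 x.1.2) x.2 (e.symm v)
      invFun := fun ρ => ((ρ (e (inl none)), fun v => ρ (e (inl (some v)))), fun v => ρ (e (inr v)))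
      left_inv := fun x => by simp
      right_inv := fun ρ => by
        funext v
        obtain ⟨w, rfl⟩ := e.surjective v
        rcases w with (_ | w) | w <;> simp }
  have key : ∀ (x : (Fin n × (V₁ → Fin n)) × (V₂ → Fin n)) (o : Option V),
      childIdx p q R a (Φ x) o =
        ((if none = o then {x.1.1} else 0) +
          (∑ v, if some (e (inl (p₁ v))) = o then {x.1.2 v} else 0) +
          ∑ v, if ((p₂ v).map fun w => e (inr w)) = o then {x.2 v} else 0) +
        ((∑ l ∈ S, if some (e (inl (q₁ l))) = o then {a l} else 0) +
          ∑ l ∈ R \ S, if ((q₂ l).map fun w => e (inr w)) = o then {a l} else 0) := by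
    intro x o
    unfold childIdx
    congr 1
    · rw [← Fintype.sum_equiv e (fun w => if p (e w) = o then {Φ x (e w)} else 0) _
        (fun _ => rfl), Fintype.sum_sum_type, Fintype.sum_option]
      simp only [hp0, hp1, hp2, Φ, Equiv.coe_fn_mk, Equiv.symm_apply_apply, Sum.elim_inl,
        Sum.elim_inr, Option.elim]
    · rw [← Finset.sum_sdiff hS, add_comm]
      congr 1
      · exact Finset.sum_congr rfl fun l hl => by rw [hq1 l hl]
      · exact Finset.sum_congr rfl fun l hl => by rw [hq2 l hl]
  have k1 : ∀ x o, childIdx p q R a (Φ x) (some (e (inl o))) = childIdx p₁ q₁ S a x.1.2 o := by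
    intro x o
    rw [key]
    simp [childIdx, Option.map_eq_some_iff]
  have k2 : ∀ x v, childIdx p q R a (Φ x) (some (e (inr v))) =
      childIdx p₂ q₂ (R \ S) a x.2 (some v) := by
    intro x o
    rw [key]
    simp [childIdx, Option.map_eq_some_iff]
  have k3 : ∀ x, childIdx p q R a (Φ x) none =
      x.1.1 ::ₘ childIdx p₂ q₂ (R \ S) a x.2 none := by
    intro x
    rw [key]
    simp [childIdx, Option.map_eq_none_iff, add_assoc, ← Multiset.singleton_add]
  unfold forestVal
  rw [← Fintype.sum_equiv Φ _ _ (fun _ => rfl), Fintype.sum_prod_type, Fintype.sum_prod_type]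
  refine Finset.sum_congr rfl fun i _ => ?_
  rw [Finset.sum_mul_sum]
  refine Finset.sum_congr rfl fun ρ₁ _ => Finset.sum_congr rfl fun ρ₂ _ => ?_
  rw [← Fintype.prod_equiv e (fun w => W (Φ ((i, ρ₁), ρ₂) (e w))
    (childIdx p q R a (Φ ((i, ρ₁), ρ₂)) (some (e w)))) _ (fun _ => rfl), Fintype.prod_sum_type,
    Fintype.prod_option]
  simp only [k1, k2, k3]
  simp only [Φ, Equiv.coe_fn_mk, Equiv.symm_apply_apply, Sum.elim_inl, Sum.elim_inr,
    Option.elim]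
  ring

/-- A leaf attached to the root adds an index to the jet at the root. -/
theorem forestVal_insert [DecidableEq ι] {p : V → Option V} {q : ι → Option V} {R : Finset ι}
    {l : ι} (hl : l ∈ R) (hq : q l = none) (a : ι → Fin n) (W : Fin n → Multiset (Fin n) → ℂ)
    (h : Multiset (Fin n) → ℂ) :
    forestVal p q R a W h = forestVal p q (R \ {l}) a W fun A => h (a l ::ₘ A) := by
  have key : ∀ ρ o, childIdx p q R a ρ o =
      (if none = o then {a l} else 0) + childIdx p q (R \ {l}) a ρ o := by
    intro ρ o
    unfold childIdx
    rw [← Finset.sum_sdiff (Finset.singleton_subset_iff.2 hl), Finset.sum_singleton, hq]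
    abel
  unfold forestVal
  refine Finset.sum_congr rfl fun ρ _ => ?_
  simp [key, ← Multiset.singleton_add]

end Forest

/-! ### Laminar families -/

section LaminarFamily

open Finset Sum

variable {n : ℕ} {ι : Type*}

/-- A family of sets with at least two elements, any two of which are nested or disjoint. -/
def Laminar (H : Finset (Finset ι)) : Prop :=
  (∀ S ∈ H, 2 ≤ S.card) ∧ ∀ S ∈ H, ∀ T ∈ H, S ⊆ T ∨ T ⊆ S ∨ Disjoint S T

theorem Laminar.nonempty {H : Finset (Finset ι)} (hH : Laminar H) {S : Finset ι} (hS : S ∈ H) :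
    S.Nonempty :=
  Finset.card_pos.1 (by have := hH.1 S hS; omega)

theorem Laminar.mono {H H' : Finset (Finset ι)} (hH : Laminar H) (h : H' ⊆ H) : Laminar H' :=
  ⟨fun S hS => hH.1 S (h hS), fun S hS T hT => hH.2 S (h hS) T (h hT)⟩

open Classical in
/-- The smallest member of `H` which strictly contains `X`. -/
def par (H : Finset (Finset ι)) (X : Finset ι) : Option H :=
  if h : ∃ S : H, X ⊂ S.1 ∧ ∀ T ∈ H, X ⊂ T → S.1 ⊆ T then some h.choose else none

theorem par_eq_some {H : Finset (Finset ι)} {X : Finset ι} {S : H} :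
    par H X = some S ↔ X ⊂ S.1 ∧ ∀ T ∈ H, X ⊂ T → S.1 ⊆ T := by
  classical
  unfold par
  constructor
  · intro h
    split_ifs at h with hex
    have := hex.choose_spec
    rw [Option.some.inj h] at this
    exact this
  · intro h
    have hex : ∃ S : H, X ⊂ S.1 ∧ ∀ T ∈ H, X ⊂ T → S.1 ⊆ T := ⟨S, h⟩
    rw [dif_pos hex]
    have h' := hex.choose_spec
    congr 1
    exact Subtype.ext (subset_antisymm (h'.2 _ S.2 h.1) (h.2 _ hex.choose.2 h'.1))

/-- If some member strictly contains `X`, then one of least cardinality lies in all the others: they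
share a point of `X`, so laminarity makes them nested. This is where `X` must be nonempty. -/
theorem par_eq_none {H : Finset (Finset ι)} (hH : Laminar H) {X : Finset ι} (hX : X.Nonempty) :
    par H X = none ↔ ∀ T ∈ H, ¬ X ⊂ T := by
  classical
  constructor
  · intro h T hT hXT
    obtain ⟨S, hS, hmin⟩ := Finset.exists_min_image (H.filter (X ⊂ ·)) Finset.card
      ⟨T, by simp [hT, hXT]⟩
    rw [Finset.mem_filter] at hS
    have : par H X = some ⟨S, hS.1⟩ := by
      refine par_eq_some.2 ⟨hS.2, fun T hT hXT => ?_⟩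
      have hle := hmin T (by simp [hT, hXT])
      rcases hH.2 S hS.1 T hT with h1 | h1 | h1
      · exact h1
      · exact (Finset.eq_of_subset_of_card_le h1 hle).ge
      · obtain ⟨x, hx⟩ := hX
        exact absurd (hXT.1 hx) (Finset.disjoint_left.1 h1 (hS.2.1 hx))
    rw [this] at h
    cases h
  · intro h
    cases hp : par H X with
    | none => rfl
    | some S => exact absurd (par_eq_some.1 hp).1 (h S S.2)

open Classical in
/-- The laminar families of subsets of `R`. -/
def laminarFamilies (R : Finset ι) : Finset (Finset (Finset ι)) :=
  R.powerset.powerset.filter Laminar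

theorem mem_laminarFamilies {R : Finset ι} {H : Finset (Finset ι)} :
    H ∈ laminarFamilies R ↔ (∀ S ∈ H, S ⊆ R) ∧ Laminar H := by
  simp [laminarFamilies, Finset.subset_iff]

theorem laminarFamilies_empty : laminarFamilies (∅ : Finset ι) = {∅} := by
  ext H
  rw [mem_laminarFamilies, Finset.mem_singleton]
  constructor
  · rintro ⟨h, hL⟩
    refine Finset.eq_empty_of_forall_notMem fun S hS => ?_
    have := hL.1 S hS
    rw [Finset.subset_empty.1 (h S hS)] at this
    simp at this
  · rintro rfl
    simp [Laminar]

variable [DecidableEq ι]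

/-- The contraction along the forest of a laminar family. -/
def laminarVal (H : Finset (Finset ι)) (R : Finset ι) (a : ι → Fin n)
    (W : Fin n → Multiset (Fin n) → ℂ) (h : Multiset (Fin n) → ℂ) : ℂ :=
  forestVal (fun S : H => par H S) (fun l => par H {l}) R a W h

/-- The signed sum of the contractions along all forests with leaves `R`. -/
def forestSum (R : Finset ι) (a : ι → Fin n) (W : Fin n → Multiset (Fin n) → ℂ)
    (h : Multiset (Fin n) → ℂ) : ℂ :=
  ∑ H ∈ laminarFamilies R, (-1) ^ H.card * laminarVal H R a W h

open Classical in
/-- The signed sum of the contractions along all trees with leaves `S` and root index `i`. -/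
def branchSum (a : ι → Fin n) (W : Fin n → Multiset (Fin n) → ℂ) (S : Finset ι) (i : Fin n) :
    ℂ :=
  -- A single leaf is the identity. Otherwise the root vertex is the factor `W i` with its sign, and
  -- the forest hanging from it omits `S`, which the root already represents.
  if S.card = 1 then ∑ l ∈ S, if i = a l then 1 else 0
  else -∑ H ∈ laminarFamilies S with S ∉ H, (-1) ^ H.card * laminarVal H S a W (W i)

/-! ### Grafting a tree onto a forest -/

section Graft

variable {R S : Finset ι} {H₁ H₂ : Finset (Finset ι)}

theorem laminar_graft (h₁ : H₁ ∈ laminarFamilies S) (h₂ : H₂ ∈ laminarFamilies (R \ S))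
    (hS2 : 2 ≤ S.card) : Laminar (insert S (H₁ ∪ H₂)) := by
  rw [mem_laminarFamilies] at h₁ h₂
  have d : ∀ X ⊆ S, ∀ Y ∈ H₂, Disjoint X Y := fun X hX Y hY =>
    Finset.disjoint_left.2 fun x hx hy => (Finset.mem_sdiff.1 (h₂.1 Y hY hy)).2 (hX hx)
  refine ⟨fun X hX => ?_, fun X hX Y hY => ?_⟩
  · simp only [Finset.mem_insert, Finset.mem_union] at hX
    rcases hX with rfl | hX | hX
    exacts [hS2, h₁.2.1 X hX, h₂.2.1 X hX]
  · simp only [Finset.mem_insert, Finset.mem_union] at hX hY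
    rcases hX with rfl | hX | hX <;> rcases hY with rfl | hY | hY
    · exact Or.inl subset_rfl
    · exact Or.inr (Or.inl (h₁.1 _ hY))
    · exact Or.inr (Or.inr (d _ subset_rfl _ hY))
    · exact Or.inl (h₁.1 _ hX)
    · exact h₁.2.2 _ hX _ hY
    · exact Or.inr (Or.inr (d _ (h₁.1 _ hX) _ hY))
    · exact Or.inr (Or.inr (d _ subset_rfl _ hX).symm)
    · exact Or.inr (Or.inr (d _ (h₁.1 _ hY) _ hX).symm)
    · exact h₂.2.2 _ hX _ hY

/-- In the enlarged family a nonempty proper subset of `S` keeps its parent in `H₁`, or gets `S` if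
it had none, and a nonempty set disjoint from `S` keeps its parent in `H₂`. These are the hypotheses
of `forestVal_graft` with `S` as branch vertex. -/
theorem laminarVal_graft (h₁ : H₁ ∈ laminarFamilies S) (h₂ : H₂ ∈ laminarFamilies (R \ S))
    (hS1 : S ∉ H₁) (hS2 : 2 ≤ S.card) (hSR : S ⊆ R) (a : ι → Fin n)
    (W : Fin n → Multiset (Fin n) → ℂ) (h : Multiset (Fin n) → ℂ) :
    laminarVal (insert S (H₁ ∪ H₂)) R a W h =
      ∑ i, laminarVal H₁ S a W (W i) * laminarVal H₂ (R \ S) a W fun A => h (i ::ₘ A) := by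
  have hL := laminar_graft h₁ h₂ hS2
  rw [mem_laminarFamilies] at h₁ h₂
  have hd : ∀ Y ∈ H₂, Disjoint S Y := fun Y hY =>
    Finset.disjoint_left.2 fun x hx hy => (Finset.mem_sdiff.1 (h₂.1 Y hY hy)).2 hx
  let c : Option H₁ ⊕ H₂ → (insert S (H₁ ∪ H₂) : Finset (Finset ι)) :=
    Sum.elim (fun o => o.elim ⟨S, by simp⟩ fun X => ⟨X, by simp [X.2]⟩)
      fun X => ⟨X, by simp [X.2]⟩
  have hc : Function.Bijective c := by
    constructor
    · have n2 : ∀ Y : H₂, ∀ X ⊆ S, X ≠ Y := by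
        rintro Y X hX rfl
        obtain ⟨x, hx⟩ := h₂.2.nonempty Y.2
        exact Finset.disjoint_left.1 (hd Y Y.2) (hX hx) hx
      rintro ((_ | X) | X) ((_ | Y) | Y) hXY <;>
        simp only [c, Sum.elim_inl, Sum.elim_inr, Option.elim, Subtype.mk.injEq] at hXY
      · rfl
      · exact absurd (hXY ▸ Y.2) hS1
      · exact absurd hXY (n2 Y _ subset_rfl)
      · exact absurd (hXY ▸ X.2) hS1
      · rw [Subtype.ext hXY]
      · exact absurd hXY (n2 Y _ (h₁.1 X X.2))
      · exact absurd hXY.symm (n2 X _ subset_rfl)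
      · exact absurd hXY.symm (n2 X _ (h₁.1 Y Y.2))
      · rw [Subtype.ext hXY]
    · rintro ⟨X, hX⟩
      rcases Finset.mem_insert.1 hX with rfl | hX'
      · exact ⟨inl none, rfl⟩
      · rcases Finset.mem_union.1 hX' with hX' | hX'
        · exact ⟨inl (some ⟨X, hX'⟩), rfl⟩
        · exact ⟨inr ⟨X, hX'⟩, rfl⟩
  have inner : ∀ X : Finset ι, X.Nonempty → X ⊂ S →
      par (insert S (H₁ ∪ H₂)) X = some (c (inl (par H₁ X))) := by
    intro X hX hXS
    have hno : ∀ T ∈ H₂, ¬ X ⊂ T := by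
      intro T hT hXT
      obtain ⟨x, hx⟩ := hX
      exact Finset.disjoint_left.1 (hd T hT) (hXS.1 hx) (hXT.1 hx)
    cases hp : par H₁ X with
    | none =>
      rw [par_eq_none h₁.2 hX] at hp
      refine par_eq_some.2 ⟨hXS, fun T hT hXT => ?_⟩
      simp only [Finset.mem_insert, Finset.mem_union] at hT
      rcases hT with rfl | hT | hT
      exacts [subset_rfl, absurd hXT (hp T hT), absurd hXT (hno T hT)]
    | some u =>
      rw [par_eq_some] at hp
      refine par_eq_some.2 ⟨hp.1, fun T hT hXT => ?_⟩
      simp only [Finset.mem_insert, Finset.mem_union] at hT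
      rcases hT with rfl | hT | hT
      exacts [h₁.1 u u.2, hp.2 T hT hXT, absurd hXT (hno T hT)]
  have outer : ∀ X : Finset ι, X.Nonempty → Disjoint X S →
      par (insert S (H₁ ∪ H₂)) X = (par H₂ X).map fun w => c (inr w) := by
    intro X hX hXS
    have hno : ∀ T ⊆ S, ¬ X ⊂ T := by
      intro T hT hXT
      obtain ⟨x, hx⟩ := hX
      exact Finset.disjoint_left.1 hXS hx (hT (hXT.1 hx))
    cases hp : par H₂ X with
    | none =>
      rw [par_eq_none h₂.2 hX] at hp
      refine (par_eq_none hL hX).2 fun T hT => ?_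
      simp only [Finset.mem_insert, Finset.mem_union] at hT
      rcases hT with rfl | hT | hT
      exacts [hno _ subset_rfl, hno T (h₁.1 T hT), hp T hT]
    | some u =>
      rw [par_eq_some] at hp
      refine par_eq_some.2 ⟨hp.1, fun T hT hXT => ?_⟩
      simp only [Finset.mem_insert, Finset.mem_union] at hT
      rcases hT with rfl | hT | hT
      exacts [absurd hXT (hno _ subset_rfl), absurd hXT (hno T (h₁.1 T hT)), hp.2 T hT hXT]
  refine forestVal_graft (Equiv.ofBijective c hc) hSR ?_ ?_ ?_ ?_ ?_ a W h
  · have hne : S.Nonempty := Finset.card_pos.1 (by omega)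
    refine (par_eq_none hL hne).2 fun T hT hXT => ?_
    simp only [Finset.mem_insert, Finset.mem_union] at hT
    rcases hT with rfl | hT | hT
    · exact hXT.2 subset_rfl
    · exact hXT.2 (h₁.1 T hT)
    · obtain ⟨x, hx⟩ := hne
      exact Finset.disjoint_left.1 (hd T hT) hx (hXT.1 hx)
  · intro v
    exact inner v (h₁.2.nonempty v.2)
      ((h₁.1 v v.2).ssubset_of_ne fun hv => hS1 (hv ▸ v.2))
  · intro v
    exact outer v (h₂.2.nonempty v.2) (hd v v.2).symm
  · intro l hl
    refine inner {l} (Finset.singleton_nonempty l)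
      ((Finset.singleton_subset_iff.2 hl).ssubset_of_ne ?_)
    rintro rfl
    simp at hS2
  · intro l hl
    exact outer {l} (Finset.singleton_nonempty l)
      (Finset.disjoint_singleton_left.2 (Finset.mem_sdiff.1 hl).2)

end Graft

/-- `S` is the largest member of `H` which contains `l`. -/
def IsTop (H : Finset (Finset ι)) (l : ι) (S : Finset ι) : Prop :=
  S ∈ H ∧ ∀ T ∈ H, l ∈ T → T ⊆ S

open Classical in
/-- The contribution to `forestSum` of the forests in which `S` is the leaf set of the branch
containing the leaf `l`. -/
theorem sum_laminarVal_branch {R S : Finset ι} (hSR : S ⊆ R) {l : ι} (hl : l ∈ S)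
    (hS2 : 2 ≤ S.card) (a : ι → Fin n) (W : Fin n → Multiset (Fin n) → ℂ)
    (h : Multiset (Fin n) → ℂ) :
    ∑ H ∈ laminarFamilies R with IsTop H l S,
      (-1) ^ H.card * laminarVal H R a W h =
    ∑ i, branchSum a W S i * forestSum (R \ S) a W fun A => h (i ::ₘ A) := by
  classical
  -- The extra 1 in the exponent counts the vertex `S`, whose sign is the minus in `branchSum`.
  have e1 : ∀ i, branchSum a W S i * forestSum (R \ S) a W (fun A => h (i ::ₘ A)) =
      ∑ x ∈ (laminarFamilies S).filter (S ∉ ·) ×ˢ laminarFamilies (R \ S),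
        (-1) ^ (x.1.card + x.2.card + 1) * (laminarVal x.1 S a W (W i) *
          laminarVal x.2 (R \ S) a W fun A => h (i ::ₘ A)) := by
    intro i
    rw [branchSum, if_neg (by omega), forestSum, neg_mul, Finset.sum_mul_sum,
      ← Finset.sum_product', ← Finset.sum_neg_distrib]
    refine Finset.sum_congr rfl fun x _ => ?_
    ring
  simp only [e1]
  rw [Finset.sum_comm]
  symm
  -- A member other than `S` is strictly inside `S` or disjoint from it: one strictly containing `S`
  -- would contain `l` and contradict maximality.
  refine Finset.sum_bij' (fun x _ => insert S (x.1 ∪ x.2))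
    (fun H _ => (H.filter (· ⊂ S), H.filter (Disjoint S ·))) ?_ ?_ ?_ ?_ ?_
  · rintro ⟨H₁, H₂⟩ hx
    simp only [Finset.mem_product, Finset.mem_filter] at hx
    obtain ⟨⟨h₁, hS1⟩, h₂⟩ := hx
    have hL := laminar_graft h₁ h₂ hS2
    rw [mem_laminarFamilies] at h₁ h₂
    simp only [Finset.mem_filter, mem_laminarFamilies]
    refine ⟨⟨fun T hT => ?_, hL⟩, Finset.mem_insert_self _ _, fun T hT hlT => ?_⟩ <;>
      simp only [Finset.mem_insert, Finset.mem_union] at hT <;> rcases hT with rfl | hT | hT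
    · exact hSR
    · exact (h₁.1 T hT).trans hSR
    · exact (h₂.1 T hT).trans Finset.sdiff_subset
    · exact subset_rfl
    · exact h₁.1 T hT
    · exact absurd hl (Finset.mem_sdiff.1 (h₂.1 T hT hlT)).2
  · intro H hH
    simp only [Finset.mem_filter, mem_laminarFamilies] at hH
    obtain ⟨⟨hR, hL⟩, -⟩ := hH
    simp only [Finset.mem_product, Finset.mem_filter, mem_laminarFamilies]
    refine ⟨⟨⟨fun T hT => hT.2.1, hL.mono (Finset.filter_subset _ _)⟩, fun hT => hT.2.2 subset_rfl⟩,
      fun T hT => ?_, hL.mono (Finset.filter_subset _ _)⟩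
    intro x hx
    exact Finset.mem_sdiff.2 ⟨hR T hT.1 hx, Finset.disjoint_right.1 hT.2 hx⟩
  · rintro ⟨H₁, H₂⟩ hx
    simp only [Finset.mem_product, Finset.mem_filter, mem_laminarFamilies] at hx
    obtain ⟨⟨⟨h₁, hL₁⟩, hS1⟩, h₂, hL₂⟩ := hx
    have d2 : ∀ Y ∈ H₂, Disjoint S Y := fun Y hY =>
      Finset.disjoint_left.2 fun x hx hy => (Finset.mem_sdiff.1 (h₂ Y hY hy)).2 hx
    have n2 : ∀ Y ∈ H₂, ¬ Y ⊆ S := fun Y hY hYS => by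
      obtain ⟨x, hx⟩ := hL₂.nonempty hY
      exact Finset.disjoint_left.1 (d2 Y hY) (hYS hx) hx
    have n1 : ∀ Y ∈ H₁, ¬ Disjoint S Y := fun Y hY hYS => by
      obtain ⟨x, hx⟩ := hL₁.nonempty hY
      exact Finset.disjoint_left.1 hYS (h₁ Y hY hx) hx
    ext T
    · simp only [Finset.mem_filter, Finset.mem_insert, Finset.mem_union]
      constructor
      · rintro ⟨rfl | hT | hT, hTS⟩
        exacts [absurd subset_rfl hTS.2, hT, absurd hTS.1 (n2 T hT)]
      · intro hT
        exact ⟨Or.inr (Or.inl hT), (h₁ T hT).ssubset_of_ne fun hv => hS1 (hv ▸ hT)⟩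
    · simp only [Finset.mem_filter, Finset.mem_insert, Finset.mem_union]
      constructor
      · rintro ⟨rfl | hT | hT, hTS⟩
        exacts [absurd hl (Finset.disjoint_left.1 hTS hl), absurd hTS (n1 T hT), hT]
      · intro hT
        exact ⟨Or.inr (Or.inr hT), d2 T hT⟩
  · intro H hH
    simp only [Finset.mem_filter, mem_laminarFamilies] at hH
    obtain ⟨⟨hR, hL⟩, hS, hmax⟩ := hH
    ext T
    simp only [Finset.mem_filter, Finset.mem_insert, Finset.mem_union]
    constructor
    · rintro (rfl | hT | hT)
      exacts [hS, hT.1, hT.1]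
    · intro hT
      rcases hL.2 T hT S hS with h1 | h1 | h1
      · rcases eq_or_ne T S with rfl | hne
        · exact Or.inl rfl
        · exact Or.inr (Or.inl ⟨hT, h1.ssubset_of_ne hne⟩)
      · exact Or.inl (subset_antisymm (hmax T hT (h1 hl)) h1)
      · exact Or.inr (Or.inr ⟨hT, h1.symm⟩)
  · rintro ⟨H₁, H₂⟩ hx
    simp only [Finset.mem_product, Finset.mem_filter] at hx
    obtain ⟨⟨h₁, hS1⟩, h₂⟩ := hx
    rw [laminarVal_graft h₁ h₂ hS1 hS2 hSR, ← Finset.mul_sum]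
    rw [mem_laminarFamilies] at h₁ h₂
    have hS3 : S ∉ H₂ := fun hS => (Finset.mem_sdiff.1 (h₂.1 S hS hl)).2 hl
    have hdisj : Disjoint H₁ H₂ := by
      refine Finset.disjoint_left.2 fun T hT hT' => ?_
      obtain ⟨x, hx⟩ := h₁.2.nonempty hT
      exact (Finset.mem_sdiff.1 (h₂.1 T hT' hx)).2 (h₁.1 T hT hx)
    rw [Finset.card_insert_of_notMem (by simp [hS1, hS3]), Finset.card_union_of_disjoint hdisj]

theorem forestSum_empty (a : ι → Fin n) (W : Fin n → Multiset (Fin n) → ℂ)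
    (h : Multiset (Fin n) → ℂ) : forestSum ∅ a W h = h 0 := by
  simp [forestSum, laminarFamilies_empty, laminarVal, forestVal, childIdx]

/-- Forests are sorted by the leaf set `insert l S` of the root branch containing `l`: a bare leaf
when `S` is empty, otherwise the largest member through `l`. The iterated chain rule satisfies a
recursion of the same shape. -/
theorem forestSum_rec {R : Finset ι} {l : ι} (hl : l ∈ R) (a : ι → Fin n)
    (W : Fin n → Multiset (Fin n) → ℂ) (h : Multiset (Fin n) → ℂ) :
    forestSum R a W h = ∑ S ∈ (R \ {l}).powerset, ∑ i, branchSum a W (insert l S) i *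
      forestSum (R \ insert l S) a W fun A => h (i ::ₘ A) := by
  classical
  -- The union of the members through `l`, without `l` itself. It is empty exactly when `l` hangs
  -- directly from the root, because members have at least two elements.
  let top : Finset (Finset ι) → Finset ι := fun H => (H.filter (l ∈ ·)).sup id \ {l}
  have hmem : ∀ H x, x ∈ top H ↔ (∃ T ∈ H, l ∈ T ∧ x ∈ T) ∧ x ≠ l := by
    intro H x
    simp [top, Finset.mem_sup, and_assoc]
  have hmaps : ∀ H ∈ laminarFamilies R, top H ∈ (R \ {l}).powerset := by
    intro H hH
    rw [mem_laminarFamilies] at hH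
    refine Finset.mem_powerset.2 fun x hx => ?_
    obtain ⟨⟨T, hT, -, hxT⟩, hxl⟩ := (hmem H x).1 hx
    exact Finset.mem_sdiff.2 ⟨hH.1 T hT hxT, by simpa using hxl⟩
  rw [forestSum, ← Finset.sum_fiberwise_of_maps_to hmaps]
  refine Finset.sum_congr rfl fun S hS => ?_
  rw [Finset.mem_powerset] at hS
  have hlS : l ∉ S := fun h => by simpa using (Finset.mem_sdiff.1 (hS h)).2
  have hSR : insert l S ⊆ R :=
    Finset.insert_subset hl (hS.trans Finset.sdiff_subset)
  rcases S.eq_empty_or_nonempty with rfl | hne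
  · have hb : ∀ i, branchSum a W (insert l ∅) i = if i = a l then 1 else 0 := by
      intro i
      rw [insert_empty_eq, branchSum, if_pos (Finset.card_singleton l), Finset.sum_singleton]
    simp only [hb, ite_mul, one_mul, zero_mul, Finset.sum_ite_eq', Finset.mem_univ, if_true]
    rw [forestSum]
    simp only [insert_empty_eq]
    have hno : ∀ H : Finset (Finset ι), Laminar H → (top H = ∅ ↔ ∀ T ∈ H, l ∉ T) := by
      intro H hH
      constructor
      · intro h0 T hT hlT
        have h2 := hH.1 T hT
        obtain ⟨x, hx, hxl⟩ := Finset.exists_mem_ne (by omega : 1 < T.card) l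
        have := (hmem H x).2 ⟨⟨T, hT, hlT, hx⟩, hxl⟩
        rw [h0] at this
        simp at this
      · intro h0
        refine Finset.eq_empty_of_forall_notMem fun x hx => ?_
        obtain ⟨⟨T, hT, hlT, -⟩, -⟩ := (hmem H x).1 hx
        exact h0 T hT hlT
    have hset : (laminarFamilies R).filter (top · = ∅) = laminarFamilies (R \ {l}) := by
      ext H
      rw [Finset.mem_filter, mem_laminarFamilies, mem_laminarFamilies]
      constructor
      · rintro ⟨⟨h1, h2⟩, h3⟩
        rw [hno H h2] at h3
        refine ⟨fun T hT x hx => Finset.mem_sdiff.2 ⟨h1 T hT hx, ?_⟩, h2⟩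
        rw [Finset.mem_singleton]
        rintro rfl
        exact h3 T hT hx
      · rintro ⟨h1, h2⟩
        refine ⟨⟨fun T hT => (h1 T hT).trans Finset.sdiff_subset, h2⟩, (hno H h2).2 ?_⟩
        intro T hT hlT
        simpa using (Finset.mem_sdiff.1 (h1 T hT hlT)).2
    rw [hset]
    refine Finset.sum_congr rfl fun H hH => ?_
    rw [mem_laminarFamilies] at hH
    congr 1
    refine forestVal_insert hl ((par_eq_none hH.2 (Finset.singleton_nonempty l)).2 ?_) a W h
    intro T hT hlT
    simpa using (Finset.mem_sdiff.1 (hH.1 T hT (hlT.1 (Finset.mem_singleton_self l)))).2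
  · have hcard : 2 ≤ (insert l S).card := by
      rw [Finset.card_insert_of_notMem hlS]
      have := Finset.card_pos.2 hne
      omega
    rw [← sum_laminarVal_branch hSR (Finset.mem_insert_self l S) hcard a W h]
    refine Finset.sum_congr ?_ fun _ _ => rfl
    ext H
    rw [Finset.mem_filter, Finset.mem_filter, mem_laminarFamilies]
    refine and_congr_right fun hH => ?_
    constructor
    · intro hS'
      obtain ⟨x, hx⟩ := hne
      rw [← hS', hmem] at hx
      obtain ⟨⟨T, hT, hlT, -⟩, -⟩ := hx
      -- Members through `l` are pairwise nested, so one of largest cardinality contains the others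
      -- and is their union.
      obtain ⟨T, hT, hmax⟩ := Finset.exists_max_image (H.filter (l ∈ ·)) Finset.card
        ⟨T, by simp [hT, hlT]⟩
      rw [Finset.mem_filter] at hT
      have hbig : ∀ T' ∈ H, l ∈ T' → T' ⊆ T := by
        intro T' hT' hlT'
        rcases hH.2.2 T' hT' T hT.1 with h1 | h1 | h1
        · exact h1
        · exact (Finset.eq_of_subset_of_card_le h1 (hmax T' (by simp [hT', hlT']))).ge
        · exact absurd hT.2 (Finset.disjoint_left.1 h1 hlT')
      have : insert l S = T := by
        rw [← hS']
        ext y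
        rw [Finset.mem_insert, hmem]
        constructor
        · rintro (rfl | ⟨⟨T', hT', hlT', hy⟩, -⟩)
          · exact hT.2
          · exact hbig T' hT' hlT' hy
        · intro hy
          by_cases hyl : y = l
          · exact Or.inl hyl
          · exact Or.inr ⟨⟨T, hT.1, hT.2, hy⟩, hyl⟩
      rw [this]
      exact ⟨hT.1, hbig⟩
    · rintro ⟨h1, h2⟩
      ext y
      rw [hmem]
      constructor
      · rintro ⟨⟨T, hT, hlT, hy⟩, hyl⟩
        exact Finset.mem_of_mem_insert_of_ne (h2 T hT hlT hy) hyl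
      · intro hy
        exact ⟨⟨_, h1, Finset.mem_insert_self l S, Finset.mem_insert_of_mem hy⟩,
          fun hyl => hlS (hyl ▸ hy)⟩

/-- The trees with leaf set `R` and the forests with at least two branches cancel. -/
theorem forestSum_vertex {R : Finset ι} (hR : 2 ≤ R.card) (a : ι → Fin n)
    (W : Fin n → Multiset (Fin n) → ℂ) (hW : ∀ i j, W i {j} = if i = j then 1 else 0)
    (i : Fin n) : forestSum R a W (W i) = 0 := by
  classical
  obtain ⟨l, hl⟩ : R.Nonempty := Finset.card_pos.1 (by omega)
  rw [forestSum, ← Finset.sum_filter_add_sum_filter_not _ (R ∈ ·)]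
  -- A family containing `R` has one root branch and no remaining leaves, so the root factor is `W i
  -- {j} = δ_ij` and these families contribute `branchSum a W R i`. The other families sum to its
  -- negative by definition.
  have h1 : ∑ H ∈ laminarFamilies R with R ∈ H, (-1) ^ H.card * laminarVal H R a W (W i) =
      ∑ j, branchSum a W R j * forestSum (R \ R) a W fun A => W i (j ::ₘ A) := by
    rw [← sum_laminarVal_branch subset_rfl hl hR]
    refine Finset.sum_congr ?_ fun _ _ => rfl
    ext H
    rw [Finset.mem_filter, Finset.mem_filter, mem_laminarFamilies]
    exact ⟨fun h => ⟨h.1, h.2, fun T hT _ => h.1.1 T hT⟩, fun h => ⟨h.1, h.2.1⟩⟩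
  rw [h1]
  simp only [sdiff_self, Finset.bot_eq_empty, forestSum_empty, Multiset.cons_zero, hW, mul_ite,
    mul_one, mul_zero, Finset.sum_ite_eq, Finset.mem_univ, if_true]
  rw [branchSum, if_neg (by omega)]
  exact neg_add_cancel _

end LaminarFamily

/-! ### Iterated derivatives of composite functions -/

section Composition

open Finset

variable {n : ℕ} {ι : Type*}

theorem foldr_cons_eq {α β : Type*} (f : α → β → β) [LeftCommutative f] (b : β) (x : α)
    (s : Multiset α) : (x ::ₘ s).foldr f b = s.foldr f (f x b) := by
  rw [← Multiset.singleton_add, add_comm, Multiset.foldr_add, Multiset.foldr_singleton]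

/-! ### The recursion of the iterated chain rule and its inversion -/

section Recursion

variable [DecidableEq ι] {𝒞 : Type*} (d : Fin n → 𝒞 → 𝒞) [LeftCommutative d] (ev : 𝒞 → ℂ)
  (ℰ : Finset ι → 𝒞 → ℂ) (ζ : Finset ι → Fin n → ℂ) (a : ι → Fin n)

/-- `ℰ R h` models the derivative of a composite along `R`, and `ζ S i` the derivative of the `i`-th
inner component along `S`. Once the coefficients are branch sums, `hrec` is the recursion
`forestSum_rec`, so induction on `R.card` applies. -/
theorem eq_forestSum_of_rec {W : Fin n → Multiset (Fin n) → ℂ} (h0 : ∀ h, ℰ ∅ h = ev h)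
    (hrec : ∀ R l, l ∈ R → ∀ h, ℰ R h = ∑ S ∈ (R \ {l}).powerset, ∑ i,
      ζ (insert l S) i * ℰ (R \ insert l S) (d i h)) (R : Finset ι)
    (hζ : ∀ S ⊆ R, S.Nonempty → ∀ i, ζ S i = branchSum a W S i) (h : 𝒞) :
    ℰ R h = forestSum R a W fun B => ev (B.foldr d h) := by
  induction hR : R.card using Nat.strong_induction_on generalizing R h with
  | _ N ih =>
    rcases R.eq_empty_or_nonempty with rfl | ⟨l, hl⟩
    · rw [h0, forestSum_empty, Multiset.foldr_zero]
    · rw [hrec R l hl, forestSum_rec hl]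
      refine Finset.sum_congr rfl fun S hS => Finset.sum_congr rfl fun i _ => ?_
      have hS' : insert l S ⊆ R :=
        Finset.insert_subset hl ((Finset.mem_powerset.1 hS).trans Finset.sdiff_subset)
      rw [hζ _ hS' (Finset.insert_nonempty l S),
        ih _ (hR ▸ Finset.card_lt_card (Finset.sdiff_ssubset hS' (Finset.insert_nonempty l S))) _
          (fun T hT => hζ T (hT.trans Finset.sdiff_subset)) _ rfl]
      simp only [foldr_cons_eq]

/-- Lagrange inversion. For `2 ≤ R.card` the recursion evaluated on `y i` vanishes by `hlin`; its
term `S = R \ {l}` is `ζ R i`, and all other terms involve smaller sets only. `forestSum_vertex`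
gives the same relation for `branchSum`, so the two agree by induction on `R.card`. -/
theorem eq_branchSum_of_rec (h0 : ∀ h, ℰ ∅ h = ev h)
    (hrec : ∀ R l, l ∈ R → ∀ h, ℰ R h = ∑ S ∈ (R \ {l}).powerset, ∑ i,
      ζ (insert l S) i * ℰ (R \ insert l S) (d i h))
    (hζ : ∀ l i, ζ {l} i = if i = a l then 1 else 0) (y : Fin n → 𝒞)
    (hy : ∀ i j, ev (d j (y i)) = if i = j then 1 else 0)
    (hlin : ∀ R : Finset ι, 2 ≤ R.card → ∀ i, ℰ R (y i) = 0)
    (R : Finset ι) (hR : R.Nonempty) (i : Fin n) :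
    ζ R i = branchSum a (fun i B => ev (B.foldr d (y i))) R i := by
  set W : Fin n → Multiset (Fin n) → ℂ := fun i B => ev (B.foldr d (y i)) with hW
  induction hN : R.card using Nat.strong_induction_on generalizing R i with
  | _ N ih =>
    obtain ⟨l, hl⟩ := hR
    rcases Nat.lt_or_ge R.card 2 with h1 | h2
    · replace h1 : R.card = 1 := by
        have := Finset.card_pos.2 ⟨l, hl⟩
        omega
      obtain rfl : R = {l} := by
        obtain ⟨x, rfl⟩ := Finset.card_eq_one.1 h1
        rw [Finset.mem_singleton.1 hl]
      rw [hζ, branchSum, if_pos h1, Finset.sum_singleton]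
    · have e1 := hlin R h2 i
      have e2 := forestSum_vertex h2 a W (fun i j => by
        simp only [hW, Multiset.foldr_singleton, hy]) i
      rw [hrec R l hl] at e1
      rw [forestSum_rec hl] at e2
      have hmem : R \ {l} ∈ (R \ {l}).powerset := Finset.mem_powerset_self _
      have hins : insert l (R \ {l}) = R := by
        rw [Finset.sdiff_singleton_eq_erase, Finset.insert_erase hl]
      rw [← Finset.add_sum_erase _ _ hmem, hins] at e1 e2
      have e3 : ∑ j, ζ R j * ℰ (R \ R) (d j (y i)) = ζ R i := by
        simp [h0, hy]
      have e4 : ∑ j, branchSum a W R j * forestSum (R \ R) a W (fun A => W i (j ::ₘ A)) =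
          branchSum a W R i := by
        simp [forestSum_empty, hW, hy]
      rw [e3] at e1
      rw [e4] at e2
      rw [eq_neg_of_add_eq_zero_left e1, eq_neg_of_add_eq_zero_left e2, neg_inj]
      refine Finset.sum_congr rfl fun S hS => Finset.sum_congr rfl fun j _ => ?_
      rw [Finset.mem_erase, Finset.mem_powerset] at hS
      have hSR : insert l S ⊂ R := by
        refine (Finset.insert_subset hl (hS.2.trans Finset.sdiff_subset)).ssubset_of_ne ?_
        rintro rfl
        refine hS.1 (subset_antisymm hS.2 fun x hx => ?_)
        rw [Finset.mem_sdiff, Finset.mem_singleton] at hx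
        exact Finset.mem_of_mem_insert_of_ne hx.1 hx.2
      have hlt := hN ▸ Finset.card_lt_card hSR
      rw [ih _ hlt _ (Finset.insert_nonempty l S) _ rfl,
        eq_forestSum_of_rec d ev ℰ ζ a h0 hrec (W := W)]
      · simp only [foldr_cons_eq, hW]
      -- Sets inside `R \ insert l S` miss `l`, so they are proper subsets of `R` and the induction
      -- hypothesis covers them.
      · intro T hT hTne q
        refine ih _ ?_ T hTne q rfl
        rw [← hN]
        refine Finset.card_lt_card ((hT.trans Finset.sdiff_subset).ssubset_of_ne ?_)
        rintro rfl
        exact (Finset.mem_sdiff.1 (hT hl)).2 (Finset.mem_insert_self l S)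

end Recursion

/-! ### Iterated derivations of composite functions -/

section Algebra

variable {A : Type*} [CommRing A] (D : ι → A →+ A) [LeftCommutative fun l α => D l α]

/-- The iterated derivative `∏_{l ∈ R} D l`. -/
def iterOn (R : Finset ι) (α : A) : A := R.val.foldr (fun l α => D l α) α

@[simp]
theorem iterOn_empty (α : A) : iterOn D ∅ α = α := rfl

theorem iterOn_insert [DecidableEq ι] {R : Finset ι} {l : ι} (hl : l ∉ R) (α : A) :
    iterOn D (insert l R) α = D l (iterOn D R α) := by
  rw [iterOn, Finset.insert_val_of_notMem hl, Multiset.foldr_cons, iterOn]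

theorem iterOn_insert' [DecidableEq ι] {R : Finset ι} {l : ι} (hl : l ∉ R) (α : A) :
    iterOn D (insert l R) α = iterOn D R (D l α) := by
  rw [iterOn, Finset.insert_val_of_notMem hl, foldr_cons_eq, iterOn]

theorem iterOn_add (R : Finset ι) (α β : A) :
    iterOn D R (α + β) = iterOn D R α + iterOn D R β := by
  classical
  induction R using Finset.induction_on with
  | empty => rfl
  | insert l R hl ih => simp only [iterOn_insert D hl, ih, map_add]

theorem iterOn_zero (R : Finset ι) : iterOn D R 0 = 0 := by
  simpa using iterOn_add D R 0 0

theorem iterOn_sum {κ : Type*} (R : Finset ι) (s : Finset κ) (α : κ → A) :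
    iterOn D R (∑ i ∈ s, α i) = ∑ i ∈ s, iterOn D R (α i) :=
  map_sum (AddMonoidHom.mk' (iterOn D R) (iterOn_add D R)) α s

theorem iterOn_mul [DecidableEq ι] (hmul : ∀ l α β, D l (α * β) = D l α * β + α * D l β)
    (R : Finset ι) (α β : A) :
    iterOn D R (α * β) = ∑ S ∈ R.powerset, iterOn D S α * iterOn D (R \ S) β := by
  induction R using Finset.induction_on with
  | empty => simp
  | insert l R hl ih =>
    rw [iterOn_insert D hl, ih, map_sum, Finset.sum_powerset_insert hl, add_comm,
      ← Finset.sum_add_distrib]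
    refine Finset.sum_congr rfl fun S hS => ?_
    have hlS : l ∉ S := fun h => hl (Finset.mem_powerset.1 hS h)
    rw [hmul, iterOn_insert D hlS, Finset.insert_sdiff_insert,
      Finset.insert_sdiff_of_notMem _ hlS, Finset.sdiff_insert_of_notMem hl,
      iterOn_insert D (fun h => hl (Finset.mem_sdiff.1 h).1)]

theorem iterOn_mul_of_const (hmul : ∀ l α β, D l (α * β) = D l α * β + α * D l β)
    (R : Finset ι) {α : A} (hα : ∀ l, D l α = 0) (β : A) :
    iterOn D R (α * β) = α * iterOn D R β := by
  classical
  induction R using Finset.induction_on with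
  | empty => rfl
  | insert l R hl ih => rw [iterOn_insert D hl, iterOn_insert D hl, ih, hmul, hα, zero_mul, zero_add]

/-- The iterated derivatives of composite functions `C h` are sums over forests. The chain rule
`hchain` involves the components `Z i` of the inner map; `y` are functions which are linear
after composition. -/
theorem iterOn_comp [DecidableEq ι] (hmul : ∀ l α β, D l (α * β) = D l α * β + α * D l β)
    {𝒞 : Type*} (d : Fin n → 𝒞 → 𝒞) [LeftCommutative d] (C : 𝒞 → A) (Z : Fin n → A)
    (hchain : ∀ l h, D l (C h) = ∑ i, D l (Z i) * C (d i h)) (a : ι → Fin n)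
    (ev : A →+* ℂ) (Λ : A →+ ℂ)
    (hΛ : ∀ (S : Finset ι), S.Nonempty → ∀ i β,
      Λ (iterOn D S (Z i) * β) = ev (iterOn D S (Z i)) * Λ β)
    (hZ : ∀ l i, ev (D l (Z i)) = if i = a l then 1 else 0) (y : Fin n → 𝒞)
    (hy : ∀ i j, ev (C (d j (y i))) = if i = j then 1 else 0)
    (hlin : ∀ l l' i, D l (D l' (C (y i))) = 0) (R : Finset ι) (h : 𝒞) :
    Λ (iterOn D R (C h)) =
      forestSum R a (fun i B => ev (C (B.foldr d (y i)))) fun B => Λ (C (B.foldr d h)) := by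
  -- `D l` is expanded by the chain rule and the remaining derivations by the Leibniz rule; `S`
  -- collects those that fall on `D l (Z i)`.
  have hrec : ∀ R l, l ∈ R → ∀ h, iterOn D R (C h) = ∑ S ∈ (R \ {l}).powerset, ∑ i,
      iterOn D (insert l S) (Z i) * iterOn D (R \ insert l S) (C (d i h)) := by
    intro R l hl h
    have hl' : l ∉ R \ {l} := by simp
    conv_lhs => rw [← Finset.insert_erase hl, ← Finset.sdiff_singleton_eq_erase]
    rw [iterOn_insert' D hl', hchain, iterOn_sum, Finset.sum_comm]
    refine Finset.sum_congr rfl fun i _ => ?_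
    rw [iterOn_mul D hmul]
    refine Finset.sum_congr rfl fun S hS => ?_
    have hlS : l ∉ S := fun h => hl' (Finset.mem_powerset.1 hS h)
    rw [iterOn_insert' D hlS, sdiff_sdiff_left]
    rfl
  -- The coefficients involve only `Z`, so they are inverted with the ring homomorphism `ev`. `Λ`
  -- acts at the root alone and need only be linear over these coefficients, which leaves room for
  -- further derivatives inside it.
  refine eq_forestSum_of_rec d (fun h => Λ (C h)) (fun R h => Λ (iterOn D R (C h)))
    (fun S i => ev (iterOn D S (Z i))) a (fun h => rfl) ?_ R ?_ h
  · intro R l hl h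
    rw [hrec R l hl, map_sum]
    refine Finset.sum_congr rfl fun S _ => ?_
    rw [map_sum]
    exact Finset.sum_congr rfl fun i _ => hΛ _ (Finset.insert_nonempty l S) _ _
  · intro S _ hS i
    refine eq_branchSum_of_rec d (fun h => ev (C h)) (fun R h => ev (iterOn D R (C h)))
      (fun S i => ev (iterOn D S (Z i))) a (fun h => rfl) ?_ ?_ y hy ?_ S hS i
    · intro R l hl h
      rw [hrec R l hl, map_sum]
      simp only [map_sum, map_mul]
    · intro l i
      rw [← hZ, ← insert_empty_eq, iterOn_insert D (Finset.notMem_empty l), iterOn_empty]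
    · intro R hR i
      obtain ⟨l, hl, l', hl', hne⟩ := Finset.one_lt_card.1 hR
      have h1 : iterOn D R (C (y i)) = 0 := by
        rw [← Finset.insert_erase hl, iterOn_insert' D (Finset.notMem_erase l R),
          ← Finset.insert_erase (Finset.mem_erase.2 ⟨hne.symm, hl'⟩),
          iterOn_insert' D (Finset.notMem_erase _ _), hlin, iterOn_zero]
      rw [h1, map_zero]

end Algebra

end Composition

/-! ### Wirtinger derivatives -/

section Wirtinger

open Complex TopologicalSpace

variable {n : ℕ}

/-- The derivative `(∂_u h + s √-1 ∂_{√-1 u} h) / 2`: it is holomorphic for `s = -1` and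
antiholomorphic for `s = 1`. -/
def wirt (s : ℂ) (u : Fin n → ℂ) (h : (Fin n → ℂ) → ℂ) : (Fin n → ℂ) → ℂ := fun z =>
  (fderiv ℝ h z u + s * I * fderiv ℝ h z (I • u)) / 2

theorem dz_eq_wirt (i : Fin n) : dz i = wirt (-1) (Pi.single i 1) := by
  funext h z
  simp only [dz, wirt, ← Pi.single_smul, smul_eq_mul, mul_one, neg_mul, one_mul, sub_eq_add_neg]

theorem dzbar_eq_wirt (i : Fin n) : dzbar i = wirt 1 (Pi.single i 1) := by
  funext h z
  simp only [dzbar, wirt, ← Pi.single_smul, smul_eq_mul, mul_one, one_mul]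

theorem wirt_congr {h k : (Fin n → ℂ) → ℂ} {z : Fin n → ℂ} (hk : h =ᶠ[nhds z] k) (s : ℂ)
    (u : Fin n → ℂ) : wirt s u h =ᶠ[nhds z] wirt s u k := by
  filter_upwards [hk.fderiv (𝕜 := ℝ)] with w hw
  simp only [wirt, hw]

theorem wirt_conj {s : ℂ} (hs : conj s = s) (u : Fin n → ℂ) (h : (Fin n → ℂ) → ℂ)
    (z : Fin n → ℂ) : wirt s u (fun w => conj (h w)) z = conj (wirt (-s) u h z) := by
  have : ∀ v, fderiv ℝ (fun w => conj (h w)) z v = conj (fderiv ℝ h z v) := by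
    intro v
    have := ContinuousLinearEquiv.comp_fderiv (𝕜 := ℝ) Complex.conjCLE (f := h) (x := z)
    have h2 := congrArg (fun L => L v) this
    simpa [Function.comp_def] using h2
  simp only [wirt, this, map_div₀, map_add, map_mul, map_neg, hs, conj_I, map_ofNat]
  ring

theorem realLinear_sub_eq_sum (L : (Fin n → ℂ) →L[ℝ] ℂ) {s : ℂ} (m : Fin n → ℂ) :
    L m + s * I * L (I • m) = ∑ i,
      ((m i).re * (L (Pi.single i 1) + s * I * L (I • Pi.single i 1)) +
        (m i).im * (L (I • Pi.single i 1) - s * I * L (Pi.single i 1))) := by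
  have hm : m = ∑ i, ((m i).re • (Pi.single i 1 : Fin n → ℂ) +
      (m i).im • (I • (Pi.single i 1 : Fin n → ℂ))) := by
    funext j
    simp only [Finset.sum_apply, Pi.add_apply, Pi.smul_apply, Pi.single_apply, Complex.real_smul,
      smul_eq_mul]
    rw [Finset.sum_eq_single j]
    · simp
    · intro i _ hij
      simp [hij.symm]
    · simp
  have hIm : I • m = ∑ i, ((m i).re • (I • (Pi.single i 1 : Fin n → ℂ)) -
      (m i).im • ((Pi.single i 1 : Fin n → ℂ))) := by
    conv_lhs => rw [hm]
    rw [Finset.smul_sum]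
    refine Finset.sum_congr rfl fun i _ => ?_
    rw [smul_add, smul_comm I (m i).re, smul_comm I (m i).im, smul_smul I I, I_mul_I, neg_one_smul,
      smul_neg, sub_eq_add_neg]
  have h1 := congrArg L hm
  have h2 := congrArg L hIm
  simp only [map_sum, map_add, map_sub, map_smul, Complex.real_smul] at h1 h2
  rw [h1, h2, Finset.mul_sum, ← Finset.sum_add_distrib]
  refine Finset.sum_congr rfl fun i _ => ?_
  ring

theorem holomorphicPart_eq_sum (L : (Fin n → ℂ) →L[ℝ] ℂ) (m : Fin n → ℂ) :
    L m + -1 * I * L (I • m) =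
      ∑ i, m i * (L (Pi.single i 1) + -1 * I * L (I • Pi.single i 1)) := by
  rw [realLinear_sub_eq_sum]
  refine Finset.sum_congr rfl fun i _ => ?_
  conv_rhs => rw [← re_add_im (m i)]
  linear_combination ((m i).im * L (I • Pi.single i 1)) * I_sq

theorem antiholomorphicPart_eq_sum (L : (Fin n → ℂ) →L[ℝ] ℂ) (m : Fin n → ℂ) :
    L m + 1 * I * L (I • m) =
      ∑ i, conj (m i) * (L (Pi.single i 1) + 1 * I * L (I • Pi.single i 1)) := by
  rw [realLinear_sub_eq_sum]
  refine Finset.sum_congr rfl fun i _ => ?_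
  have : conj (m i) = (m i).re - (m i).im * I := by
    apply Complex.ext <;> simp
  rw [this]
  linear_combination ((m i).im * L (I • Pi.single i 1)) * I_sq

/-- The algebra of functions which are smooth on `U`. -/
def Smooth (U : Opens (Fin n → ℂ)) : Subalgebra ℂ ((Fin n → ℂ) → ℂ) where
  carrier := {h | ContDiffOn ℝ ∞ h U}
  mul_mem' h k := ContDiffOn.mul h k
  add_mem' h k := ContDiffOn.add h k
  algebraMap_mem' _ := contDiffOn_const

variable {U V : Opens (Fin n → ℂ)}

theorem contDiffAt_smooth (h : Smooth U) {z : Fin n → ℂ} (hz : z ∈ U) :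
    ContDiffAt ℝ ∞ h.1 z :=
  ContDiffOn.contDiffAt h.2 (U.isOpen.mem_nhds hz)

theorem differentiableAt_smooth (h : Smooth U) {z : Fin n → ℂ} (hz : z ∈ U) :
    DifferentiableAt ℝ h.1 z :=
  (contDiffAt_smooth h hz).differentiableAt (by simp)

theorem contDiffOn_wirt {h : (Fin n → ℂ) → ℂ} (hh : ContDiffOn ℝ ∞ h U) (s : ℂ)
    (u : Fin n → ℂ) : ContDiffOn ℝ ∞ (wirt s u h) U := by
  have h1 : ContDiffOn ℝ ∞ (fderiv ℝ h) U := hh.fderiv_of_isOpen U.isOpen (by simp)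
  unfold wirt
  exact ((h1.clm_apply contDiffOn_const).add
    (contDiffOn_const.mul (h1.clm_apply contDiffOn_const))).div_const 2

/-- The operator `wirt` on smooth functions. -/
def wirtOp (U : Opens (Fin n → ℂ)) (s : ℂ) (u : Fin n → ℂ) : Smooth U →ₗ[ℂ] Smooth U where
  -- Elements of `Smooth U` are arbitrary outside `U`. Extending derivatives by zero makes
  -- identities that hold on `U` into equalities of functions.
  toFun h := ⟨(U : Set (Fin n → ℂ)).indicator (wirt s u h.1),
    (contDiffOn_wirt h.2 s u).congr fun _ hz => Set.indicator_of_mem hz _⟩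
  map_add' h k := by
    ext z
    by_cases hz : z ∈ (U : Set (Fin n → ℂ))
    · simp only [AddMemClass.coe_add, Pi.add_apply, Set.indicator_of_mem hz, wirt]
      rw [fderiv_add (differentiableAt_smooth h hz) (differentiableAt_smooth k hz)]
      simp only [_root_.add_apply]
      ring
    · simp [Set.indicator_of_notMem hz]
  map_smul' c h := by
    ext z
    by_cases hz : z ∈ (U : Set (Fin n → ℂ))
    · simp only [SetLike.val_smul, Pi.smul_apply, Set.indicator_of_mem hz, wirt, RingHom.id_apply]
      rw [fderiv_const_smul (differentiableAt_smooth h hz)]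
      simp only [_root_.smul_apply, smul_eq_mul]
      ring
    · simp [Set.indicator_of_notMem hz]

theorem wirtOp_apply {z : Fin n → ℂ} (hz : z ∈ U) (s : ℂ) (u : Fin n → ℂ) (h : Smooth U) :
    (wirtOp U s u h).1 z = wirt s u h.1 z :=
  Set.indicator_of_mem (show z ∈ (U : Set (Fin n → ℂ)) from hz) _

theorem Smooth.ext_wirtOp {h k : Smooth U} {s : ℂ} {u : Fin n → ℂ}
    (hk : ∀ z ∈ U, (wirtOp U s u h).1 z = k.1 z) (h0 : ∀ z ∉ U, k.1 z = 0) :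
    wirtOp U s u h = k := by
  ext z
  by_cases hz : z ∈ U
  · exact hk z hz
  · rw [h0 z hz]
    exact Set.indicator_of_notMem (show z ∉ (U : Set (Fin n → ℂ)) from hz) _

theorem wirtOp_apply_of_notMem {z : Fin n → ℂ} (hz : z ∉ U) (s : ℂ) (u : Fin n → ℂ)
    (h : Smooth U) : (wirtOp U s u h).1 z = 0 :=
  Set.indicator_of_notMem (show z ∉ (U : Set (Fin n → ℂ)) from hz) _

theorem wirtOp_eventuallyEq {z : Fin n → ℂ} (hz : z ∈ U) (s : ℂ) (u : Fin n → ℂ)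
    (h : Smooth U) : (wirtOp U s u h).1 =ᶠ[nhds z] wirt s u h.1 := by
  filter_upwards [U.isOpen.mem_nhds hz] with w hw using wirtOp_apply hw s u h

theorem wirtOp_mul (s : ℂ) (u : Fin n → ℂ) (h k : Smooth U) :
    wirtOp U s u (h * k) = wirtOp U s u h * k + h * wirtOp U s u k := by
  refine Smooth.ext_wirtOp (fun z hz => ?_) fun z hz => ?_
  · simp only [MulMemClass.coe_mul, AddMemClass.coe_add, Pi.mul_apply, Pi.add_apply,
      wirtOp_apply hz, wirt]
    rw [fderiv_mul (differentiableAt_smooth h hz) (differentiableAt_smooth k hz)]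
    simp only [_root_.add_apply, _root_.smul_apply, smul_eq_mul]
    ring
  · simp [wirtOp_apply_of_notMem hz]

/-- Both orders expand into the same four values of the second real derivative, which is symmetric
on `U`. -/
theorem wirtOp_comm (s t : ℂ) (u v : Fin n → ℂ) (h : Smooth U) :
    wirtOp U s u (wirtOp U t v h) = wirtOp U t v (wirtOp U s u h) := by
  have key : ∀ (s t : ℂ) (u v : Fin n → ℂ), ∀ z ∈ U, (wirtOp U s u (wirtOp U t v h)).1 z =
      (fderiv ℝ (fderiv ℝ h.1) z u v + t * I * fderiv ℝ (fderiv ℝ h.1) z u (I • v) +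
        s * I * fderiv ℝ (fderiv ℝ h.1) z (I • u) v +
        s * I * t * I * fderiv ℝ (fderiv ℝ h.1) z (I • u) (I • v)) / 4 := by
    intro s t u v z hz
    have hd : DifferentiableAt ℝ (fderiv ℝ h.1) z :=
      ((contDiffAt_smooth h hz).fderiv_right (m := 1) (by norm_cast)).differentiableAt (by simp)
    rw [wirtOp_apply hz, (wirt_congr (wirtOp_eventuallyEq hz t v h) s u).eq_of_nhds]
    have hd2 : HasFDerivAt (wirt t v h.1) ((2 : ℂ)⁻¹ • ((fderiv ℝ (fderiv ℝ h.1) z).flip v +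
        (t * I) • (fderiv ℝ (fderiv ℝ h.1) z).flip (I • v))) z := by
      have e : wirt t v h.1 = fun w => (2 : ℂ)⁻¹ • (fderiv ℝ h.1 w v +
          (t * I) • fderiv ℝ h.1 w (I • v)) := by
        funext w
        simp only [wirt, smul_eq_mul]
        ring
      rw [e]
      have h1 : ∀ v, HasFDerivAt (fun w => fderiv ℝ h.1 w v)
          ((fderiv ℝ (fderiv ℝ h.1) z).flip v) z := by
        intro v
        have := hd.hasFDerivAt.clm_apply (hasFDerivAt_const v z)
        simpa using this
      exact ((h1 v).add ((h1 (I • v)).const_smul (t * I))).const_smul ((2 : ℂ)⁻¹)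
    simp only [wirt, hd2.fderiv, _root_.smul_apply, _root_.add_apply,
      ContinuousLinearMap.flip_apply, smul_eq_mul]
    ring
  refine Smooth.ext_wirtOp (fun z hz => ?_) fun z hz => wirtOp_apply_of_notMem hz _ _ _
  have hsymm : IsSymmSndFDerivAt ℝ h.1 z :=
    (contDiffAt_smooth h hz).isSymmSndFDerivAt (by simp; norm_cast)
  rw [key s t u v z hz, key t s v u z hz, hsymm v u, hsymm v (I • u), hsymm (I • v) u,
    hsymm (I • v) (I • u)]
  ring

/-- Complex conjugation of smooth functions. -/
def conjOp (h : Smooth U) : Smooth U :=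
  ⟨fun z => (starRingEnd ℂ) (h.1 z), Complex.conjCLE.contDiff.comp_contDiffOn h.2⟩

theorem wirtOp_conj {s : ℂ} (hs : (starRingEnd ℂ) s = s) (u : Fin n → ℂ) (h : Smooth U) :
    wirtOp U s u (conjOp h) = conjOp (wirtOp U (-s) u h) := by
  refine Smooth.ext_wirtOp (fun z hz => ?_) fun z hz => ?_
  · rw [wirtOp_apply hz]
    exact (wirt_conj hs u h.1 z).trans (congrArg _ (wirtOp_apply hz _ _ _).symm)
  · exact (congrArg _ (wirtOp_apply_of_notMem hz _ _ _)).trans (map_zero _)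

/-- The derivative along the `i`-th coordinate, unbarred for `s = -1` and barred for `s = 1`. -/
def coordOp (U : Opens (Fin n → ℂ)) (s : ℂ) (i : Fin n) : Smooth U → Smooth U :=
  wirtOp U s (Pi.single i 1)

instance (s : ℂ) : LeftCommutative (coordOp U s) := ⟨fun _ _ h => wirtOp_comm _ _ _ _ h⟩

/-- The derivatives along a family of vectors. -/
def dirOp {ι : Type*} (U : Opens (Fin n → ℂ)) (s : ℂ) (u : ι → Fin n → ℂ) (l : ι) :
    Smooth U →+ Smooth U :=
  (wirtOp U s (u l)).toAddMonoidHom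

instance {ι : Type*} (s : ℂ) (u : ι → Fin n → ℂ) :
    LeftCommutative fun l α => dirOp U s u l α := ⟨fun _ _ h => wirtOp_comm _ _ _ _ h⟩

/-- Evaluation at a point. -/
def Smooth.eval (U : Opens (Fin n → ℂ)) (z : Fin n → ℂ) : Smooth U →+* ℂ :=
  (Pi.evalRingHom (fun _ => ℂ) z).comp (Smooth U).subtype

theorem wirt_sum_single_holomorphic (u : Fin n → ℂ) (h : (Fin n → ℂ) → ℂ) (z : Fin n → ℂ) :
    wirt (-1) u h z = ∑ i, u i * wirt (-1) (Pi.single i 1) h z := by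
  simp only [wirt]
  rw [holomorphicPart_eq_sum, Finset.sum_div]
  simp only [mul_div_assoc]

theorem wirt_sum_single_antiholomorphic (u : Fin n → ℂ) (h : (Fin n → ℂ) → ℂ)
    (z : Fin n → ℂ) : wirt 1 u h z = ∑ i, conj (u i) * wirt 1 (Pi.single i 1) h z := by
  simp only [wirt]
  rw [antiholomorphicPart_eq_sum, Finset.sum_div]
  simp only [mul_div_assoc]

theorem coe_foldr_coordOp (s : ℂ) (L : List (Fin n)) (h : Smooth U) {z : Fin n → ℂ}
    (hz : z ∈ U) : (L.foldr (coordOp U s) h).1 z =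
      L.foldr (fun i => wirt s (Pi.single i 1)) h.1 z := by
  induction L generalizing z with
  | nil => rfl
  | cons i L ih =>
    rw [List.foldr_cons, List.foldr_cons]
    refine (wirtOp_apply hz _ _ _).trans (wirt_congr ?_ _ _).eq_of_nhds
    filter_upwards [U.isOpen.mem_nhds hz] with w hw using ih hw

theorem foldr_wirt_congr {h k : (Fin n → ℂ) → ℂ} {z : Fin n → ℂ} (hk : h =ᶠ[nhds z] k) (s : ℂ)
    (L : List (Fin n)) : L.foldr (fun i => wirt s (Pi.single i 1)) h =ᶠ[nhds z]
      L.foldr (fun i => wirt s (Pi.single i 1)) k := by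
  induction L with
  | nil => exact hk
  | cons i L ih => exact wirt_congr ih _ _

theorem iterD_eq_foldr (A B : List (Fin n)) (h : (Fin n → ℂ) → ℂ) :
    iterD A B h = A.foldr (fun i => wirt (-1) (Pi.single i 1))
      (B.foldr (fun i => wirt 1 (Pi.single i 1)) h) := by
  simp only [iterD, ← dz_eq_wirt, ← dzbar_eq_wirt]

theorem iterD_congr {h k : (Fin n → ℂ) → ℂ} {z : Fin n → ℂ} (hk : h =ᶠ[nhds z] k)
    (A B : List (Fin n)) : iterD A B h z = iterD A B k z := by
  simp only [iterD_eq_foldr]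
  exact (foldr_wirt_congr (foldr_wirt_congr hk _ _) _ _).eq_of_nhds

/-- Passage from lists to multisets: as the operators commute, iterated derivatives of smooth
functions do not depend on the order of the indices. -/
theorem iterD_eq (A B : List (Fin n)) (h : Smooth U) {z : Fin n → ℂ} (hz : z ∈ U) :
    iterD A B h.1 z = ((A : Multiset (Fin n)).foldr (coordOp U (-1))
      ((B : Multiset (Fin n)).foldr (coordOp U 1) h)).1 z := by
  rw [Multiset.coe_foldr, Multiset.coe_foldr, coe_foldr_coordOp _ _ _ hz, iterD_eq_foldr]
  refine (foldr_wirt_congr ?_ _ _).eq_of_nhds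
  filter_upwards [U.isOpen.mem_nhds hz] with w hw using (coe_foldr_coordOp _ _ _ hw).symm

theorem foldr_coordOp_conj {s : ℂ} (hs : (starRingEnd ℂ) s = s) (B : Multiset (Fin n))
    (h : Smooth U) : B.foldr (coordOp U s) (conjOp h) = conjOp (B.foldr (coordOp U (-s)) h) := by
  induction B using Multiset.induction_on with
  | empty => rfl
  | cons i B ih => rw [Multiset.foldr_cons, ih, Multiset.foldr_cons]; exact wirtOp_conj hs _ _

/-- A holomorphic map from `V` to `U`. -/
structure HolMap (V U : Opens (Fin n → ℂ)) where
  /-- the underlying map -/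
  toFun : (Fin n → ℂ) → (Fin n → ℂ)
  mapsTo : ∀ z ∈ V, toFun z ∈ U
  analytic : AnalyticOnNhd ℂ toFun V

/-! ### Wirtinger derivatives and holomorphic maps -/

namespace HolMap

variable (φ : HolMap V U)

theorem contDiffOn : ContDiffOn ℝ ∞ φ.toFun V :=
  (φ.analytic.contDiffOn V.isOpen.uniqueDiffOn).restrict_scalars ℝ

theorem differentiableAt {z : Fin n → ℂ} (hz : z ∈ V) : DifferentiableAt ℂ φ.toFun z :=
  (φ.analytic z hz).differentiableAt

/-- The pullback of smooth functions along a holomorphic map. -/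
def comp (h : Smooth U) : Smooth V :=
  ⟨fun z => h.1 (φ.toFun z), ContDiffOn.comp (g := h.1) h.2 φ.contDiffOn φ.mapsTo⟩

/-- The components of a holomorphic map. -/
def coord (i : Fin n) : Smooth V :=
  ⟨fun z => φ.toFun z i, contDiffOn_pi.1 φ.contDiffOn i⟩

theorem fderiv_comp_apply {z : Fin n → ℂ} (hz : z ∈ V) (h : Smooth U) (u : Fin n → ℂ) :
    fderiv ℝ (φ.comp h).1 z u = fderiv ℝ h.1 (φ.toFun z) (fderiv ℂ φ.toFun z u) := by
  have h1 : HasFDerivAt (φ.comp h).1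
      ((fderiv ℝ h.1 (φ.toFun z)).comp ((fderiv ℂ φ.toFun z).restrictScalars ℝ)) z :=
    HasFDerivAt.comp (g := h.1) (f := φ.toFun) z (differentiableAt_smooth h (φ.mapsTo z hz)).hasFDerivAt
      ((φ.differentiableAt hz).hasFDerivAt.restrictScalars ℝ)
  rw [h1.fderiv]
  rfl

theorem fderiv_coord_apply {z : Fin n → ℂ} (hz : z ∈ V) (i : Fin n) (u : Fin n → ℂ) :
    fderiv ℝ (φ.coord i).1 z u = fderiv ℂ φ.toFun z u i := by
  have h1 : HasFDerivAt (φ.coord i).1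
      (((ContinuousLinearMap.proj i).comp (fderiv ℂ φ.toFun z)).restrictScalars ℝ) z :=
    ((hasFDerivAt_pi'.1 (φ.differentiableAt hz).hasFDerivAt) i).restrictScalars ℝ
  rw [h1.fderiv]
  rfl

theorem wirt_coord {z : Fin n → ℂ} (hz : z ∈ V) (i : Fin n) (u : Fin n → ℂ) :
    wirt (-1) u (φ.coord i).1 z = fderiv ℂ φ.toFun z u i := by
  simp only [wirt, fderiv_coord_apply φ hz, map_smul, Pi.smul_apply, smul_eq_mul]
  linear_combination (-(fderiv ℂ φ.toFun z u i) / 2) * I_sq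

/-- The Cauchy–Riemann equations: the differential of `φ` commutes with multiplication by `I`. -/
theorem wirtOp_one_coord (i : Fin n) (u : Fin n → ℂ) : wirtOp V 1 u (φ.coord i) = 0 := by
  refine Smooth.ext_wirtOp (fun z hz => ?_) fun z _ => rfl
  rw [wirtOp_apply hz]
  simp only [wirt, fderiv_coord_apply φ hz, map_smul, Pi.smul_apply, smul_eq_mul,
    ZeroMemClass.coe_zero, Pi.zero_apply]
  linear_combination ((fderiv ℂ φ.toFun z u i) / 2) * I_sq

theorem wirtOp_neg_one_conj_coord (i : Fin n) (u : Fin n → ℂ) :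
    wirtOp V (-1) u (conjOp (φ.coord i)) = 0 := by
  rw [wirtOp_conj (by simp), neg_neg, wirtOp_one_coord]
  ext z
  exact map_zero _

/-- Complex linearity of the differential of `φ` keeps the two types apart: no barred derivative of
`h` enters. -/
theorem wirtOp_comp (u : Fin n → ℂ) (h : Smooth U) :
    wirtOp V (-1) u (φ.comp h) =
      ∑ i, wirtOp V (-1) u (φ.coord i) * φ.comp (coordOp U (-1) i h) := by
  refine Smooth.ext_wirtOp (fun z hz => ?_) fun z hz => ?_
  · rw [wirtOp_apply hz, AddSubmonoidClass.coe_finsetSum, Finset.sum_apply]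
    simp only [MulMemClass.coe_mul, Pi.mul_apply, wirtOp_apply hz, wirt_coord φ hz]
    have : ∀ i, (φ.comp (coordOp U (-1) i h)).1 z = wirt (-1) (Pi.single i 1) h.1 (φ.toFun z) :=
      fun i => wirtOp_apply (φ.mapsTo z hz) _ _ _
    simp only [this]
    rw [← wirt_sum_single_holomorphic]
    simp only [wirt, fderiv_comp_apply φ hz, map_smul]
  · rw [AddSubmonoidClass.coe_finsetSum, Finset.sum_apply]
    simp [wirtOp_apply_of_notMem hz]

theorem comp_conj (h : Smooth U) : φ.comp (conjOp h) = conjOp (φ.comp h) := rfl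

theorem wirtOp_one_comp (u : Fin n → ℂ) (h : Smooth U) :
    wirtOp V 1 u (φ.comp h) =
      ∑ i, wirtOp V 1 u (conjOp (φ.coord i)) * φ.comp (coordOp U 1 i h) := by
  refine Smooth.ext_wirtOp (fun z hz => ?_) fun z hz => ?_
  · rw [wirtOp_apply hz, AddSubmonoidClass.coe_finsetSum, Finset.sum_apply]
    have h1 : ∀ i, (wirtOp V 1 u (conjOp (φ.coord i))).1 z =
        (starRingEnd ℂ) (fderiv ℂ φ.toFun z u i) := by
      intro i
      rw [wirtOp_conj (by simp), ← wirt_coord φ hz, ← wirtOp_apply hz]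
      rfl
    have h2 : ∀ i, (φ.comp (coordOp U 1 i h)).1 z = wirt 1 (Pi.single i 1) h.1 (φ.toFun z) :=
      fun i => wirtOp_apply (φ.mapsTo z hz) _ _ _
    simp only [MulMemClass.coe_mul, Pi.mul_apply, h1, h2]
    rw [← wirt_sum_single_antiholomorphic]
    simp only [wirt, fderiv_comp_apply φ hz, map_smul]
  · rw [AddSubmonoidClass.coe_finsetSum, Finset.sum_apply]
    simp [wirtOp_apply_of_notMem hz]

end HolMap

end Wirtinger

/-! ### Derivatives in another coordinate system as sums over forests -/

section ChangeOfCoordinates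

open Complex TopologicalSpace

variable {n : ℕ} {U V : Opens (Fin n → ℂ)}

theorem foldr_map_eq {α β γ : Type*} (f : α → β → β) [LeftCommutative f] (g : γ → α)
    (b : β) (s : Multiset γ) :
    haveI : LeftCommutative fun c => f (g c) := ⟨fun _ _ _ => LeftCommutative.left_comm _ _ _⟩
    (s.map g).foldr f b = s.foldr (fun c => f (g c)) b := by
  have : LeftCommutative fun c => f (g c) := ⟨fun _ _ _ => LeftCommutative.left_comm _ _ _⟩
  induction s using Multiset.induction_on with
  | empty => rfl
  | cons c s ih => rw [Multiset.map_cons, Multiset.foldr_cons, ih, Multiset.foldr_cons]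

theorem dirOp_mul {ι : Type*} (s : ℂ) (v : ι → Fin n → ℂ) (l : ι) (α β : Smooth U) :
    dirOp U s v l (α * β) = dirOp U s v l α * β + α * dirOp U s v l β :=
  wirtOp_mul s (v l) α β

theorem wirtOp_congr {h k : Smooth U} (hk : ∀ z ∈ U, h.1 z = k.1 z) (s : ℂ) (u : Fin n → ℂ) :
    wirtOp U s u h = wirtOp U s u k := by
  refine Smooth.ext_wirtOp (fun z hz => ?_) fun z hz => wirtOp_apply_of_notMem hz _ _ _
  rw [wirtOp_apply hz, wirtOp_apply hz]
  refine (wirt_congr ?_ _ _).eq_of_nhds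
  filter_upwards [U.isOpen.mem_nhds hz] with w hw using hk w hw

theorem wirtOp_algebraMap (s : ℂ) (u : Fin n → ℂ) (c : ℂ) :
    wirtOp U s u (algebraMap ℂ (Smooth U) c) = 0 := by
  refine Smooth.ext_wirtOp (fun z hz => ?_) fun z _ => rfl
  rw [wirtOp_apply hz]
  have : fderiv ℝ (algebraMap ℂ (Smooth U) c).1 z = 0 := fderiv_const_apply c
  simp only [wirt, this, zero_apply, mul_zero, add_zero, zero_div]
  rfl

theorem wirtOp_iterOn_eq_zero {ι : Type*} {s t : ℂ} {u : Fin n → ℂ} {v : ι → Fin n → ℂ}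
    {α : Smooth U} (hα : wirtOp U s u α = 0) (R : Finset ι) :
    wirtOp U s u (iterOn (dirOp U t v) R α) = 0 := by
  classical
  induction R using Finset.induction_on with
  | empty => exact hα
  | insert l R hl ih =>
    rw [iterOn_insert _ hl]
    refine (wirtOp_comm _ _ _ _ _).trans ?_
    rw [ih]
    exact map_zero _

theorem iterOn_dirOp_smul {ι : Type*} (s : ℂ) (v : ι → Fin n → ℂ) (R : Finset ι) (c : ℂ)
    (α : Smooth U) : iterOn (dirOp U s v) R (c • α) = c • iterOn (dirOp U s v) R α := by
  classical
  induction R using Finset.induction_on with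
  | empty => rfl
  | insert l R hl ih =>
    rw [iterOn_insert _ hl, iterOn_insert _ hl, ih]
    exact map_smul (wirtOp U s (v l)) _ _

/-- Expanding each direction in the coordinate basis produces the contraction that occurs in the
tensorial transformation law. The coefficients `w` are the entries of `v` or their conjugates,
according to `s`. -/
theorem iterOn_dirOp_univ {k : ℕ} (s : ℂ) (v : Fin k → Fin n → ℂ) (w : Fin k → Fin n → ℂ)
    (hw : ∀ l α, wirtOp U s (v l) α = ∑ i, w l i • coordOp U s i α) (α : Smooth U) :
    iterOn (dirOp U s v) Finset.univ α =
      ∑ c : Fin k → Fin n, (∏ l, w l (c l)) • (indices c).foldr (coordOp U s) α := by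
  induction k with
  | zero => simp [indices, iterOn]
  | succ k ih =>
    have hu : (Finset.univ : Finset (Fin (k + 1))).val =
        0 ::ₘ (Finset.univ : Finset (Fin k)).val.map Fin.succ := by
      rw [Fin.univ_succ]; rfl
    have h1 : iterOn (dirOp U s v) Finset.univ α =
        wirtOp U s (v 0) (iterOn (dirOp U s fun l : Fin k => v l.succ) Finset.univ α) := by
      rw [iterOn, hu, Multiset.foldr_cons, iterOn]
      exact congrArg _ (foldr_map_eq (fun l α => dirOp U s v l α) Fin.succ α _)
    rw [h1, ih _ _ fun l => hw l.succ, map_sum,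
      ← Fintype.sum_equiv (Fin.consEquiv fun _ => Fin n) _ _ (fun _ => rfl),
      Fintype.sum_prod_type, Finset.sum_comm]
    refine Finset.sum_congr rfl fun c _ => ?_
    rw [map_smul, hw, Finset.smul_sum]
    refine Finset.sum_congr rfl fun i _ => ?_
    have hi : indices (Fin.consEquiv (fun _ => Fin n) (i, c)) = i ::ₘ indices c := by
      rw [indices, hu, Multiset.map_cons, Multiset.map_map]
      rfl
    rw [hi, Multiset.foldr_cons, Fin.prod_univ_succ, smul_smul, mul_comm]
    rfl

theorem wirtOp_neg_one_eq_sum (u : Fin n → ℂ) (α : Smooth U) :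
    wirtOp U (-1) u α = ∑ i, u i • coordOp U (-1) i α := by
  refine Smooth.ext_wirtOp (fun z hz => ?_) fun z hz => ?_
  · rw [wirtOp_apply hz, AddSubmonoidClass.coe_finsetSum, Finset.sum_apply,
      wirt_sum_single_holomorphic]
    simp [coordOp, wirtOp_apply hz]
  · rw [AddSubmonoidClass.coe_finsetSum, Finset.sum_apply]
    simp [coordOp, wirtOp_apply_of_notMem hz]

theorem wirtOp_one_eq_sum (u : Fin n → ℂ) (α : Smooth U) :
    wirtOp U 1 u α = ∑ i, conj (u i) • coordOp U 1 i α := by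
  refine Smooth.ext_wirtOp (fun z hz => ?_) fun z hz => ?_
  · rw [wirtOp_apply hz, AddSubmonoidClass.coe_finsetSum, Finset.sum_apply,
      wirt_sum_single_antiholomorphic]
    simp [coordOp, wirtOp_apply hz]
  · rw [AddSubmonoidClass.coe_finsetSum, Finset.sum_apply]
    simp [coordOp, wirtOp_apply_of_notMem hz]

namespace HolMap

variable (ψ : HolMap U V) (φ : HolMap V U)

/-- The coordinates `ψ`, composed with the linear map which makes their differential at the
point `φ y` the identity. -/
def normalized (y : Fin n → ℂ) (i : Fin n) : Smooth U :=
  ∑ c, fderiv ℂ φ.toFun y (Pi.single c 1) i • ψ.coord c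

variable {ψ φ} (hψφ : ∀ z ∈ V, ψ.toFun (φ.toFun z) = z) (hφψ : ∀ z ∈ U, φ.toFun (ψ.toFun z) = z)

include hφψ in
theorem fderiv_fderiv {x : Fin n → ℂ} (hx : x ∈ U) (v : Fin n → ℂ) :
    fderiv ℂ φ.toFun (ψ.toFun x) (fderiv ℂ ψ.toFun x v) = v := by
  have h1 := ((φ.differentiableAt (ψ.mapsTo x hx)).hasFDerivAt.comp x
    (ψ.differentiableAt hx).hasFDerivAt)
  have h2 : HasFDerivAt (φ.toFun ∘ ψ.toFun) (ContinuousLinearMap.id ℂ (Fin n → ℂ)) x := by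
    refine (hasFDerivAt_id x).congr_of_eventuallyEq ?_
    filter_upwards [U.isOpen.mem_nhds hx] with w hw using hφψ w hw
  exact congrArg (fun L => L v) (h1.unique h2)

include hφψ in
theorem coordOp_normalized {x : Fin n → ℂ} (hx : x ∈ U) (i j : Fin n) :
    (coordOp U (-1) j (normalized ψ φ (ψ.toFun x) i)).1 x = if i = j then 1 else 0 := by
  have h1 := congrFun (fderiv_fderiv hφψ hx (Pi.single j 1)) i
  have h2 : fderiv ℂ ψ.toFun x (Pi.single j 1) =
      ∑ c, fderiv ℂ ψ.toFun x (Pi.single j 1) c • (Pi.single c 1 : Fin n → ℂ) := by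
    funext d
    simp [Finset.sum_apply, Pi.single_apply]
  rw [h2, map_sum, Finset.sum_apply] at h1
  rw [normalized, coordOp, map_sum, AddSubmonoidClass.coe_finsetSum, Finset.sum_apply,
    ← Pi.single_apply, ← h1]
  refine Finset.sum_congr rfl fun c _ => ?_
  rw [map_smul, map_smul]
  simp only [SetLike.val_smul, Pi.smul_apply, smul_eq_mul, wirtOp_apply hx, wirt_coord ψ hx]
  exact mul_comm _ _

-- On `V` the map `ψ ∘ φ` is the identity, so after composition with `φ` these functions are linear
-- in the coordinates. This is the source of the vanishing required by Lagrange inversion.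
include hψφ in
theorem wirtOp_comp_normalized (y u : Fin n → ℂ) (i : Fin n) : ∃ c : ℂ, ∀ z ∈ V,
    (wirtOp V (-1) u (φ.comp (normalized ψ φ y i))).1 z = c := by
  let idV : HolMap V V := ⟨id, fun _ h => h, analyticOnNhd_id⟩
  refine ⟨∑ c, fderiv ℂ φ.toFun y (Pi.single c 1) i * u c, fun z hz => ?_⟩
  have h1 : wirtOp V (-1) u (φ.comp (normalized ψ φ y i)) =
      wirtOp V (-1) u (∑ c, fderiv ℂ φ.toFun y (Pi.single c 1) i • idV.coord c) := by
    refine wirtOp_congr (fun w hw => ?_) _ _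
    simp only [normalized, comp, coord, AddSubmonoidClass.coe_finsetSum, Finset.sum_apply,
      SetLike.val_smul, Pi.smul_apply, hψφ w hw]
    rfl
  rw [h1, map_sum, AddSubmonoidClass.coe_finsetSum, Finset.sum_apply]
  refine Finset.sum_congr rfl fun c _ => ?_
  rw [map_smul]
  simp only [SetLike.val_smul, Pi.smul_apply, smul_eq_mul, wirtOp_apply hz, wirt_coord idV hz]
  simp [idV]

include hψφ in
theorem wirtOp_wirtOp_comp_normalized (y u v : Fin n → ℂ) (i : Fin n) :
    wirtOp V (-1) u (wirtOp V (-1) v (φ.comp (normalized ψ φ y i))) = 0 := by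
  obtain ⟨c, hc⟩ := wirtOp_comp_normalized hψφ y v i
  rw [wirtOp_congr (k := algebraMap ℂ (Smooth V) c) hc, wirtOp_algebraMap]

theorem conjOp_zero : conjOp (0 : Smooth U) = 0 := by
  ext z
  exact map_zero _

include hψφ hφψ in
/-- The derivatives of `f` in the coordinates `ψ`, as a sum over pairs of forests of the
derivatives of `f` in the original coordinates. -/
theorem iterOn_eq_forestSum {x : Fin n → ℂ} (hx : x ∈ U) {k m : ℕ} (a : Fin k → Fin n)
    (b : Fin m → Fin n) (f : Smooth U) :
    (iterOn (dirOp V (-1) fun l => fderiv ℂ ψ.toFun x (Pi.single (a l) 1)) Finset.univ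
      (iterOn (dirOp V 1 fun l => fderiv ℂ ψ.toFun x (Pi.single (b l) 1)) Finset.univ
        (φ.comp f))).1 (ψ.toFun x) =
    forestSum Finset.univ b
      (fun i B => conj ((B.foldr (coordOp U (-1)) (normalized ψ φ (ψ.toFun x) i)).1 x))
      fun B => forestSum Finset.univ a
        (fun i A => (A.foldr (coordOp U (-1)) (normalized ψ φ (ψ.toFun x) i)).1 x)
        fun A => (A.foldr (coordOp U (-1)) (B.foldr (coordOp U 1) f)).1 x := by
  have hy : ψ.toFun x ∈ V := ψ.mapsTo x hx
  set u : Fin k → Fin n → ℂ := fun l => fderiv ℂ ψ.toFun x (Pi.single (a l) 1) with hu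
  set v : Fin m → Fin n → ℂ := fun l => fderiv ℂ ψ.toFun x (Pi.single (b l) 1) with hv
  -- The differential of `φ` takes the direction `u l` back to the basis vector with index `a l`;
  -- this gives the factor at a leaf.
  have hu1 : ∀ l i, (wirtOp V (-1) (u l) (φ.coord i)).1 (ψ.toFun x) =
      if i = a l then 1 else 0 := by
    intro l i
    rw [wirtOp_apply hy, wirt_coord φ hy, fderiv_fderiv hφψ hx, Pi.single_apply]
  have hv1 : ∀ l i, (wirtOp V (-1) (v l) (φ.coord i)).1 (ψ.toFun x) =
      if i = b l then 1 else 0 := by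
    intro l i
    rw [wirtOp_apply hy, wirt_coord φ hy, fderiv_fderiv hφψ hx, Pi.single_apply]
  have inner : ∀ g : Smooth U,
      (iterOn (dirOp V (-1) u) Finset.univ (φ.comp g)).1 (ψ.toFun x) =
      forestSum Finset.univ a
        (fun i A => (A.foldr (coordOp U (-1)) (normalized ψ φ (ψ.toFun x) i)).1 x)
        fun A => (A.foldr (coordOp U (-1)) g).1 x := by
    intro g
    have h := iterOn_comp (dirOp V (-1) u) (dirOp_mul (-1) u) (coordOp U (-1))
      φ.comp φ.coord (fun l h => wirtOp_comp φ (u l) h) a (Smooth.eval V (ψ.toFun x))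
      (Smooth.eval V (ψ.toFun x)).toAddMonoidHom (fun S _ i β => map_mul (Smooth.eval V (ψ.toFun x)) _ _) hu1
      (normalized ψ φ (ψ.toFun x)) (fun i j => by
        refine Eq.trans ?_ (coordOp_normalized hφψ hx i j)
        exact congrArg (coordOp U (-1) j (normalized ψ φ (ψ.toFun x) i)).1 (hφψ x hx))
      (fun l l' i => wirtOp_wirtOp_comp_normalized hψφ _ _ _ _) Finset.univ g
    refine Eq.trans h ?_
    have e : ∀ g : Smooth U, Smooth.eval V (ψ.toFun x) (φ.comp g) = g.1 x := fun g =>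
      congrArg g.1 (hφψ x hx)
    simp only [RingHom.toAddMonoidHom_eq_coe, AddMonoidHom.coe_coe, e]
  -- Unbarred derivatives annihilate the conjugated components of `φ` and all their barred
  -- derivatives, so these pass through as constants.
  have hΛ : ∀ S : Finset (Fin m), S.Nonempty → ∀ i β, ((Smooth.eval V (ψ.toFun x)).toAddMonoidHom.comp
        (AddMonoidHom.mk' (iterOn (dirOp V (-1) u) Finset.univ) (iterOn_add _ _)))
        (iterOn (dirOp V 1 v) S (conjOp (φ.coord i)) * β) =
      Smooth.eval V (ψ.toFun x) (iterOn (dirOp V 1 v) S (conjOp (φ.coord i))) *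
        ((Smooth.eval V (ψ.toFun x)).toAddMonoidHom.comp
        (AddMonoidHom.mk' (iterOn (dirOp V (-1) u) Finset.univ) (iterOn_add _ _))) β := by
    intro S _ i β
    have h1 := iterOn_mul_of_const (dirOp V (-1) u) (dirOp_mul (-1) u)
      Finset.univ (α := iterOn (dirOp V 1 v) S (conjOp (φ.coord i)))
      (fun l => wirtOp_iterOn_eq_zero (wirtOp_neg_one_conj_coord φ i (u l)) S) β
    exact (congrArg (Smooth.eval V (ψ.toFun x)) h1).trans (map_mul _ _ _)
  have hZ : ∀ l i, Smooth.eval V (ψ.toFun x) (dirOp V 1 v l (conjOp (φ.coord i))) =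
      if i = b l then 1 else 0 := by
    intro l i
    have h1 : dirOp V 1 v l (conjOp (φ.coord i)) = conjOp (wirtOp V (-1) (v l) (φ.coord i)) :=
      wirtOp_conj (by simp) (v l) (φ.coord i)
    rw [h1]
    refine Eq.trans (congrArg (starRingEnd ℂ) (hv1 l i)) ?_
    split_ifs <;> simp
  have hn : ∀ i j, Smooth.eval V (ψ.toFun x)
      (φ.comp (coordOp U 1 j (conjOp (normalized ψ φ (ψ.toFun x) i)))) =
      if i = j then 1 else 0 := by
    intro i j
    have h1 : coordOp U 1 j (conjOp (normalized ψ φ (ψ.toFun x) i)) =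
      conjOp (coordOp U (-1) j (normalized ψ φ (ψ.toFun x) i)) := wirtOp_conj (by simp) _ _
    rw [h1]
    refine Eq.trans (congrArg (fun z => (starRingEnd ℂ)
      ((coordOp U (-1) j (normalized ψ φ (ψ.toFun x) i)).1 z)) (hφψ x hx)) ?_
    rw [coordOp_normalized hφψ hx]
    split_ifs <;> simp
  have hlin : ∀ l l' i, dirOp V 1 v l (dirOp V 1 v l'
      (φ.comp (conjOp (normalized ψ φ (ψ.toFun x) i)))) = 0 := by
    intro l l' i
    have h1 : dirOp V 1 v l' (φ.comp (conjOp (normalized ψ φ (ψ.toFun x) i))) =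
      conjOp (wirtOp V (-1) (v l') (φ.comp (normalized ψ φ (ψ.toFun x) i))) := by
      rw [comp_conj]
      exact wirtOp_conj (by simp) (v l') (φ.comp (normalized ψ φ (ψ.toFun x) i))
    have h2 := wirtOp_conj (U := V) (s := 1) (by simp) (v l)
      (wirtOp V (-1) (v l') (φ.comp (normalized ψ φ (ψ.toFun x) i)))
    rw [wirtOp_wirtOp_comp_normalized hψφ, conjOp_zero] at h2
    rw [h1]
    exact h2
  have hchain : ∀ l h, dirOp V 1 v l (φ.comp h) =
      ∑ i, dirOp V 1 v l (conjOp (φ.coord i)) * φ.comp (coordOp U 1 i h) :=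
    fun l h => wirtOp_one_comp φ (v l) h
  -- The barred derivatives are expanded first, with `Λ` the unbarred derivative evaluated at `ψ x`;
  -- at the root this leaves `inner`, applied to barred derivatives of `f`.
  have outer := iterOn_comp (dirOp V 1 v) (dirOp_mul 1 v) (coordOp U 1)
      φ.comp (fun i => conjOp (φ.coord i)) hchain b
      (Smooth.eval V (ψ.toFun x))
      ((Smooth.eval V (ψ.toFun x)).toAddMonoidHom.comp
        (AddMonoidHom.mk' (iterOn (dirOp V (-1) u) Finset.univ) (iterOn_add _ _)))
      hΛ hZ (fun i => conjOp (normalized ψ φ (ψ.toFun x) i)) hn hlin Finset.univ f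
  refine Eq.trans outer ?_
  have e : ∀ (i : Fin n) (B : Multiset (Fin n)), Smooth.eval V (ψ.toFun x)
      (φ.comp (B.foldr (coordOp U 1) (conjOp (normalized ψ φ (ψ.toFun x) i)))) =
      (starRingEnd ℂ) ((B.foldr (coordOp U (-1)) (normalized ψ φ (ψ.toFun x) i)).1 x) := by
    intro i B
    rw [foldr_coordOp_conj (by simp)]
    exact congrArg (fun z => (starRingEnd ℂ)
      ((B.foldr (coordOp U (-1)) (normalized ψ φ (ψ.toFun x) i)).1 z)) (hφψ x hx)
  simp only [e]
  congr 1
  funext B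
  exact inner _

-- Contracting the derivatives of `f ∘ φ` with the Jacobian of `ψ` amounts to differentiating along
-- the images of the basis vectors, so `iterOn_eq_forestSum` computes the transported tensor.
include hψφ hφψ in
theorem sum_iterated_eq_forestSum {x : Fin n → ℂ} (hx : x ∈ U) {k m : ℕ} (a : Fin k → Fin n)
    (b : Fin m → Fin n) (f : Smooth U) :
    ∑ c : Fin k → Fin n, ∑ d : Fin m → Fin n,
      (∏ i, dz (a i) (fun w => ψ.toFun w (c i)) x) *
      (∏ j, conj (dz (b j) (fun w => ψ.toFun w (d j)) x)) *
      ((indices c).foldr (coordOp V (-1)) ((indices d).foldr (coordOp V 1) (φ.comp f))).1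
        (ψ.toFun x) =
    forestSum Finset.univ b
      (fun i B => conj ((B.foldr (coordOp U (-1)) (normalized ψ φ (ψ.toFun x) i)).1 x))
      fun B => forestSum Finset.univ a
        (fun i A => (A.foldr (coordOp U (-1)) (normalized ψ φ (ψ.toFun x) i)).1 x)
        fun A => (A.foldr (coordOp U (-1)) (B.foldr (coordOp U 1) f)).1 x := by
  rw [← iterOn_eq_forestSum hψφ hφψ hx]
  rw [iterOn_dirOp_univ 1 _ _ (fun l => wirtOp_one_eq_sum _), iterOn_sum]
  simp only [iterOn_dirOp_smul]
  simp only [iterOn_dirOp_univ (-1) _ _ (fun l => wirtOp_neg_one_eq_sum _)]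
  simp only [AddSubmonoidClass.coe_finsetSum, Finset.sum_apply, SetLike.val_smul,
    Pi.smul_apply, smul_eq_mul, Finset.mul_sum]
  rw [Finset.sum_comm]
  refine Finset.sum_congr rfl fun d _ => Finset.sum_congr rfl fun c _ => ?_
  have h1 : ∀ i j, dz i (fun w => ψ.toFun w j) x = fderiv ℂ ψ.toFun x (Pi.single i 1) j := by
    intro i j
    rw [dz_eq_wirt, ← wirt_coord ψ hx]
    rfl
  simp only [h1]
  ring

end HolMap

end ChangeOfCoordinates

/-! ### Forests and laminar families -/

section Forests

open Relation

variable {V ι : Type*} [Fintype V] [DecidableEq V] [Fintype ι]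

/-- The number of children of a node of a forest. -/
def childCount (p : V → Option V) (q : ι → Option V) (o : Option V) : ℕ :=
  (Finset.univ.filter fun v => p v = o).card + (Finset.univ.filter fun l => q l = o).card

theorem card_childIdx {n : ℕ} (p : V → Option V) (q : ι → Option V) (a : ι → Fin n)
    (ρ : V → Fin n) (o : Option V) :
    (childIdx p q Finset.univ a ρ o).card = childCount p q o := by
  simp only [childIdx, childCount, Multiset.card_add, Multiset.card_sum, Finset.card_filter,
    apply_ite Multiset.card, Multiset.card_singleton, Multiset.card_zero]

open Classical in
/-- The leaves below the vertex `v` of a forest. -/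
def leafSet (p : V → Option V) (q : ι → Option V) (v : V) : Finset ι :=
  Finset.univ.filter fun l => ∃ u, q l = some u ∧ ReflTransGen (fun x y => p x = some y) u v

variable {p : V → Option V} {q : ι → Option V}

theorem mem_leafSet {v : V} {l : ι} : l ∈ leafSet p q v ↔
    ∃ u, q l = some u ∧ ReflTransGen (fun x y => p x = some y) u v := by
  simp [leafSet]

theorem leafSet_mono {u v : V} (h : ReflTransGen (fun x y => p x = some y) u v) :
    leafSet p q u ⊆ leafSet p q v := by
  intro l hl
  obtain ⟨w, hw, hwu⟩ := mem_leafSet.1 hl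
  exact mem_leafSet.2 ⟨w, hw, hwu.trans h⟩

theorem reach_total {u v w : V} (hv : ReflTransGen (fun x y => p x = some y) u v)
    (hw : ReflTransGen (fun x y => p x = some y) u w) :
    ReflTransGen (fun x y => p x = some y) v w ∨ ReflTransGen (fun x y => p x = some y) w v :=
  ReflTransGen.total_of_right_unique
    (fun _ _ _ h h' => Option.some.inj (h.symm.trans h')) hv hw

/-! ### Forests with a depth function and at least two children per vertex -/

section Rank

variable {d : V → ℕ} (hd : ∀ x y, p x = some y → d y < d x)
include hd

theorem reach_rank {u v : V} (h : ReflTransGen (fun x y => p x = some y) u v) :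
    u = v ∨ d v < d u := by
  induction h with
  | refl => exact Or.inl rfl
  | tail _ h ih =>
    have := hd _ _ h
    rcases ih with rfl | ih
    · exact Or.inr this
    · exact Or.inr (this.trans ih)

theorem reach_antisymm {u v : V} (h : ReflTransGen (fun x y => p x = some y) u v)
    (h' : ReflTransGen (fun x y => p x = some y) v u) : u = v := by
  rcases reach_rank hd h with h1 | h1
  · exact h1
  rcases reach_rank hd h' with h2 | h2
  · exact h2.symm
  omega

/-- A proper descent passes through the last vertex before the end. -/
theorem reach_child {u v : V} (h : ReflTransGen (fun x y => p x = some y) u v) (hne : u ≠ v) :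
    ∃ c, p c = some v ∧ ReflTransGen (fun x y => p x = some y) u c := by
  rcases ReflTransGen.cases_tail h with h1 | ⟨c, h1, h2⟩
  · exact absurd h1.symm hne
  · exact ⟨c, h2, h1⟩

variable (hc : ∀ v, 2 ≤ childCount p q (some v))
include hc

/-- Passing to a child increases `d`, which is bounded on the finite set `V`. The descent ends at a
vertex without vertex children, and by `hc` such a vertex has leaves. -/
theorem leafSet_nonempty (v : V) : (leafSet p q v).Nonempty := by
  induction hM : Finset.univ.sup d - d v using Nat.strong_induction_on generalizing v with
  | _ M ih =>
    have h := hc v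
    by_cases h1 : ∃ c, p c = some v
    · obtain ⟨c, h1⟩ := h1
      have hlt := hd _ _ h1
      have hle : d c ≤ Finset.univ.sup d := Finset.le_sup (Finset.mem_univ c)
      exact (ih _ (by omega) c rfl).mono (leafSet_mono (ReflTransGen.single h1))
    · push Not at h1
      rw [childCount, Finset.filter_false_of_mem fun c _ => h1 c, Finset.card_empty, zero_add] at h
      obtain ⟨l, hl⟩ := Finset.card_pos.1 (two_pos.trans_le h)
      exact ⟨l, mem_leafSet.2 ⟨v, (Finset.mem_filter.1 hl).2, ReflTransGen.refl⟩⟩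

theorem reach_of_leafSet_inter {u v : V} {l : ι} (hu : l ∈ leafSet p q u)
    (hv : l ∈ leafSet p q v) : ReflTransGen (fun x y => p x = some y) u v ∨
      ReflTransGen (fun x y => p x = some y) v u := by
  obtain ⟨w, hw, hwu⟩ := mem_leafSet.1 hu
  obtain ⟨w', hw', hwv⟩ := mem_leafSet.1 hv
  obtain rfl : w = w' := Option.some.inj (hw.symm.trans hw')
  exact reach_total hwu hwv

/-- The vertex `v` has a child besides `c`, either a leaf or another vertex, and different siblings
have no leaf in common. Hence leaf sets grow strictly towards the root. -/
theorem exists_leaf_notMem {c v : V} (hcv : p c = some v) :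
    ∃ l ∈ leafSet p q v, l ∉ leafSet p q c := by
  have hdc := hd _ _ hcv
  by_cases h1 : ∃ l, q l = some v
  · obtain ⟨l, hl⟩ := h1
    refine ⟨l, mem_leafSet.2 ⟨v, hl, ReflTransGen.refl⟩, fun h => ?_⟩
    obtain ⟨w, hw, hwc⟩ := mem_leafSet.1 h
    obtain rfl : v = w := Option.some.inj (hl.symm.trans hw)
    rcases reach_rank hd hwc with rfl | h2 <;> omega
  · push Not at h1
    have h := hc v
    rw [childCount, Finset.filter_false_of_mem (s := (Finset.univ : Finset ι)) fun c _ => h1 c,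
      Finset.card_empty, add_zero] at h
    obtain ⟨c', hc', hne⟩ := Finset.exists_mem_ne (Nat.lt_of_succ_le h) c
    have hc'v := (Finset.mem_filter.1 hc').2
    have hdc' := hd _ _ hc'v
    obtain ⟨l, hl⟩ := leafSet_nonempty hd hc c'
    refine ⟨l, leafSet_mono (ReflTransGen.single hc'v) hl, fun h => ?_⟩
    have key : ∀ x y, p x = some v → p y = some v → x ≠ y →
        ¬ ReflTransGen (fun x y => p x = some y) x y := by
      intro x y hx hy hxy hr
      rcases ReflTransGen.cases_head hr with h2 | ⟨z, hz, hzy⟩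
      · exact hxy h2
      · obtain rfl : v = z := Option.some.inj (hx.symm.trans hz)
        have := hd _ _ hy
        rcases reach_rank hd hzy with rfl | h2 <;> omega
    rcases reach_of_leafSet_inter hd hc hl h with h2 | h2
    · exact key _ _ hc'v hcv hne h2
    · exact key _ _ hcv hc'v hne.symm h2

/-- Vertices with a common leaf are comparable. If `v` were properly below `u`, it would be below a
child of `u`, and that child misses a leaf of `u`. -/
theorem leafSet_subset_iff {u v : V} :
    leafSet p q u ⊆ leafSet p q v ↔ ReflTransGen (fun x y => p x = some y) u v := by
  refine ⟨fun h => ?_, leafSet_mono⟩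
  obtain ⟨l, hl⟩ := leafSet_nonempty hd hc u
  rcases reach_of_leafSet_inter hd hc hl (h hl) with h1 | h1
  · exact h1
  · rcases eq_or_ne v u with rfl | hne
    · exact h1
    · obtain ⟨c, hcu, hvc⟩ := reach_child hd h1 hne
      obtain ⟨l', h2, h3⟩ := exists_leaf_notMem hd hc hcu
      exact absurd (leafSet_mono hvc (h h2)) h3

theorem leafSet_injective : Function.Injective (leafSet p q) := fun _ _ h =>
  reach_antisymm hd ((leafSet_subset_iff hd hc).1 h.le) ((leafSet_subset_iff hd hc).1 h.ge)

theorem two_le_card_leafSet (v : V) : 2 ≤ (leafSet p q v).card := by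
  by_cases h1 : ∃ c, p c = some v
  · obtain ⟨c, h1⟩ := h1
    obtain ⟨l, hl⟩ := leafSet_nonempty hd hc c
    obtain ⟨l', h2, h3⟩ := exists_leaf_notMem hd hc h1
    exact Finset.one_lt_card.2 ⟨l', h2, l, leafSet_mono (ReflTransGen.single h1) hl,
      fun h => h3 (h ▸ hl)⟩
  · push Not at h1
    have h := hc v
    rw [childCount, Finset.filter_false_of_mem fun c _ => h1 c, Finset.card_empty, zero_add] at h
    exact h.trans (Finset.card_le_card fun l hl =>
      mem_leafSet.2 ⟨v, (Finset.mem_filter.1 hl).2, ReflTransGen.refl⟩)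

/-- Every forest in which each vertex has at least two children is the forest of a laminar
family. -/
theorem exists_laminar [DecidableEq ι] : ∃ (H : Finset (Finset ι)) (ε : V ≃ H), Laminar H ∧
    (∀ v, par H (ε v) = (p v).map ε) ∧ ∀ l, par H {l} = (q l).map ε := by
  classical
  let H : Finset (Finset ι) := Finset.univ.image (leafSet p q)
  have hmem : ∀ v, leafSet p q v ∈ H := fun v => Finset.mem_image_of_mem _ (Finset.mem_univ v)
  have hall : ∀ S ∈ H, ∃ v, leafSet p q v = S := fun S hS => by simpa [H] using hS
  let ε : V ≃ H := Equiv.ofBijective (fun v => ⟨leafSet p q v, hmem v⟩)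
    ⟨fun u v h => leafSet_injective hd hc (congrArg Subtype.val h), by
      rintro ⟨S, hS⟩
      obtain ⟨v, rfl⟩ := hall S hS
      exact ⟨v, rfl⟩⟩
  have hL : Laminar H := by
    refine ⟨fun S hS => ?_, fun S hS T hT => ?_⟩
    · obtain ⟨v, rfl⟩ := hall S hS
      exact two_le_card_leafSet hd hc v
    · obtain ⟨u, rfl⟩ := hall S hS
      obtain ⟨v, rfl⟩ := hall T hT
      by_cases h : Disjoint (leafSet p q u) (leafSet p q v)
      · exact Or.inr (Or.inr h)
      · obtain ⟨l, hu, hv⟩ := Finset.not_disjoint_iff.1 h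
        rcases reach_of_leafSet_inter hd hc hu hv with h1 | h1
        · exact Or.inl (leafSet_mono h1)
        · exact Or.inr (Or.inl (leafSet_mono h1))
  refine ⟨H, ε, hL, fun v => ?_, fun l => ?_⟩
  -- A vertex with strictly larger leaf set is a proper ancestor, so it is the parent of `v` or lies
  -- above it; the parent is therefore the smallest such member.
  · have key : ∀ t, leafSet p q v ⊂ leafSet p q t →
        ∃ u, p v = some u ∧ ReflTransGen (fun x y => p x = some y) u t := by
      intro t ht
      rcases ReflTransGen.cases_head ((leafSet_subset_iff hd hc).1 ht.1) with rfl | ⟨u, h1, h2⟩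
      · exact absurd subset_rfl ht.2
      · exact ⟨u, h1, h2⟩
    cases hp : p v with
    | none =>
      refine (par_eq_none hL (leafSet_nonempty hd hc v)).2 fun T hT hvT => ?_
      obtain ⟨t, rfl⟩ := hall T hT
      obtain ⟨u, hu, -⟩ := key t hvT
      rw [hp] at hu
      cases hu
    | some u =>
      refine par_eq_some.2 ⟨⟨leafSet_mono (ReflTransGen.single hp), fun h => ?_⟩,
        fun T hT hvT => ?_⟩
      · obtain ⟨l, h1, h2⟩ := exists_leaf_notMem hd hc hp
        exact h2 (h h1)
      · obtain ⟨t, rfl⟩ := hall T hT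
        obtain ⟨u', hu', h2⟩ := key t hvT
        obtain rfl : u = u' := Option.some.inj (hp.symm.trans hu')
        exact leafSet_mono h2
  · have key : ∀ t, {l} ⊂ leafSet p q t →
        ∃ u, q l = some u ∧ ReflTransGen (fun x y => p x = some y) u t := fun t ht =>
      mem_leafSet.1 (ht.1 (Finset.mem_singleton_self l))
    cases hq : q l with
    | none =>
      refine (par_eq_none hL (Finset.singleton_nonempty l)).2 fun T hT hvT => ?_
      obtain ⟨t, rfl⟩ := hall T hT
      obtain ⟨u, hu, -⟩ := key t hvT
      rw [hq] at hu
      cases hu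
    | some u =>
      refine par_eq_some.2 ⟨?_, fun T hT hvT => ?_⟩
      · refine (Finset.singleton_subset_iff.2
          (mem_leafSet.2 ⟨u, hq, ReflTransGen.refl⟩)).ssubset_of_ne fun h => ?_
        have := two_le_card_leafSet hd hc u
        change {l} = leafSet p q u at h
        rw [← h, Finset.card_singleton] at this
        omega
      · obtain ⟨t, rfl⟩ := hall T hT
        obtain ⟨u', hu', h2⟩ := key t hvT
        obtain rfl : u = u' := Option.some.inj (hq.symm.trans hu')
        exact leafSet_mono h2

end Rank

/-- In the forest of a laminar family each vertex has at least two children. -/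
theorem Laminar.two_le_childCount [DecidableEq ι] {H : Finset (Finset ι)} (hH : Laminar H)
    (S : H) : 2 ≤ childCount (fun S : H => par H S) (fun l : ι => par H {l}) (some S) := by
  classical
  -- The children of `S` cover it. One vertex child is a proper subset and cannot cover `S` alone;
  -- without vertex children, the elements of `S`, at least two, are all leaf children.
  have hcover : ∀ l ∈ S.1, par H {l} = some S ∨ ∃ X : H, par H X.1 = some S ∧ l ∈ X.1 := by
    intro l hl
    by_cases h : ∃ T ∈ H, T ⊂ S.1 ∧ l ∈ T
    · right
      obtain ⟨T, hT, hTS, hlT⟩ := h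
      obtain ⟨X, hX, hmax⟩ := Finset.exists_max_image (H.filter fun T => T ⊂ S.1 ∧ l ∈ T)
        Finset.card ⟨T, Finset.mem_filter.2 ⟨hT, hTS, hlT⟩⟩
      obtain ⟨hXH, hXS, hlX⟩ := Finset.mem_filter.1 hX
      refine ⟨⟨X, hXH⟩, par_eq_some.2 ⟨hXS, fun T hT hXT => ?_⟩, hlX⟩
      rcases hH.2 S S.2 T hT with h1 | h1 | h1
      · exact h1
      · rcases eq_or_ne T S with rfl | hne
        · exact subset_rfl
        · have := hmax T (Finset.mem_filter.2 ⟨hT, h1.ssubset_of_ne hne, hXT.1 hlX⟩)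
          have : X.card < T.card := Finset.card_lt_card hXT
          omega
      · exact absurd (hXT.1 hlX) (Finset.disjoint_left.1 h1 hl)
    · left
      push Not at h
      refine par_eq_some.2 ⟨(Finset.singleton_subset_iff.2 hl).ssubset_of_ne fun h' => ?_,
        fun T hT hlT => ?_⟩
      · have := hH.1 S S.2
        rw [← h', Finset.card_singleton] at this
        omega
      · have hlT' := hlT.1 (Finset.mem_singleton_self l)
        rcases hH.2 S S.2 T hT with h1 | h1 | h1
        · exact h1
        · rcases eq_or_ne T S with rfl | hne
          · exact subset_rfl
          · exact absurd hlT' (h T hT (h1.ssubset_of_ne hne))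
        · exact absurd hlT' (Finset.disjoint_left.1 h1 hl)
  change 2 ≤ (Finset.univ.filter fun v : H => par H v.1 = some S).card +
    (Finset.univ.filter fun l : ι => par H {l} = some S).card
  by_cases hX : ∃ X : H, par H X.1 = some S
  · obtain ⟨X, hX⟩ := hX
    have hXm : X ∈ Finset.univ.filter fun v : H => par H v.1 = some S := by simpa using hX
    obtain ⟨l, hl, hlX⟩ := Finset.exists_of_ssubset (par_eq_some.1 hX).1
    have h1 := Finset.card_pos.2 ⟨X, hXm⟩
    rcases hcover l hl with h | ⟨Y, hY, hlY⟩
    · have h2 : 0 < (Finset.univ.filter fun l : ι => par H {l} = some S).card :=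
        Finset.card_pos.2 ⟨l, by simpa using h⟩
      omega
    · have : 1 < (Finset.univ.filter fun v : H => par H v.1 = some S).card :=
        Finset.one_lt_card.2 ⟨X, hXm, Y, by simpa using hY, fun h => hlX (h ▸ hlY)⟩
      omega
  · push Not at hX
    have h2 : S.1 ⊆ Finset.univ.filter fun l : ι => par H {l} = some S := by
      intro l hl
      rcases hcover l hl with h | ⟨Y, hY, -⟩
      · simpa using h
      · exact absurd hY (hX Y)
    have := Finset.card_le_card h2
    have := hH.1 S S.2
    omega

end Forests

/-! ### Pointed trees as pairs of forests -/

section Models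

open Relation Sum

variable {k m : ℕ}

namespace PointedTree

/-- The pointed tree with all directions reversed. -/
def reverse (T : PointedTree k m) : PointedTree m k where
  N := T.N
  edges := T.edges.map (Equiv.prodComm _ _).toEmbedding
  outLeg := T.inLeg
  inLeg := T.outLeg
  asymm u v h := by
    simp only [Finset.mem_map_equiv, Equiv.prodComm_symm, Equiv.prodComm_apply, Prod.swap_prod_mk]
      at h ⊢
    exact T.asymm _ _ h
  isTree := by
    convert T.isTree using 1
    ext u v
    simp only [SimpleGraph.fromRel_adj, Finset.mem_map_equiv, Equiv.prodComm_symm,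
      Equiv.prodComm_apply, Prod.swap_prod_mk]
    exact and_congr_right fun _ => or_comm

variable {T : PointedTree k m}

theorem mem_edges_reverse {u v : Option (Fin T.reverse.N)} :
    (u, v) ∈ T.reverse.edges ↔ (v, u) ∈ T.edges :=
  Finset.mem_map_equiv

theorem outDeg_eq (v : Option (Fin T.N)) : T.outDeg v =
    (T.edges.filter fun e => e.1 = v).card + (Finset.univ.filter fun l => T.outLeg l = v).card := by
  rw [outDeg]
  congr 1
  rw [Finset.card_filter, Finset.card_filter]
  exact Finset.sum_coe_sort T.edges fun e => if e.1 = v then 1 else 0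

theorem inDeg_eq (v : Option (Fin T.N)) : T.inDeg v =
    (T.edges.filter fun e => e.2 = v).card + (Finset.univ.filter fun l => T.inLeg l = v).card := by
  rw [inDeg]
  congr 1
  rw [Finset.card_filter, Finset.card_filter]
  exact Finset.sum_coe_sort T.edges fun e => if e.2 = v then 1 else 0

theorem outDeg_reverse (v : Option (Fin T.reverse.N)) : T.reverse.outDeg v = T.inDeg v := by
  refine (outDeg_eq (T := T.reverse) v).trans (Eq.trans ?_ (inDeg_eq (T := T) v).symm)
  congr 1
  rw [Finset.card_filter, Finset.card_filter]
  exact Finset.sum_map T.edges _ fun e : Option (Fin T.reverse.N) × Option (Fin T.reverse.N) =>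
    if e.1 = v then 1 else 0

theorem inDeg_reverse (v : Option (Fin T.reverse.N)) : T.reverse.inDeg v = T.outDeg v := by
  refine (inDeg_eq (T := T.reverse) v).trans (Eq.trans ?_ (outDeg_eq (T := T) v).symm)
  congr 1
  rw [Finset.card_filter, Finset.card_filter]
  exact Finset.sum_map T.edges _ fun e : Option (Fin T.reverse.N) × Option (Fin T.reverse.N) =>
    if e.2 = v then 1 else 0

theorem Semistable.reverse (h : T.Semistable) : T.reverse.Semistable := fun v => by
  rw [outDeg_reverse, inDeg_reverse, add_comm]
  exact ⟨(h v).2.1, (h v).1, (h v).2.2⟩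

theorem Contractible.reverse (h : T.Contractible) : T.reverse.Contractible := fun u v huv => by
  rw [outDeg_reverse, inDeg_reverse]
  exact (h v u (mem_edges_reverse.1 huv)).symm

/-- The tree `T` consists of the distinguished vertex, the forest `(p₁, q₁)` directed away from
it and the forest `(p₂, q₂)` directed towards it. -/
structure IsModel (T : PointedTree k m) {V₁ V₂ : Type*} (p₁ : V₁ → Option V₁)
    (q₁ : Fin k → Option V₁) (p₂ : V₂ → Option V₂) (q₂ : Fin m → Option V₂)
    (e : V₁ ⊕ V₂ ≃ Fin T.N) : Prop where
  edges : ∀ u v, (u, v) ∈ T.edges ↔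
    (∃ X, u = (p₁ X).map (fun w => e (inl w)) ∧ v = some (e (inl X))) ∨
    ∃ X, u = some (e (inr X)) ∧ v = (p₂ X).map fun w => e (inr w)
  outLeg : ∀ l, T.outLeg l = (q₁ l).map fun w => e (inl w)
  inLeg : ∀ l, T.inLeg l = (q₂ l).map fun w => e (inr w)

namespace IsModel

section

variable {V₁ V₂ : Type*} {p₁ : V₁ → Option V₁} {q₁ : Fin k → Option V₁} {p₂ : V₂ → Option V₂}
  {q₂ : Fin m → Option V₂} {e : V₁ ⊕ V₂ ≃ Fin T.N}

theorem reverse (h : T.IsModel p₁ q₁ p₂ q₂ e) :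
    T.reverse.IsModel p₂ q₂ p₁ q₁ ((Equiv.sumComm V₂ V₁).trans e) where
  edges u v := by
    refine mem_edges_reverse.trans ((h.edges _ _).trans (or_comm.trans
      (or_congr (exists_congr fun _ => and_comm) (exists_congr fun _ => and_comm))))
  outLeg := h.inLeg
  inLeg := h.outLeg

theorem iso {T' : PointedTree k m} {e' : V₁ ⊕ V₂ ≃ Fin T'.N} (h : T.IsModel p₁ q₁ p₂ q₂ e)
    (h' : T'.IsModel p₁ q₁ p₂ q₂ e') : T.Iso T' := by
  have inj := Option.map_injective (e.symm.trans e').injective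
  refine ⟨e.symm.trans e', fun u v => ?_, fun l => ?_, fun l => ?_⟩
  · rw [h.edges, h'.edges]
    refine or_congr (exists_congr fun X => ?_) (exists_congr fun X => ?_) <;>
    · rw [← inj.eq_iff, ← inj.eq_iff (a := v)]
      simp only [Option.map_map, Function.comp_def, Equiv.trans_apply, Equiv.symm_apply_apply,
        Option.map_some]
  · rw [h.outLeg, h'.outLeg]
    simp only [Option.map_map, Function.comp_def, Equiv.trans_apply, Equiv.symm_apply_apply]
  · rw [h.inLeg, h'.inLeg]
    simp only [Option.map_map, Function.comp_def, Equiv.trans_apply, Equiv.symm_apply_apply]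

theorem of_iso {T' : PointedTree k m} (h : T.IsModel p₁ q₁ p₂ q₂ e) (hT : T.Iso T') :
    ∃ e', T'.IsModel p₁ q₁ p₂ q₂ e' := by
  obtain ⟨σ, h1, h2, h3⟩ := hT
  refine ⟨e.trans σ, fun u v => ?_, fun l => ?_, fun l => ?_⟩
  · have inj := Option.map_injective σ.injective
    obtain ⟨u, rfl⟩ : ∃ u', u'.map σ = u := ⟨u.map σ.symm, by simp [Option.map_map]⟩
    obtain ⟨v, rfl⟩ : ∃ v', v'.map σ = v := ⟨v.map σ.symm, by simp [Option.map_map]⟩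
    rw [← h1, h.edges]
    refine or_congr (exists_congr fun X => ?_) (exists_congr fun X => ?_) <;>
    · rw [← inj.eq_iff, ← inj.eq_iff (a := v)]
      simp only [Option.map_map, Function.comp_def, Equiv.trans_apply, Option.map_some]
  · rw [h2, h.outLeg]
    simp only [Option.map_map, Function.comp_def, Equiv.trans_apply]
  · rw [h3, h.inLeg]
    simp only [Option.map_map, Function.comp_def, Equiv.trans_apply]

theorem congr {V₁' V₂' : Type*} {p₁' : V₁' → Option V₁'} {q₁' : Fin k → Option V₁'}
    {p₂' : V₂' → Option V₂'} {q₂' : Fin m → Option V₂'} (h : T.IsModel p₁ q₁ p₂ q₂ e)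
    (ε₁ : V₁ ≃ V₁') (ε₂ : V₂ ≃ V₂') (hp₁ : ∀ v, p₁' (ε₁ v) = (p₁ v).map ε₁)
    (hq₁ : ∀ l, q₁' l = (q₁ l).map ε₁) (hp₂ : ∀ v, p₂' (ε₂ v) = (p₂ v).map ε₂)
    (hq₂ : ∀ l, q₂' l = (q₂ l).map ε₂) :
    T.IsModel p₁' q₁' p₂' q₂' ((Equiv.sumCongr ε₁ ε₂).symm.trans e) where
  edges u v := by
    rw [h.edges, ← ε₁.exists_congr_right, ← ε₂.exists_congr_right]
    simp only [hp₁, hp₂, Option.map_map, Function.comp_def, Equiv.trans_apply,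
      Equiv.sumCongr_symm, Equiv.sumCongr_apply, Sum.map_inl, Sum.map_inr, Equiv.symm_apply_apply]
  outLeg l := by
    simp only [h.outLeg, hq₁, Option.map_map, Function.comp_def, Equiv.trans_apply,
      Equiv.sumCongr_symm, Equiv.sumCongr_apply, Sum.map_inl, Equiv.symm_apply_apply]
  inLeg l := by
    simp only [h.inLeg, hq₂, Option.map_map, Function.comp_def, Equiv.trans_apply,
      Equiv.sumCongr_symm, Equiv.sumCongr_apply, Sum.map_inr, Equiv.symm_apply_apply]

/-- The edges of `T` correspond to the ordinary vertices. -/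
def edgeEquiv (h : T.IsModel p₁ q₁ p₂ q₂ e) : V₁ ⊕ V₂ ≃ T.edges :=
  Equiv.ofBijective (Sum.elim
    (fun X => ⟨((p₁ X).map (fun w => e (inl w)), some (e (inl X))),
      (h.edges _ _).2 (Or.inl ⟨X, rfl, rfl⟩)⟩)
    (fun X => ⟨(some (e (inr X)), (p₂ X).map (fun w => e (inr w))),
      (h.edges _ _).2 (Or.inr ⟨X, rfl, rfl⟩)⟩)) (by
    constructor
    · rintro (X | X) (Y | Y) hXY <;>
        simp only [Sum.elim_inl, Sum.elim_inr, Subtype.mk.injEq, Prod.mk.injEq,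
          Option.some.injEq, EmbeddingLike.apply_eq_iff_eq] at hXY
      · exact hXY.2
      · obtain ⟨w, -, hw⟩ := Option.map_eq_some_iff.1 hXY.2.symm
        simp at hw
      · obtain ⟨w, -, hw⟩ := Option.map_eq_some_iff.1 hXY.2
        simp at hw
      · exact hXY.1
    · rintro ⟨⟨u, v⟩, huv⟩
      rcases (h.edges u v).1 huv with ⟨X, rfl, rfl⟩ | ⟨X, rfl, rfl⟩
      · exact ⟨inl X, rfl⟩
      · exact ⟨inr X, rfl⟩)

theorem edgeEquiv_inl (h : T.IsModel p₁ q₁ p₂ q₂ e) (X : V₁) :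
    (h.edgeEquiv (inl X)).1 = ((p₁ X).map (fun w => e (inl w)), some (e (inl X))) := rfl

theorem edgeEquiv_inr (h : T.IsModel p₁ q₁ p₂ q₂ e) (X : V₂) :
    (h.edgeEquiv (inr X)).1 = (some (e (inr X)), (p₂ X).map (fun w => e (inr w))) := rfl

end

theorem map_filter_eq_sum {α β : Type*} (s : Finset α) (P : α → Prop) [DecidablePred P]
    (r : α → β) : (s.filter P).val.map r = ∑ x ∈ s, if P x then {r x} else 0 := by
  rw [← Finset.sum_filter, Finset.sum, ← Multiset.sum_map_singleton (Multiset.map r _), Multiset.map_map]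
  rfl

variable {n : ℕ} {V₁ V₂ : Type*} [Fintype V₁] [Fintype V₂]
  {p₁ : V₁ → Option V₁} {q₁ : Fin k → Option V₁} {p₂ : V₂ → Option V₂}
  {q₂ : Fin m → Option V₂} {e : V₁ ⊕ V₂ ≃ Fin T.N}

theorem outIndices_eq (h : T.IsModel p₁ q₁ p₂ q₂ e) (a : Fin k → Fin n)
    (r : V₁ ⊕ V₂ → Fin n) (v : Option (Fin T.N)) :
    T.outIndices a (r ∘ h.edgeEquiv.symm) v =
      ((∑ X, if (p₁ X).map (fun w => e (inl w)) = v then {r (inl X)} else 0) +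
        ∑ X, if some (e (inr X)) = v then {r (inr X)} else 0) +
      ∑ l, if (q₁ l).map (fun w => e (inl w)) = v then {a l} else 0 := by
  rw [outIndices, map_filter_eq_sum, map_filter_eq_sum]
  simp only [← h.outLeg]
  congr 1
  rw [← Fintype.sum_equiv h.edgeEquiv _ _ (fun _ => rfl), Fintype.sum_sum_type]
  simp only [edgeEquiv_inl, edgeEquiv_inr, Function.comp_apply, Equiv.symm_apply_apply]

theorem inIndices_eq (h : T.IsModel p₁ q₁ p₂ q₂ e) (b : Fin m → Fin n)
    (s : V₁ ⊕ V₂ → Fin n) (v : Option (Fin T.N)) :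
    T.inIndices b (s ∘ h.edgeEquiv.symm) v =
      ((∑ X, if some (e (inl X)) = v then {s (inl X)} else 0) +
        ∑ X, if (p₂ X).map (fun w => e (inr w)) = v then {s (inr X)} else 0) +
      ∑ l, if (q₂ l).map (fun w => e (inr w)) = v then {b l} else 0 := by
  rw [inIndices, map_filter_eq_sum, map_filter_eq_sum]
  simp only [← h.inLeg]
  congr 1
  rw [← Fintype.sum_equiv h.edgeEquiv _ _ (fun _ => rfl), Fintype.sum_sum_type]
  simp only [edgeEquiv_inl, edgeEquiv_inr, Function.comp_apply, Equiv.symm_apply_apply]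

theorem card_eq (h : T.IsModel p₁ q₁ p₂ q₂ e) : T.edges.card = T.N := by
  rw [← Fintype.card_coe, ← Fintype.card_congr h.edgeEquiv, Fintype.card_congr e,
    Fintype.card_fin]

variable [DecidableEq V₁] [DecidableEq V₂]

theorem outIndices_inl (h : T.IsModel p₁ q₁ p₂ q₂ e) (a : Fin k → Fin n)
    (r : V₁ ⊕ V₂ → Fin n) (X : V₁) :
    T.outIndices a (r ∘ h.edgeEquiv.symm) (some (e (inl X))) =
      childIdx p₁ q₁ Finset.univ a (fun Y => r (inl Y)) (some X) := by
  rw [outIndices_eq]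
  simp [childIdx, Option.map_eq_some_iff]

theorem outIndices_none (h : T.IsModel p₁ q₁ p₂ q₂ e) (a : Fin k → Fin n)
    (r : V₁ ⊕ V₂ → Fin n) :
    T.outIndices a (r ∘ h.edgeEquiv.symm) none =
      childIdx p₁ q₁ Finset.univ a (fun Y => r (inl Y)) none := by
  rw [outIndices_eq]
  simp [childIdx]

/-- At a vertex of the forest directed towards `•`, the only outward half-edge is the edge to its
parent. -/
theorem outIndices_inr (h : T.IsModel p₁ q₁ p₂ q₂ e) (a : Fin k → Fin n)
    (r : V₁ ⊕ V₂ → Fin n) (X : V₂) :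
    T.outIndices a (r ∘ h.edgeEquiv.symm) (some (e (inr X))) = {r (inr X)} := by
  rw [outIndices_eq]
  simp [Option.map_eq_some_iff]

theorem inIndices_inl (h : T.IsModel p₁ q₁ p₂ q₂ e) (b : Fin m → Fin n)
    (s : V₁ ⊕ V₂ → Fin n) (X : V₁) :
    T.inIndices b (s ∘ h.edgeEquiv.symm) (some (e (inl X))) = {s (inl X)} := by
  rw [inIndices_eq]
  simp [Option.map_eq_some_iff]

theorem inIndices_none (h : T.IsModel p₁ q₁ p₂ q₂ e) (b : Fin m → Fin n)
    (s : V₁ ⊕ V₂ → Fin n) :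
    T.inIndices b (s ∘ h.edgeEquiv.symm) none =
      childIdx p₂ q₂ Finset.univ b (fun Y => s (inr Y)) none := by
  rw [inIndices_eq]
  simp [childIdx]

theorem inIndices_inr (h : T.IsModel p₁ q₁ p₂ q₂ e) (b : Fin m → Fin n)
    (s : V₁ ⊕ V₂ → Fin n) (X : V₂) :
    T.inIndices b (s ∘ h.edgeEquiv.symm) (some (e (inr X))) =
      childIdx p₂ q₂ Finset.univ b (fun Y => s (inr Y)) (some X) := by
  rw [inIndices_eq]
  simp [childIdx, Option.map_eq_some_iff]

theorem outDeg_inl (h : T.IsModel p₁ q₁ p₂ q₂ e) (X : V₁) :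
    T.outDeg (some (e (inl X))) = childCount p₁ q₁ (some X) := by
  rw [← card_outIndices (n := 1) T 0 ((0 : V₁ ⊕ V₂ → Fin 1) ∘ h.edgeEquiv.symm),
    outIndices_inl, card_childIdx]

theorem outDeg_inr (h : T.IsModel p₁ q₁ p₂ q₂ e) (X : V₂) :
    T.outDeg (some (e (inr X))) = 1 := by
  rw [← card_outIndices (n := 1) T 0 ((0 : V₁ ⊕ V₂ → Fin 1) ∘ h.edgeEquiv.symm),
    outIndices_inr, Multiset.card_singleton]

theorem inDeg_inl (h : T.IsModel p₁ q₁ p₂ q₂ e) (X : V₁) :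
    T.inDeg (some (e (inl X))) = 1 := by
  rw [← card_inIndices (n := 1) T 0 ((0 : V₁ ⊕ V₂ → Fin 1) ∘ h.edgeEquiv.symm),
    inIndices_inl, Multiset.card_singleton]

theorem inDeg_inr (h : T.IsModel p₁ q₁ p₂ q₂ e) (X : V₂) :
    T.inDeg (some (e (inr X))) = childCount p₂ q₂ (some X) := by
  rw [← card_inIndices (n := 1) T 0 ((0 : V₁ ⊕ V₂ → Fin 1) ∘ h.edgeEquiv.symm),
    inIndices_inr, card_childIdx]

theorem semistable (h : T.IsModel p₁ q₁ p₂ q₂ e) (h₁ : ∀ X, 2 ≤ childCount p₁ q₁ (some X))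
    (h₂ : ∀ X, 2 ≤ childCount p₂ q₂ (some X)) : T.Semistable := by
  intro v
  obtain ⟨X | X, rfl⟩ := e.surjective v
  · rw [h.outDeg_inl, h.inDeg_inl]
    have := h₁ X
    omega
  · rw [h.outDeg_inr, h.inDeg_inr]
    have := h₂ X
    omega

theorem contractible (h : T.IsModel p₁ q₁ p₂ q₂ e) : T.Contractible := by
  intro u v huv
  rcases (h.edges u v).1 huv with ⟨X, rfl, rfl⟩ | ⟨X, rfl, rfl⟩
  · exact Or.inr ⟨by simp, h.inDeg_inl X⟩
  · exact Or.inl ⟨by simp, h.outDeg_inr X⟩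

/-- A crude bound, uniform in the tree: at most `k + m` edges and `k` legs. It determines a
sufficient order of the normal coordinates. -/
theorem outDeg_le (h : T.IsModel p₁ q₁ p₂ q₂ e) (hT : T.Semistable) (v : Option (Fin T.N)) :
    T.outDeg v ≤ 2 * (k + m) := by
  have h1 := hT.N_le
  rw [outDeg_eq]
  have h2 := Finset.card_filter_le T.edges fun e => e.1 = v
  have h3 := Finset.card_filter_le (Finset.univ : Finset (Fin k)) fun l => T.outLeg l = v
  rw [h.card_eq] at h2
  rw [Finset.card_univ, Fintype.card_fin] at h3
  omega

theorem inDeg_le (h : T.IsModel p₁ q₁ p₂ q₂ e) (hT : T.Semistable) (v : Option (Fin T.N)) :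
    T.inDeg v ≤ 2 * (k + m) := by
  have h1 := hT.N_le
  rw [inDeg_eq]
  have h2 := Finset.card_filter_le T.edges fun e => e.2 = v
  have h3 := Finset.card_filter_le (Finset.univ : Finset (Fin m)) fun l => T.inLeg l = v
  rw [h.card_eq] at h2
  rw [Finset.card_univ, Fintype.card_fin] at h3
  omega

/-- The value of `f_T` is the contraction along the two forests of which `T` consists. -/
theorem eval_poly (h : T.IsModel p₁ q₁ p₂ q₂ e) (hT : T.Semistable) (a : Fin k → Fin n)
    (b : Fin m → Fin n) (ν : JetVar n → ℂ) (W₁ W₂ : Fin n → Multiset (Fin n) → ℂ)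
    (hW₁ : ∀ i (A : Multiset (Fin n)) (hA : ∀ j : Fin n, 1 ≤ A.card ∧
      1 ≤ ({j} : Multiset (Fin n)).card ∧ 3 ≤ A.card + ({j} : Multiset (Fin n)).card),
      A.card ≤ 2 * (k + m) → ∑ j, ν (.inv i j) * ν (.metric A {j} (hA j)) = W₁ i A)
    (hW₂ : ∀ i (B : Multiset (Fin n)) (hB : ∀ j : Fin n, 1 ≤ ({j} : Multiset (Fin n)).card ∧
      1 ≤ B.card ∧ 3 ≤ ({j} : Multiset (Fin n)).card + B.card),
      B.card ≤ 2 * (k + m) → ∑ j, ν (.inv j i) * ν (.metric {j} B (hB j)) = W₂ i B) :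
    MvPolynomial.eval ν (T.poly hT a b) =
      forestVal p₂ q₂ Finset.univ b W₂ fun B =>
        forestVal p₁ q₁ Finset.univ a W₁ fun A => ν (.func A B) := by
  classical
  -- Extending by zero removes the proof argument of the metric variables, so that their index
  -- multisets can be rewritten.
  let M : Multiset (Fin n) → Multiset (Fin n) → ℂ := fun A B =>
    if hAB : 1 ≤ A.card ∧ 1 ≤ B.card ∧ 3 ≤ A.card + B.card then ν (.metric A B hAB) else 0
  have hM : ∀ A B hAB, ν (.metric A B hAB) = M A B := fun A B hAB => by
    simp only [M, dif_pos hAB]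
  let c₁ := fun (ρ : V₁ → Fin n) o => childIdx p₁ q₁ Finset.univ a ρ o
  let c₂ := fun (ρ : V₂ → Fin n) o => childIdx p₂ q₂ Finset.univ b ρ o
  have hcard₁ : ∀ ρ X, 2 ≤ (c₁ ρ (some X)).card ∧ (c₁ ρ (some X)).card ≤ 2 * (k + m) := by
    intro ρ X
    have h1 := h.outDeg_le hT (some (e (inl X)))
    have h2 := hT (e (inl X))
    rw [h.outDeg_inl] at h1 h2
    rw [h.inDeg_inl] at h2
    simp only [c₁, card_childIdx]
    omega
  have hcard₂ : ∀ ρ X, 2 ≤ (c₂ ρ (some X)).card ∧ (c₂ ρ (some X)).card ≤ 2 * (k + m) := by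
    intro ρ X
    have h1 := h.inDeg_le hT (some (e (inr X)))
    have h2 := hT (e (inr X))
    rw [h.inDeg_inr] at h1 h2
    rw [h.outDeg_inr] at h2
    simp only [c₂, card_childIdx]
    omega
  have hW₁' : ∀ ρ X i, W₁ i (c₁ ρ (some X)) = ∑ j, ν (.inv i j) * M (c₁ ρ (some X)) {j} := by
    intro ρ X i
    have hc := hcard₁ ρ X
    have h3 : ∀ j : Fin n, 1 ≤ (c₁ ρ (some X)).card ∧ 1 ≤ ({j} : Multiset (Fin n)).card ∧
        3 ≤ (c₁ ρ (some X)).card + ({j} : Multiset (Fin n)).card := by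
      intro j; rw [Multiset.card_singleton]; omega
    rw [← hW₁ i _ h3 hc.2]
    exact Finset.sum_congr rfl fun j _ => by rw [hM]
  have hW₂' : ∀ ρ X i, W₂ i (c₂ ρ (some X)) = ∑ j, ν (.inv j i) * M {j} (c₂ ρ (some X)) := by
    intro ρ X i
    have hc := hcard₂ ρ X
    have h3 : ∀ j : Fin n, 1 ≤ ({j} : Multiset (Fin n)).card ∧ 1 ≤ (c₂ ρ (some X)).card ∧
        3 ≤ ({j} : Multiset (Fin n)).card + (c₂ ρ (some X)).card := by
      intro j; rw [Multiset.card_singleton]; omega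
    rw [← hW₂ i _ h3 hc.2]
    exact Finset.sum_congr rfl fun j _ => by rw [hM]
  -- Each ordinary vertex owns the edge to its parent, so index assignments on edges are pairs of
  -- assignments on the two vertex sets.
  let Φ : (V₁ → Fin n) × (V₂ → Fin n) ≃ (T.edges → Fin n) :=
    (Equiv.sumArrowEquivProdArrow V₁ V₂ (Fin n)).symm.trans (h.edgeEquiv.arrowCongr (Equiv.refl _))
  have hΦ : ∀ x, Φ x = Sum.elim x.1 x.2 ∘ h.edgeEquiv.symm := fun x => rfl
  rw [poly, map_sum, ← Fintype.sum_equiv Φ _ _ (fun _ => rfl)]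
  simp only [map_sum]
  rw [Finset.sum_congr rfl fun x _ => (Fintype.sum_equiv Φ _ _ (fun _ => rfl)).symm]
  have term : ∀ x y : (V₁ → Fin n) × (V₂ → Fin n), MvPolynomial.eval ν
      ((∏ e, MvPolynomial.X (.inv (Φ x e) (Φ y e))) * (∏ v : Fin T.N, MvPolynomial.X
        (.metric (T.outIndices a (Φ x) (some v)) (T.inIndices b (Φ y) (some v))
          (by rw [card_outIndices, card_inIndices]; exact hT v))) *
        MvPolynomial.X (.func (T.outIndices a (Φ x) none) (T.inIndices b (Φ y) none))) =
      (∏ X, ν (.inv (x.1 X) (y.1 X)) * M (c₁ x.1 (some X)) {y.1 X}) *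
        (∏ X, ν (.inv (x.2 X) (y.2 X)) * M {x.2 X} (c₂ y.2 (some X))) *
        ν (.func (c₁ x.1 none) (c₂ y.2 none)) := by
    intro x y
    simp only [map_mul, map_prod, MvPolynomial.eval_X, hM]
    rw [← Fintype.prod_equiv h.edgeEquiv _ _ (fun _ => rfl), Fintype.prod_sum_type,
      ← Fintype.prod_equiv e _ _ (fun _ => rfl), Fintype.prod_sum_type]
    simp only [hΦ, h.outIndices_inl, h.outIndices_inr, h.outIndices_none, h.inIndices_inl,
      h.inIndices_inr, h.inIndices_none, Function.comp_apply, Equiv.symm_apply_apply, Sum.elim_inl,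
      Sum.elim_inr, Finset.prod_mul_distrib, c₁, c₂]
    ring
  simp only [term]
  -- In the outward forest the head index of an edge occurs at one vertex only, and in the inward
  -- forest the tail index does. Summing over it, vertex by vertex, turns a vertex with its edge
  -- into `W₁` or `W₂`.
  have distrib₁ : ∀ F : V₁ → Fin n → ℂ, ∏ X, ∑ j, F X j = ∑ ρ : V₁ → Fin n, ∏ X, F X (ρ X) := by
    intro F
    rw [Finset.prod_univ_sum, Fintype.piFinset_univ]
  have distrib₂ : ∀ F : V₂ → Fin n → ℂ, ∏ X, ∑ j, F X j = ∑ ρ : V₂ → Fin n, ∏ X, F X (ρ X) := by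
    intro F
    rw [Finset.prod_univ_sum, Fintype.piFinset_univ]
  have e1 : ∀ ρ : V₁ → Fin n, ∏ v, W₁ (ρ v) (childIdx p₁ q₁ Finset.univ a ρ (some v)) =
      ∑ s : V₁ → Fin n, ∏ X, ν (.inv (ρ X) (s X)) * M (c₁ ρ (some X)) {s X} := by
    intro ρ
    refine Eq.trans ?_ (distrib₁ fun X j => ν (.inv (ρ X) j) * M (c₁ ρ (some X)) {j})
    exact Finset.prod_congr rfl fun X _ => hW₁' ρ X _
  have e2 : ∀ ρ : V₂ → Fin n, ∏ v, W₂ (ρ v) (childIdx p₂ q₂ Finset.univ b ρ (some v)) =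
      ∑ r : V₂ → Fin n, ∏ X, ν (.inv (r X) (ρ X)) * M {r X} (c₂ ρ (some X)) := by
    intro ρ
    refine Eq.trans ?_ (distrib₂ fun X j => ν (.inv j (ρ X)) * M {j} (c₂ ρ (some X)))
    exact Finset.prod_congr rfl fun X _ => hW₂' ρ X _
  simp only [forestVal, e1, e2, Fintype.sum_prod_type, Finset.mul_sum, Finset.sum_mul]
  symm
  rw [Finset.sum_comm]
  refine Finset.sum_congr rfl fun x₁ _ => ?_
  rw [Finset.sum_comm]
  symm
  rw [Finset.sum_comm]
  refine Finset.sum_congr rfl fun y₁ _ => ?_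
  rw [Finset.sum_comm]
  refine Finset.sum_congr rfl fun y₂ _ => Finset.sum_congr rfl fun x₂ _ => ?_
  simp only [c₁, c₂]
  ring

end IsModel

end PointedTree

end Models

/-! ### Contractible trees and laminar families -/

section Classification

open Relation Sum

/-- The graph which joins each vertex to its parent is a tree. -/
theorem isTree_of_parent {V : Type*} [Fintype V] (P : V → Option V) (d : V → ℕ)
    (hd : ∀ x y, P x = some y → d y < d x) (G : SimpleGraph (Option V))
    (hG : ∀ u v, G.Adj u v ↔ (∃ x, u = P x ∧ v = some x) ∨ ∃ x, u = some x ∧ v = P x) :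
    G.IsTree := by
  classical
  rw [SimpleGraph.isTree_iff_connected_and_card]
  constructor
  · have hr : ∀ v : V, G.Reachable none (some v) := by
      intro v
      induction hM : d v using Nat.strong_induction_on generalizing v with
      | _ M ih =>
        have hadj : G.Adj (P v) (some v) := (hG _ _).2 (Or.inl ⟨v, rfl, rfl⟩)
        cases hp : P v with
        | none => exact hp ▸ hadj.reachable
        | some u => exact (ih _ (hM ▸ hd _ _ hp) u rfl).trans (hp ▸ hadj.reachable)
    have hr' : ∀ v : Option V, G.Reachable none v := fun v => by
      cases v with
      | none => exact SimpleGraph.Reachable.refl _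
      | some v => exact hr v
    exact ⟨fun u v => (hr' u).symm.trans (hr' v)⟩
  · have hb : Function.Bijective fun x : V =>
        (⟨s(some x, P x), (hG _ _).2 (Or.inr ⟨x, rfl, rfl⟩)⟩ : G.edgeSet) := by
      constructor
      · intro x y h
        rcases Sym2.eq_iff.1 (congrArg Subtype.val h) with ⟨h1, -⟩ | ⟨h1, h2⟩
        · exact Option.some.inj h1
        · have := hd _ _ h2
          have := hd _ _ h1.symm
          omega
      · rintro ⟨s, hs⟩
        induction s with
        | _ u v =>
          rcases (hG u v).1 hs with ⟨x, rfl, rfl⟩ | ⟨x, rfl, rfl⟩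
          · exact ⟨x, Subtype.ext Sym2.eq_swap⟩
          · exact ⟨x, rfl⟩
    rw [← Nat.card_eq_of_bijective _ hb, Nat.card_eq_fintype_card, Nat.card_eq_fintype_card,
      Fintype.card_option]

namespace PointedTree

variable {k m : ℕ}

/-- Joining every vertex to its parent gives a tree because the depth functions exclude cycles;
edges are oriented according to the forest to which they belong. -/
theorem exists_isModel {V₁ V₂ : Type*} [Fintype V₁] [Fintype V₂] (p₁ : V₁ → Option V₁)
    (q₁ : Fin k → Option V₁) (p₂ : V₂ → Option V₂) (q₂ : Fin m → Option V₂) (d₁ : V₁ → ℕ)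
    (d₂ : V₂ → ℕ) (hd₁ : ∀ x y, p₁ x = some y → d₁ y < d₁ x)
    (hd₂ : ∀ x y, p₂ x = some y → d₂ y < d₂ x) :
    ∃ (T : PointedTree k m) (e : V₁ ⊕ V₂ ≃ Fin T.N), T.IsModel p₁ q₁ p₂ q₂ e := by
  classical
  let e : V₁ ⊕ V₂ ≃ Fin (Fintype.card (V₁ ⊕ V₂)) := Fintype.equivFin _
  let E : Finset (Option (Fin (Fintype.card (V₁ ⊕ V₂))) × Option (Fin (Fintype.card (V₁ ⊕ V₂)))) :=
    Finset.univ.image (Sum.elim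
      (fun X => ((p₁ X).map (fun w => e (inl w)), some (e (inl X))))
      (fun X => (some (e (inr X)), (p₂ X).map fun w => e (inr w))))
  have hE : ∀ u v, (u, v) ∈ E ↔
      (∃ X, u = (p₁ X).map (fun w => e (inl w)) ∧ v = some (e (inl X))) ∨
      ∃ X, u = some (e (inr X)) ∧ v = (p₂ X).map fun w => e (inr w) := by
    intro u v
    simp only [E, Finset.mem_image, Finset.mem_univ, true_and, Sum.exists, Sum.elim_inl,
      Sum.elim_inr, Prod.mk.injEq]
    exact or_congr (exists_congr fun X => and_congr eq_comm eq_comm)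
      (exists_congr fun X => and_congr eq_comm eq_comm)
  let P : Fin (Fintype.card (V₁ ⊕ V₂)) → Option (Fin (Fintype.card (V₁ ⊕ V₂))) := fun v =>
    Sum.elim (fun X => (p₁ X).map fun w => e (inl w)) (fun X => (p₂ X).map fun w => e (inr w))
      (e.symm v)
  let d : Fin (Fintype.card (V₁ ⊕ V₂)) → ℕ := fun v => Sum.elim d₁ d₂ (e.symm v)
  have hd : ∀ x y, P x = some y → d y < d x := by
    intro x y hxy
    obtain ⟨X | X, rfl⟩ := e.surjective x
    · simp only [P, Equiv.symm_apply_apply, Sum.elim_inl] at hxy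
      obtain ⟨w, hw, rfl⟩ := Option.map_eq_some_iff.1 hxy
      simpa [d] using hd₁ _ _ hw
    · simp only [P, Equiv.symm_apply_apply, Sum.elim_inr] at hxy
      obtain ⟨w, hw, rfl⟩ := Option.map_eq_some_iff.1 hxy
      simpa [d] using hd₂ _ _ hw
  have hPE : ∀ u v, (u, v) ∈ E → (∃ x, u = P x ∧ v = some x) ∨ ∃ x, u = some x ∧ v = P x := by
    intro u v huv
    rcases (hE u v).1 huv with ⟨X, h1, h2⟩ | ⟨X, h1, h2⟩
    · exact Or.inl ⟨e (inl X), by simpa [P] using h1, h2⟩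
    · exact Or.inr ⟨e (inr X), h1, by simpa [P] using h2⟩
  have hne : ∀ x, P x ≠ some x := fun x h => lt_irrefl _ (hd x x h)
  have hasymm : ∀ u v, (u, v) ∈ E → (v, u) ∉ E := by
    intro u v huv hvu
    rw [hE] at huv hvu
    rcases huv with ⟨X, rfl, rfl⟩ | ⟨X, rfl, rfl⟩ <;>
      rcases hvu with ⟨Y, h1, h2⟩ | ⟨Y, h1, h2⟩
    · obtain ⟨w, hw, hw'⟩ := Option.map_eq_some_iff.1 h1.symm
      obtain ⟨w', hv, hv'⟩ := Option.map_eq_some_iff.1 h2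
      simp only [EmbeddingLike.apply_eq_iff_eq, Sum.inl.injEq] at hw' hv'
      subst hw' hv'
      have := hd₁ _ _ hw
      have := hd₁ _ _ hv
      omega
    · simp at h1
    · simp at h2
    · obtain ⟨w, hw, hw'⟩ := Option.map_eq_some_iff.1 h2.symm
      obtain ⟨w', hv, hv'⟩ := Option.map_eq_some_iff.1 h1
      simp only [EmbeddingLike.apply_eq_iff_eq, Sum.inr.injEq] at hw' hv'
      subst hw' hv'
      have := hd₂ _ _ hw
      have := hd₂ _ _ hv
      omega
  refine ⟨⟨Fintype.card (V₁ ⊕ V₂), E, fun l => (q₁ l).map fun w => e (inl w),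
    fun l => (q₂ l).map fun w => e (inr w), hasymm, ?_⟩, e, hE, fun _ => rfl, fun _ => rfl⟩
  refine isTree_of_parent P d hd _ fun u v => ?_
  rw [SimpleGraph.fromRel_adj]
  constructor
  · rintro ⟨-, h | h⟩
    · exact hPE _ _ h
    · rcases hPE _ _ h with ⟨x, h1, h2⟩ | ⟨x, h1, h2⟩
      exacts [Or.inr ⟨x, h2, h1⟩, Or.inl ⟨x, h2, h1⟩]
  · have key : ∀ x, (P x, some x) ∈ E ∨ (some x, P x) ∈ E := by
      intro x
      obtain ⟨X | X, rfl⟩ := e.surjective x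
      · exact Or.inl ((hE _ _).2 (Or.inl ⟨X, by simp [P], rfl⟩))
      · exact Or.inr ((hE _ _).2 (Or.inr ⟨X, rfl, by simp [P]⟩))
    rintro (⟨x, rfl, rfl⟩ | ⟨x, rfl, rfl⟩)
    · exact ⟨hne x, key x⟩
    · exact ⟨(hne x).symm, (key x).symm⟩

/-! ### Structure of contractible semistable trees -/

section Structure

variable {T : PointedTree k m}

theorem eq_of_inDeg_eq_one {u u' v : Option (Fin T.N)} (hv : T.inDeg v = 1)
    (h : (u, v) ∈ T.edges) (h' : (u', v) ∈ T.edges) : u' = u := by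
  rw [inDeg_eq] at hv
  have hle : (T.edges.filter fun e => e.2 = v).card ≤ 1 := by omega
  have := Finset.card_le_one.1 hle _ (Finset.mem_filter.2 ⟨h', rfl⟩) _
    (Finset.mem_filter.2 ⟨h, rfl⟩)
  exact congrArg Prod.fst this

theorem inLeg_ne_of_inDeg_eq_one {u v : Option (Fin T.N)} (hv : T.inDeg v = 1)
    (h : (u, v) ∈ T.edges) (l : Fin m) : T.inLeg l ≠ v := by
  intro hl
  rw [inDeg_eq] at hv
  have h1 : 0 < (T.edges.filter fun e => e.2 = v).card :=
    Finset.card_pos.2 ⟨(u, v), Finset.mem_filter.2 ⟨h, rfl⟩⟩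
  have h2 : 0 < (Finset.univ.filter fun l => T.inLeg l = v).card :=
    Finset.card_pos.2 ⟨l, Finset.mem_filter.2 ⟨Finset.mem_univ l, hl⟩⟩
  omega

theorem reach_reverse {u v : Option (Fin T.reverse.N)} :
    ReflTransGen (fun u v => (u, v) ∈ T.reverse.edges) u v ↔
      ReflTransGen (fun u v => (u, v) ∈ T.edges) v u :=
  ⟨fun h => ReflTransGen.mono (fun _ _ h => mem_edges_reverse.1 h) _ _ (ReflTransGen.swap _ _ h),
    fun h => ReflTransGen.mono (fun _ _ h => mem_edges_reverse.2 h) _ _ (ReflTransGen.swap _ _ h)⟩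

variable (hs : T.Semistable) (hc : T.Contractible)
include hs hc

/-- Contractibility propagates outwards from `•`, which cannot serve as the contracted tail. A
vertex reached with inward degree 1 has outward degree at least 2 by semistability, so the next edge
is again contractible only through its head. -/
theorem reach_step {w w' : Option (Fin T.N)}
    (hw : ReflTransGen (fun u v => (u, v) ∈ T.edges) none w) (h : (w, w') ∈ T.edges) :
    w' ≠ none ∧ T.inDeg w' = 1 := by
  induction hw generalizing w' with
  | refl =>
    rcases hc _ _ h with h1 | h1
    · exact absurd rfl h1.1
    · exact h1
  | tail _ hb ih =>
    obtain ⟨h1, h2⟩ := ih hb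
    rcases hc _ _ h with h3 | h3
    · obtain ⟨x, rfl⟩ := Option.ne_none_iff_exists'.1 h1
      have := hs x
      omega
    · exact h3

theorem inDeg_of_reach {w : Fin T.N}
    (hw : ReflTransGen (fun u v => (u, v) ∈ T.edges) none (some w)) :
    T.inDeg (some w) = 1 ∧ ∃ u, (u, some w) ∈ T.edges ∧
      ReflTransGen (fun u v => (u, v) ∈ T.edges) none u := by
  rcases ReflTransGen.cases_tail hw with h | ⟨u, hu, huw⟩
  · cases h
  · exact ⟨(reach_step hs hc hu huw).2, u, huw, hu⟩

theorem not_reach_none {w : Fin T.N}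
    (hw : ReflTransGen (fun u v => (u, v) ∈ T.edges) none (some w)) :
    ¬ ReflTransGen (fun u v => (u, v) ∈ T.edges) (some w) none := by
  intro h
  rcases ReflTransGen.cases_tail h with h | ⟨u, hu, huw⟩
  · cases h
  · exact (reach_step hs hc (hw.trans hu) huw).1 rfl

theorem outDeg_of_reach {w : Fin T.N}
    (hw : ReflTransGen (fun u v => (u, v) ∈ T.edges) (some w) none) :
    T.outDeg (some w) = 1 ∧ ∃ u, (some w, u) ∈ T.edges ∧
      ReflTransGen (fun u v => (u, v) ∈ T.edges) u none := by
  obtain ⟨h1, u, h2, h3⟩ := inDeg_of_reach hs.reverse hc.reverse (w := w)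
    ((reach_reverse).2 hw)
  exact ⟨(inDeg_reverse _).symm.trans h1, u, mem_edges_reverse.1 h2, (reach_reverse).1 h3⟩

/-- An ordinary vertex reachable from `•` has a single incoming edge, coming from a reachable
vertex. So the reachable set can be left only at `•`, against the direction of an edge. -/
theorem reach_adj {w w' : Option (Fin T.N)}
    (hw : ReflTransGen (fun u v => (u, v) ∈ T.edges) none w)
    (h : (w, w') ∈ T.edges ∨ (w', w) ∈ T.edges) :
    ReflTransGen (fun u v => (u, v) ∈ T.edges) none w' ∨
      ReflTransGen (fun u v => (u, v) ∈ T.edges) w' none := by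
  rcases h with h | h
  · exact Or.inl (hw.tail h)
  · cases w with
    | none => exact Or.inr (ReflTransGen.single h)
    | some w =>
      obtain ⟨h1, u, h2, h3⟩ := inDeg_of_reach hs hc hw
      rw [eq_of_inDeg_eq_one h1 h2 h]
      exact Or.inl h3

/-- The underlying graph is connected, and along a walk from `•` both alternatives persist, by
`reach_adj` and its reversed form. -/
theorem reach_or_reach (w : Option (Fin T.N)) :
    ReflTransGen (fun u v => (u, v) ∈ T.edges) none w ∨
      ReflTransGen (fun u v => (u, v) ∈ T.edges) w none := by
  have h := (SimpleGraph.reachable_iff_reflTransGen none w).1 (T.isTree.connected none w)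
  induction h with
  | refl => exact Or.inl ReflTransGen.refl
  | tail _ hb ih =>
    have hb' := ((SimpleGraph.fromRel_adj _ _ _).1 hb).2
    rcases ih with h1 | h1
    · exact reach_adj hs hc h1 hb'
    · rcases reach_adj hs.reverse hc.reverse ((reach_reverse).2 h1)
        (hb'.symm.imp mem_edges_reverse.2 mem_edges_reverse.2) with h2 | h2
      · exact Or.inr ((reach_reverse).1 h2)
      · exact Or.inl ((reach_reverse).1 h2)

/-- The forest directed away from the distinguished vertex. -/
theorem exists_outForest : ∃ (p : {v : Fin T.N // ReflTransGen (fun u v => (u, v) ∈ T.edges) none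
      (some v)} → Option {v : Fin T.N // ReflTransGen (fun u v => (u, v) ∈ T.edges) none (some v)})
    (q : Fin k → Option {v : Fin T.N // ReflTransGen (fun u v => (u, v) ∈ T.edges) none (some v)})
    (d : {v : Fin T.N // ReflTransGen (fun u v => (u, v) ∈ T.edges) none (some v)} → ℕ),
    (∀ x, ((p x).map Subtype.val, some x.1) ∈ T.edges) ∧
    (∀ l, T.outLeg l = (q l).map Subtype.val) ∧ ∀ x y, p x = some y → d y < d x := by
  classical
  let F := {v : Fin T.N // ReflTransGen (fun u v => (u, v) ∈ T.edges) none (some v)}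
  have lift : ∀ u, ReflTransGen (fun u v => (u, v) ∈ T.edges) none u →
      ∃ o : Option F, o.map Subtype.val = u := by
    intro u hu
    cases u with
    | none => exact ⟨none, rfl⟩
    | some u => exact ⟨some ⟨u, hu⟩, rfl⟩
  have hp : ∀ x : F, ∃ o : Option F, (o.map Subtype.val, some x.1) ∈ T.edges := by
    intro x
    obtain ⟨-, u, hu, hu'⟩ := inDeg_of_reach hs hc x.2
    obtain ⟨o, rfl⟩ := lift u hu'
    exact ⟨o, hu⟩
  choose p hp using hp
  -- An outward leg cannot sit at an ordinary vertex directed towards `•`, whose only outward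
  -- half-edge is an edge.
  have hq : ∀ l, ∃ o : Option F, T.outLeg l = o.map Subtype.val := by
    intro l
    rcases reach_or_reach hs hc (T.outLeg l) with h | h
    · obtain ⟨o, ho⟩ := lift _ h
      exact ⟨o, ho.symm⟩
    · cases hw : T.outLeg l with
      | none => exact ⟨none, rfl⟩
      | some w =>
        rw [hw] at h
        obtain ⟨h1, u, h2, -⟩ := outDeg_of_reach hs hc h
        exact absurd hw (inLeg_ne_of_inDeg_eq_one (T := T.reverse)
          ((inDeg_reverse (T := T) (some w)).trans h1) (mem_edges_reverse.2 h2) l)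
  choose q hq using hq
  -- The incoming edge being unique, the last step of a path from `•` is the step from the parent;
  -- induction along the path gives well-foundedness, and `d` counts the steps.
  have hwf : WellFounded fun y x : F => p x = some y := by
    have hacc : ∀ w, ReflTransGen (fun u v => (u, v) ∈ T.edges) none w → ∀ x : F, w = some x.1 →
        Acc (fun y x : F => p x = some y) x := by
      intro w hw
      induction hw with
      | refl => intro x hx; cases hx
      | @tail u w hu huw ih =>
        rintro x rfl
        refine Acc.intro x fun y hy => ih y ?_
        have h1 := hp x
        rw [hy] at h1
        exact eq_of_inDeg_eq_one (inDeg_of_reach hs hc x.2).1 h1 huw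
    exact ⟨fun x => hacc _ x.2 x rfl⟩
  let d : F → ℕ := hwf.fix fun x IH => (p x).attach.elim 0 fun y => IH y.1 y.2 + 1
  refine ⟨p, q, d, hp, hq, fun x y hxy => ?_⟩
  have h1 : d x = (p x).attach.elim 0 fun y => d y.1 + 1 := hwf.fix_eq _ x
  have h2 : ∀ (o : Option F), o = some y → (o.attach.elim 0 fun y => d y.1 + 1) = d y + 1 := by
    rintro _ rfl
    rfl
  rw [h1, h2 _ hxy]
  exact Nat.lt_succ_self _

/-- A contractible semistable tree consists of two forests. -/
theorem exists_forests : ∃ (V₁ V₂ : Type) (_ : Fintype V₁) (_ : Fintype V₂) (_ : DecidableEq V₁)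
    (_ : DecidableEq V₂) (p₁ : V₁ → Option V₁) (q₁ : Fin k → Option V₁) (p₂ : V₂ → Option V₂)
    (q₂ : Fin m → Option V₂) (d₁ : V₁ → ℕ) (d₂ : V₂ → ℕ) (e : V₁ ⊕ V₂ ≃ Fin T.N),
    (∀ x y, p₁ x = some y → d₁ y < d₁ x) ∧ (∀ x y, p₂ x = some y → d₂ y < d₂ x) ∧
    T.IsModel p₁ q₁ p₂ q₂ e := by
  classical
  obtain ⟨p₁, q₁, d₁, hp₁, hq₁, hd₁⟩ := exists_outForest hs hc
  obtain ⟨p₂, q₂, d₂, hp₂, hq₂, hd₂⟩ := exists_outForest hs.reverse hc.reverse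
  have hr : ∀ u v, ReflTransGen (fun u v => (u, v) ∈ T.reverse.edges) u v ↔
      ReflTransGen (fun u v => (u, v) ∈ T.edges) v u := fun u v => reach_reverse
  let c : {v : Fin T.N // ReflTransGen (fun u v => (u, v) ∈ T.edges) none (some v)} ⊕
      {v : Fin T.reverse.N // ReflTransGen (fun u v => (u, v) ∈ T.reverse.edges) none (some v)} →
      Fin T.N := Sum.elim Subtype.val Subtype.val
  have hcb : Function.Bijective c := by
    constructor
    · rintro (x | x) (y | y) hxy
      · exact congrArg inl (Subtype.ext hxy)
      · refine absurd ((hr _ _).1 y.2) ?_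
        have := not_reach_none hs hc x.2
        rwa [show x.1 = y.1 from hxy] at this
      · refine absurd ((hr _ _).1 x.2) ?_
        have := not_reach_none hs hc y.2
        rwa [← show x.1 = y.1 from hxy] at this
      · exact congrArg inr (Subtype.ext hxy)
    · intro v
      rcases reach_or_reach hs hc (some v) with h | h
      · exact ⟨inl ⟨v, h⟩, rfl⟩
      · exact ⟨inr ⟨v, (hr _ _).2 h⟩, rfl⟩
  refine ⟨_, _, inferInstance, inferInstance, inferInstance, inferInstance, p₁, q₁, p₂, q₂, d₁, d₂,
    Equiv.ofBijective c hcb, hd₁, hd₂, fun u v => ⟨fun huv => ?_, ?_⟩, hq₁, hq₂⟩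
  · by_cases hu : ReflTransGen (fun u v => (u, v) ∈ T.edges) none u
    · obtain ⟨v, rfl⟩ := Option.ne_none_iff_exists'.1 (reach_step hs hc hu huv).1
      refine Or.inl ⟨⟨v, hu.tail huv⟩, ?_, rfl⟩
      exact eq_of_inDeg_eq_one (inDeg_of_reach hs hc (hu.tail huv)).1
        (hp₁ ⟨v, hu.tail huv⟩) huv
    · have hu' := (reach_or_reach hs hc u).resolve_left hu
      cases u with
      | none => exact absurd ReflTransGen.refl hu
      | some u =>
        refine Or.inr ⟨⟨u, (hr _ _).2 hu'⟩, rfl, ?_⟩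
        exact eq_of_inDeg_eq_one (T := T.reverse)
          (inDeg_of_reach hs.reverse hc.reverse ((hr _ _).2 hu')).1
          (hp₂ ⟨u, (hr _ _).2 hu'⟩) (mem_edges_reverse.2 huv)
  · rintro (⟨X, rfl, rfl⟩ | ⟨X, rfl, rfl⟩)
    · exact hp₁ X
    · exact mem_edges_reverse.1 (hp₂ X)

end Structure

end PointedTree

end Classification

/-! ### The tree sum as a double sum over laminar families -/

section TreeSum

open Relation Sum

theorem forestVal_sum {ι α V : Type*} {n : ℕ} [Fintype V] [DecidableEq V] (p : V → Option V)
    (q : ι → Option V) (R : Finset ι) (a : ι → Fin n) (W : Fin n → Multiset (Fin n) → ℂ)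
    (s : Finset α) (c : α → ℂ) (h : α → Multiset (Fin n) → ℂ) :
    forestVal p q R a W (fun A => ∑ i ∈ s, c i * h i A) =
      ∑ i ∈ s, c i * forestVal p q R a W (h i) := by
  simp only [forestVal, Finset.mul_sum]
  rw [Finset.sum_comm]
  exact Finset.sum_congr rfl fun _ _ => Finset.sum_congr rfl fun _ _ => by ring

theorem par_rank {ι : Type*} [Fintype ι] [DecidableEq ι] {H : Finset (Finset ι)} (S S' : H)
    (h : par H S.1 = some S') :
    Fintype.card ι - S'.1.card < Fintype.card ι - S.1.card := by
  have h1 := Finset.card_lt_card (par_eq_some.1 h).1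
  have h2 := Finset.card_le_univ S'.1
  omega

namespace PointedTree

variable {k m : ℕ} {T : PointedTree k m}

namespace IsModel

/-! ### Recovering the laminar families from the tree -/

section Leaves

variable {H : Finset (Finset (Fin k))} {V₂ : Type*} {p₂ : V₂ → Option V₂}
  {q₂ : Fin m → Option V₂} {e : H ⊕ V₂ ≃ Fin T.N}

theorem reach_par (hH : Laminar H)
    (h : T.IsModel (fun S : H => par H S) (fun l => par H {l}) p₂ q₂ e) (S : H)
    (X : Finset (Fin k)) (hX : X.Nonempty) (hXS : X ⊂ S.1) :
    ReflTransGen (fun u v => (u, v) ∈ T.edges) (some (e (inl S)))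
      ((par H X).map fun w => e (inl w)) := by
  induction hM : k - X.card using Nat.strong_induction_on generalizing X with
  | _ M ih =>
    cases hp : par H X with
    | none => exact absurd hXS ((par_eq_none hH hX).1 hp S.1 S.2)
    | some Y =>
      obtain ⟨h1, h2⟩ := par_eq_some.1 hp
      by_cases hYS : Y = S
      · rw [hYS]
        exact ReflTransGen.refl
      · have h3 : Y.1 ⊂ S.1 := (h2 S.1 S.2 hXS).ssubset_of_ne fun h => hYS (Subtype.ext h)
        have h4 := Finset.card_lt_card h1
        have h5 := Finset.card_le_univ Y.1
        rw [Fintype.card_fin] at h5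
        exact (ih _ (by omega) Y.1 (hH.nonempty Y.2) h3 rfl).tail
          ((h.edges _ _).2 (Or.inl ⟨Y, rfl, rfl⟩))

/-- The elements of `S` are the outward legs that can be reached from its vertex. This description
refers to the tree only, so the tree determines the family. -/
theorem mem_iff_reach (hH : Laminar H)
    (h : T.IsModel (fun S : H => par H S) (fun l => par H {l}) p₂ q₂ e) (S : H) (l : Fin k) :
    l ∈ S.1 ↔ ReflTransGen (fun u v => (u, v) ∈ T.edges) (some (e (inl S))) (T.outLeg l) := by
  constructor
  · intro hl
    rw [h.outLeg]
    refine h.reach_par hH S {l} (Finset.singleton_nonempty l) ?_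
    refine (Finset.singleton_subset_iff.2 hl).ssubset_of_ne fun hS => ?_
    have := hH.1 S.1 S.2
    rw [← hS, Finset.card_singleton] at this
    omega
  · intro hl
    have key : ∀ w, ReflTransGen (fun u v => (u, v) ∈ T.edges) (some (e (inl S))) w →
        ∃ Y : H, Y.1 ⊆ S.1 ∧ w = some (e (inl Y)) := by
      intro w hw
      induction hw with
      | refl => exact ⟨S, subset_rfl, rfl⟩
      | tail _ hb ih =>
        obtain ⟨Y, hYS, rfl⟩ := ih
        rcases (h.edges _ _).1 hb with ⟨X, h1, rfl⟩ | ⟨X, h1, -⟩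
        · refine ⟨X, ?_, rfl⟩
          obtain ⟨Z, h2, h3⟩ := Option.map_eq_some_iff.1 h1.symm
          obtain rfl : Z = Y := by simpa using h3
          exact (par_eq_some.1 h2).1.subset.trans hYS
        · simp at h1
    obtain ⟨Y, hYS, hY⟩ := key _ hl
    rw [h.outLeg] at hY
    obtain ⟨Z, h2, h3⟩ := Option.map_eq_some_iff.1 hY
    obtain rfl : Z = Y := by simpa using h3
    exact hYS ((par_eq_some.1 h2).1.subset (Finset.mem_singleton_self l))

end Leaves

variable {H₁ H₁' : Finset (Finset (Fin k))} {H₂ H₂' : Finset (Finset (Fin m))}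
  {e : H₁ ⊕ H₂ ≃ Fin T.N} {e' : H₁' ⊕ H₂' ≃ Fin T.N}

/-- The inward degree, 1 in the outward forest and at least 2 in the other, shows that a vertex lies
in the same forest in both models; `mem_iff_reach` then identifies the two leaf sets. -/
theorem laminar_subset (hH₁ : Laminar H₁) (hH₁' : Laminar H₁') (hH₂' : Laminar H₂')
    (h : T.IsModel (fun S : H₁ => par H₁ S) (fun l => par H₁ {l})
      (fun S : H₂ => par H₂ S) (fun l => par H₂ {l}) e)
    (h' : T.IsModel (fun S : H₁' => par H₁' S) (fun l => par H₁' {l})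
      (fun S : H₂' => par H₂' S) (fun l => par H₂' {l}) e') : H₁ ⊆ H₁' := by
  intro S hS
  have hd := h.inDeg_inl ⟨S, hS⟩
  obtain ⟨X | X, hX⟩ := e'.surjective (e (inl ⟨S, hS⟩))
  · have : S = X.1 := by
      ext l
      exact (h.mem_iff_reach hH₁ ⟨S, hS⟩ l).trans (hX ▸ (h'.mem_iff_reach hH₁' X l).symm)
    exact this ▸ X.2
  · rw [← hX, h'.inDeg_inr] at hd
    have := hH₂'.two_le_childCount X
    omega

theorem laminar_eq (hH₁ : Laminar H₁) (hH₁' : Laminar H₁') (hH₂ : Laminar H₂)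
    (hH₂' : Laminar H₂')
    (h : T.IsModel (fun S : H₁ => par H₁ S) (fun l => par H₁ {l})
      (fun S : H₂ => par H₂ S) (fun l => par H₂ {l}) e)
    (h' : T.IsModel (fun S : H₁' => par H₁' S) (fun l => par H₁' {l})
      (fun S : H₂' => par H₂' S) (fun l => par H₂' {l}) e') : H₁ = H₁' ∧ H₂ = H₂' :=
  ⟨(laminar_subset hH₁ hH₁' hH₂' h h').antisymm (laminar_subset hH₁' hH₁ hH₂ h' h),
    (laminar_subset hH₂ hH₂' hH₁' h.reverse h'.reverse).antisymm
      (laminar_subset hH₂' hH₂ hH₁ h'.reverse h.reverse)⟩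

end IsModel

theorem exists_isModel_laminar {H₁ : Finset (Finset (Fin k))} {H₂ : Finset (Finset (Fin m))}
    (hH₁ : Laminar H₁) (hH₂ : Laminar H₂) : ∃ (T : ContractibleTree k m)
      (e : H₁ ⊕ H₂ ≃ Fin T.1.N), T.1.IsModel (fun S : H₁ => par H₁ S) (fun l => par H₁ {l})
        (fun S : H₂ => par H₂ S) (fun l => par H₂ {l}) e := by
  obtain ⟨T, e, h⟩ := exists_isModel (fun S : H₁ => par H₁ S) (fun l => par H₁ {l})
    (fun S : H₂ => par H₂ S) (fun l => par H₂ {l}) _ _ par_rank par_rank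
  exact ⟨⟨T, h.semistable hH₁.two_le_childCount hH₂.two_le_childCount, h.contractible⟩, e, h⟩

theorem exists_laminar_isModel (hs : T.Semistable) (hc : T.Contractible) :
    ∃ (H₁ : Finset (Finset (Fin k))) (H₂ : Finset (Finset (Fin m))) (e : H₁ ⊕ H₂ ≃ Fin T.N),
      Laminar H₁ ∧ Laminar H₂ ∧ T.IsModel (fun S : H₁ => par H₁ S) (fun l => par H₁ {l})
        (fun S : H₂ => par H₂ S) (fun l => par H₂ {l}) e := by
  obtain ⟨V₁, V₂, _, _, _, _, p₁, q₁, p₂, q₂, d₁, d₂, e, hd₁, hd₂, h⟩ := exists_forests hs hc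
  obtain ⟨H₁, ε₁, hH₁, hp₁, hq₁⟩ := exists_laminar (p := p₁) (q := q₁) hd₁ fun v => by
    have := hs (e (inl v))
    rw [h.inDeg_inl, h.outDeg_inl] at this
    omega
  obtain ⟨H₂, ε₂, hH₂, hp₂, hq₂⟩ := exists_laminar (p := p₂) (q := q₂) hd₂ fun v => by
    have := hs (e (inr v))
    rw [h.inDeg_inr, h.outDeg_inr] at this
    omega
  exact ⟨H₁, H₂, _, hH₁, hH₂, h.congr ε₁ ε₂ hp₁ hq₁ hp₂ hq₂⟩

end PointedTree

open PointedTree in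
/-- The sum over trees, written as a sum over pairs of laminar families. -/
theorem eval_treeSum {n k m : ℕ} (a : Fin k → Fin n) (b : Fin m → Fin n) (ν : JetVar n → ℂ)
    (W₁ W₂ : Fin n → Multiset (Fin n) → ℂ)
    (hW₁ : ∀ i A (hA : ∀ j : Fin n, 1 ≤ A.card ∧ 1 ≤ ({j} : Multiset (Fin n)).card ∧
      3 ≤ A.card + ({j} : Multiset (Fin n)).card), A.card ≤ 2 * (k + m) →
      ∑ j, ν (.inv i j) * ν (.metric A {j} (hA j)) = W₁ i A)
    (hW₂ : ∀ i B (hB : ∀ j : Fin n, 1 ≤ ({j} : Multiset (Fin n)).card ∧ 1 ≤ B.card ∧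
      3 ≤ ({j} : Multiset (Fin n)).card + B.card), B.card ≤ 2 * (k + m) →
      ∑ j, ν (.inv j i) * ν (.metric {j} B (hB j)) = W₂ i B) :
    MvPolynomial.eval ν (treeSum n k m a b) = forestSum Finset.univ b W₂ fun B =>
      forestSum Finset.univ a W₁ fun A => ν (.func A B) := by
  classical
  simp only [treeSum, forestSum, laminarVal, map_sum, map_mul, map_pow, map_neg, map_one]
  simp only [forestVal_sum, Finset.mul_sum]
  rw [← Finset.sum_product']
  symm
  have hmem : ∀ P ∈ laminarFamilies (Finset.univ : Finset (Fin m)) ×ˢ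
      laminarFamilies (Finset.univ : Finset (Fin k)), Laminar P.1 ∧ Laminar P.2 := by
    intro P hP
    rw [Finset.mem_product, mem_laminarFamilies, mem_laminarFamilies] at hP
    exact ⟨hP.1.2, hP.2.2⟩
  choose τ e hτ using fun P hP => exists_isModel_laminar (hmem P hP).2 (hmem P hP).1
  -- Pairs of laminar families biject with isomorphism classes of trees. Their members are the
  -- ordinary vertices, so the signs agree as well.
  refine Finset.sum_bij (fun P hP => (⟦τ P hP⟧ : TreeClass k m)) (fun _ _ => Finset.mem_univ _)
    ?_ ?_ ?_
  · intro P hP P' hP' h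
    obtain ⟨e', h'⟩ := (hτ P hP).of_iso (Quotient.exact h)
    obtain ⟨h1, h2⟩ := IsModel.laminar_eq (hmem P hP).2 (hmem P' hP').2 (hmem P hP).1
      (hmem P' hP').1 h' (hτ P' hP')
    exact Prod.ext h2 h1
  · intro t _
    obtain ⟨T, rfl⟩ := Quotient.exists_rep t
    obtain ⟨H₁, H₂, e', hH₁, hH₂, h⟩ := exists_laminar_isModel T.2.1 T.2.2
    have hP : (H₂, H₁) ∈ laminarFamilies (Finset.univ : Finset (Fin m)) ×ˢ
        laminarFamilies (Finset.univ : Finset (Fin k)) := by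
      rw [Finset.mem_product, mem_laminarFamilies, mem_laminarFamilies]
      exact ⟨⟨fun _ _ => Finset.subset_univ _, hH₂⟩, fun _ _ => Finset.subset_univ _, hH₁⟩
    exact ⟨_, hP, Quotient.sound ((hτ _ hP).iso h)⟩
  · intro P hP
    have hN : (τ P hP).1.N = P.2.card + P.1.card := by
      rw [← Fintype.card_fin (τ P hP).1.N, ← Fintype.card_congr (e P hP), Fintype.card_sum,
        Fintype.card_coe, Fintype.card_coe]
    have h1 : TreeClass.numVertices (⟦τ P hP⟧ : TreeClass k m) = P.2.card + P.1.card := hN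
    have h2 : TreeClass.poly (⟦τ P hP⟧ : TreeClass k m) a b =
        (τ P hP).1.poly (τ P hP).2.1 a b := rfl
    rw [h1, h2, (hτ P hP).eval_poly (τ P hP).2.1 a b ν W₁ W₂ hW₁ hW₂, pow_add]
    ring

end TreeSum

/-! ### Metrics in coordinates with a flat metric -/

section Flat

open TopologicalSpace

variable {n : ℕ} {U V : Opens (Fin n → ℂ)}

/-- All unbarred derivatives of `h` at `x` of order at most `N` vanish. -/
def Flat (x : Fin n → ℂ) : ℕ → Smooth U → Prop
  | 0, h => h.1 x = 0
  | N + 1, h => h.1 x = 0 ∧ ∀ p, Flat x N (coordOp U (-1) p h)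

variable {x : Fin n → ℂ} {N : ℕ}

theorem Flat.apply {h : Smooth U} (hh : Flat x N h) : h.1 x = 0 := by
  cases N with
  | zero => exact hh
  | succ N => exact hh.1

theorem Flat.of_succ {h : Smooth U} (hh : Flat x (N + 1) h) : Flat x N h := by
  induction N generalizing h with
  | zero => exact hh.1
  | succ N ih => exact ⟨hh.1, fun p => ih (hh.2 p)⟩

theorem Flat.add {h k : Smooth U} (hh : Flat x N h) (hk : Flat x N k) : Flat x N (h + k) := by
  induction N generalizing h k with
  | zero =>
    show h.1 x + k.1 x = 0
    rw [hh.apply, hk.apply, add_zero]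
  | succ N ih =>
    refine ⟨?_, fun p => ?_⟩
    · show h.1 x + k.1 x = 0
      rw [hh.apply, hk.apply, add_zero]
    · rw [coordOp, map_add]
      exact ih (hh.2 p) (hk.2 p)

theorem Flat.zero : Flat x N (0 : Smooth U) := by
  induction N with
  | zero => rfl
  | succ N ih => exact ⟨rfl, fun p => by rw [coordOp, map_zero]; exact ih⟩

theorem Flat.sum {κ : Type*} (s : Finset κ) {h : κ → Smooth U} (hh : ∀ i ∈ s, Flat x N (h i)) :
    Flat x N (∑ i ∈ s, h i) := by
  classical
  induction s using Finset.induction_on with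
  | empty => exact Flat.zero
  | insert i s hi ih =>
    rw [Finset.sum_insert hi]
    exact (hh i (Finset.mem_insert_self i s)).add
      (ih fun j hj => hh j (Finset.mem_insert_of_mem hj))

/-- Together with `Flat.add` and `Flat.comp`: the flat functions form an ideal stable under
holomorphic pullback, so computations with unbarred derivatives may be done modulo this ideal. -/
theorem Flat.mul_right {h : Smooth U} (hh : Flat x N h) (k : Smooth U) : Flat x N (h * k) := by
  induction N generalizing h k with
  | zero =>
    show h.1 x * k.1 x = 0
    rw [hh.apply, zero_mul]
  | succ N ih =>
    refine ⟨?_, fun p => ?_⟩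
    · show h.1 x * k.1 x = 0
      rw [hh.apply, zero_mul]
    · rw [coordOp, wirtOp_mul]
      exact (ih (hh.2 p) k).add (ih hh.of_succ _)

theorem Flat.comp (φ : HolMap V U) {y : Fin n → ℂ} {h : Smooth U}
    (hh : Flat (φ.toFun y) N h) : Flat y N (φ.comp h) := by
  induction N generalizing h with
  | zero => exact hh
  | succ N ih =>
    refine ⟨hh.apply, fun p => ?_⟩
    rw [coordOp, HolMap.wirtOp_comp]
    refine Flat.sum _ fun i _ => ?_
    rw [mul_comm]
    exact (ih (hh.2 i)).mul_right _

theorem Flat.foldr {h : Smooth U} (hh : Flat x N h) {A : Multiset (Fin n)} (hA : A.card ≤ N) :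
    (A.foldr (coordOp U (-1)) h).1 x = 0 := by
  induction N generalizing h A with
  | zero =>
    obtain rfl := Multiset.card_eq_zero.1 (Nat.le_zero.1 hA)
    exact hh
  | succ N ih =>
    induction A using Multiset.induction_on with
    | empty => exact hh.1
    | cons i A _ =>
      rw [Multiset.card_cons] at hA
      rw [foldr_cons_eq]
      exact ih (hh.2 i) (by omega)

theorem Flat.of_foldr {h : Smooth U}
    (hh : ∀ A : Multiset (Fin n), A.card ≤ N → (A.foldr (coordOp U (-1)) h).1 x = 0) :
    Flat x N h := by
  induction N generalizing h with
  | zero => exact hh 0 le_rfl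
  | succ N ih =>
    refine ⟨hh 0 (Nat.zero_le _), fun p => ih fun A hA => ?_⟩
    rw [← foldr_cons_eq]
    exact hh _ (by rw [Multiset.card_cons]; omega)

theorem Flat.of_coordOp_eq_zero {h : Smooth U} (h0 : h.1 x = 0)
    (h1 : ∀ p, coordOp U (-1) p h = 0) : Flat x N h := by
  cases N with
  | zero => exact h0
  | succ N => exact ⟨h0, fun p => (h1 p).symm ▸ Flat.zero⟩

theorem foldr_coordOp_add (s : ℂ) (A : Multiset (Fin n)) (h k : Smooth U) :
    A.foldr (coordOp U s) (h + k) = A.foldr (coordOp U s) h + A.foldr (coordOp U s) k := by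
  induction A using Multiset.induction_on with
  | empty => rfl
  | cons i A ih =>
    rw [Multiset.foldr_cons, ih, Multiset.foldr_cons, Multiset.foldr_cons]
    exact map_add _ _ _

/-- Iterated derivatives, as a linear map. -/
def foldrOp (U : Opens (Fin n → ℂ)) (s : ℂ) (A : Multiset (Fin n)) : Smooth U →ₗ[ℂ] Smooth U where
  toFun := A.foldr (coordOp U s)
  map_add' := foldr_coordOp_add s A
  map_smul' c h := by
    induction A using Multiset.induction_on with
    | empty => rfl
    | cons i A ih =>
      rw [Multiset.foldr_cons, ih, Multiset.foldr_cons]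
      exact map_smul _ _ _

theorem foldrOp_apply (s : ℂ) (A : Multiset (Fin n)) (h : Smooth U) :
    foldrOp U s A h = A.foldr (coordOp U s) h := rfl

theorem foldrOp_mul_of_const (s : ℂ) (A : Multiset (Fin n)) (h k : Smooth U)
    (hk : ∀ p, coordOp U s p k = 0) : foldrOp U s A (h * k) = foldrOp U s A h * k := by
  simp only [foldrOp_apply]
  induction A using Multiset.induction_on with
  | empty => rfl
  | cons i A ih =>
    rw [Multiset.foldr_cons, ih, Multiset.foldr_cons, coordOp, wirtOp_mul]
    rw [show wirtOp U s (Pi.single i 1) k = 0 from hk i, mul_zero, add_zero]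

/-- The coefficients of a Kähler metric, as smooth functions. -/
def IsKahlerOn.entry {g : (Fin n → ℂ) → Matrix (Fin n) (Fin n) ℂ} (hg : IsKahlerOn U g)
    (i j : Fin n) : Smooth U :=
  ⟨fun z => g z i j, hg.smooth i j⟩

namespace HolMap

variable (ψ : HolMap U V)

theorem dz_eq {z : Fin n → ℂ} (hz : z ∈ U) (i p : Fin n) :
    dz i (fun w => ψ.toFun w p) z = (coordOp U (-1) i (ψ.coord p)).1 z := by
  rw [dz_eq_wirt]
  exact (wirtOp_apply hz _ _ (ψ.coord p)).symm

theorem coordOp_one_coord (p q j : Fin n) :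
    coordOp U 1 p (coordOp U (-1) j (ψ.coord q)) = 0 := by
  rw [coordOp, coordOp, wirtOp_comm, wirtOp_one_coord, map_zero]

theorem coordOp_conj_coord (p q j : Fin n) :
    coordOp U (-1) p (conjOp (coordOp U (-1) j (ψ.coord q))) = 0 := by
  have h1 : coordOp U (-1) p (conjOp (coordOp U (-1) j (ψ.coord q))) =
      conjOp (wirtOp U (-(-1)) (Pi.single p 1) (coordOp U (-1) j (ψ.coord q))) :=
    wirtOp_conj (by simp) _ _
  rw [h1, neg_neg]
  exact (congrArg conjOp (coordOp_one_coord ψ p q j)).trans conjOp_zero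

/-- The pullback of a metric along a holomorphic map. -/
def pullback (G : Fin n → Fin n → Smooth V) (i j : Fin n) : Smooth U :=
  ∑ p, ∑ q, ψ.comp (G p q) * coordOp U (-1) i (ψ.coord p) *
    conjOp (coordOp U (-1) j (ψ.coord q))

variable {G : (Fin n → ℂ) → Matrix (Fin n) (Fin n) ℂ}

theorem pullback_apply (hG : IsKahlerOn V G) {z : Fin n → ℂ} (hz : z ∈ U) (i j : Fin n) :
    (ψ.pullback hG.entry i j).1 z = pullbackMetric ψ.toFun G z i j := by
  simp only [pullback, pullbackMetric, Matrix.of_apply, AddSubmonoidClass.coe_finsetSum,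
    Finset.sum_apply, MulMemClass.coe_mul, Pi.mul_apply, ψ.dz_eq hz]
  rfl

theorem pullbackMetric_conj (hG : IsKahlerOn V G) {z : Fin n → ℂ} (hz : z ∈ U) (i j : Fin n) :
    conj (pullbackMetric ψ.toFun G z i j) = pullbackMetric ψ.toFun G z j i := by
  simp only [pullbackMetric, Matrix.of_apply, map_sum, map_mul, Complex.conj_conj]
  rw [Finset.sum_comm]
  refine Finset.sum_congr rfl fun q _ => Finset.sum_congr rfl fun p _ => ?_
  rw [← (hG.posDef _ (ψ.mapsTo z hz)).isHermitian.apply q p]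
  simp only [RCLike.star_def]
  ring

theorem iterD_pullbackMetric (hG : IsKahlerOn V G) {x : Fin n → ℂ} (hx : x ∈ U)
    (A B : List (Fin n)) (i j : Fin n) :
    iterD A B (fun z => pullbackMetric ψ.toFun G z i j) x =
      ((A : Multiset (Fin n)).foldr (coordOp U (-1))
        ((B : Multiset (Fin n)).foldr (coordOp U 1) (ψ.pullback hG.entry i j))).1 x := by
  rw [← iterD_eq A B _ hx]
  refine iterD_congr ?_ A B
  filter_upwards [U.isOpen.mem_nhds hx] with z hz using (ψ.pullback_apply hG hz i j).symm

theorem iterD_pullbackMetric_conj (hG : IsKahlerOn V G) {x : Fin n → ℂ} (hx : x ∈ U)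
    (B : List (Fin n)) (i j : Fin n) :
    iterD [] B (fun z => pullbackMetric ψ.toFun G z i j) x =
      conj (iterD B [] (fun z => pullbackMetric ψ.toFun G z j i) x) := by
  rw [iterD_pullbackMetric ψ hG hx B []]
  have h1 : iterD [] B (fun z => pullbackMetric ψ.toFun G z i j) x =
      iterD [] B (conjOp (ψ.pullback hG.entry j i)).1 x := by
    refine iterD_congr ?_ _ _
    filter_upwards [U.isOpen.mem_nhds hx] with z hz
    exact (pullbackMetric_conj ψ hG hz j i).symm.trans
      (congrArg conj (ψ.pullback_apply hG hz j i).symm)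
  rw [h1, iterD_eq _ _ _ hx, foldr_coordOp_conj (by simp)]
  rfl

/-- Pullbacks of metrics along holomorphic maps are closed under the unbarred derivatives at
points where the metric is flat. -/
theorem flat_pullback (hG : IsKahlerOn V G) {x : Fin n → ℂ}
    (hN : ∀ p q, Flat (ψ.toFun x) N (hG.entry p q - algebraMap ℂ (Smooth V) (if p = q then 1 else 0)))
    (i j : Fin n) : Flat x N (ψ.pullback hG.entry i j -
      ∑ p, coordOp U (-1) i (ψ.coord p) * conjOp (coordOp U (-1) j (ψ.coord p))) := by
  have h1 : ψ.pullback hG.entry i j -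
      ∑ p, coordOp U (-1) i (ψ.coord p) * conjOp (coordOp U (-1) j (ψ.coord p)) =
      ∑ p, ∑ q, ψ.comp (hG.entry p q - algebraMap ℂ (Smooth V) (if p = q then 1 else 0)) *
        (coordOp U (-1) i (ψ.coord p) * conjOp (coordOp U (-1) j (ψ.coord q))) := by
    have h2 : ∀ p q, ψ.comp (hG.entry p q - algebraMap ℂ (Smooth V) (if p = q then 1 else 0)) =
        ψ.comp (hG.entry p q) - (if p = q then 1 else 0) := by
      intro p q
      split_ifs <;> rfl
    simp only [h2, sub_mul, Finset.sum_sub_distrib, ite_mul, one_mul, zero_mul,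
      Finset.sum_ite_eq, Finset.mem_univ, if_true, pullback, mul_assoc]
  rw [h1]
  exact Flat.sum _ fun p _ => Flat.sum _ fun q _ => ((hN p q).comp ψ).mul_right _

theorem isNormalAt_flat {y : Fin n → ℂ} (hy : y ∈ V) (hG : IsKahlerOn V G)
    (hN : IsNormalAt N G y) (p q : Fin n) :
    Flat y N (hG.entry p q - algebraMap ℂ (Smooth V) (if p = q then 1 else 0)) := by
  refine Flat.of_foldr fun A hA => ?_
  rw [← foldrOp_apply, map_sub]
  induction A using Quotient.inductionOn with
  | _ L =>
    have h1 : (foldrOp V (-1) (L : Multiset (Fin n)) (hG.entry p q)).1 y =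
        iterD L [] (fun z => G z p q) y := (iterD_eq L [] (hG.entry p q) hy).symm
    cases L with
    | nil =>
      have : G y p q = (1 : Matrix (Fin n) (Fin n) ℂ) p q := by rw [hN.1]
      show G y p q - (if p = q then 1 else 0) = 0
      rw [this, Matrix.one_apply, sub_self]
    | cons i L =>
      have h2 : foldrOp V (-1) ((i :: L : List (Fin n)) : Multiset (Fin n))
          (algebraMap ℂ (Smooth V) (if p = q then 1 else 0)) = 0 := by
        rw [foldrOp_apply, ← Multiset.cons_coe, foldr_cons_eq, coordOp, wirtOp_algebraMap,
          ← foldrOp_apply, map_zero]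
      have h3 := (hN.2 p q (i :: L) (by simp) hA).1
      show (foldrOp V (-1) ((i :: L : List (Fin n)) : Multiset (Fin n)) (hG.entry p q)).1 y -
        (foldrOp V (-1) ((i :: L : List (Fin n)) : Multiset (Fin n))
          (algebraMap ℂ (Smooth V) (if p = q then 1 else 0))).1 y = 0
      rw [h1, h2, h3]
      exact sub_zero _

/-- The unbarred derivatives of a metric which is normal in the coordinates `ψ`. -/
theorem iterD_pullbackMetric_of_flat (hG : IsKahlerOn V G) {x : Fin n → ℂ} (hx : x ∈ U)
    (hN : ∀ p q, Flat (ψ.toFun x) N (hG.entry p q - algebraMap ℂ (Smooth V) (if p = q then 1 else 0)))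
    (A : List (Fin n)) (hA : A.length ≤ N) (i j : Fin n) :
    iterD A [] (fun z => pullbackMetric ψ.toFun G z i j) x =
      ∑ p, ((i ::ₘ (A : Multiset (Fin n))).foldr (coordOp U (-1)) (ψ.coord p)).1 x *
        conj ((coordOp U (-1) j (ψ.coord p)).1 x) := by
  rw [ψ.iterD_pullbackMetric hG hx]
  have h1 := (ψ.flat_pullback hG hN i j).foldr (A := (A : Multiset (Fin n))) hA
  rw [← foldrOp_apply, map_sub, map_sum] at h1
  have h2 : (foldrOp U (-1) (A : Multiset (Fin n)) (ψ.pullback hG.entry i j)).1 x =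
      (∑ p, foldrOp U (-1) (A : Multiset (Fin n)) (coordOp U (-1) i (ψ.coord p) *
        conjOp (coordOp U (-1) j (ψ.coord p)))).1 x := sub_eq_zero.1 h1
  refine h2.trans ?_
  rw [AddSubmonoidClass.coe_finsetSum, Finset.sum_apply]
  refine Finset.sum_congr rfl fun p _ => ?_
  -- The conjugated factor is antiholomorphic, so all unbarred derivatives fall on `∂_i ψ_p`, where
  -- `i` joins the multiset.
  rw [foldrOp_mul_of_const _ _ _ _ fun r => ψ.coordOp_conj_coord r p j, foldr_cons_eq]
  rfl

end HolMap

end Flat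

/-! ### The sum over trees in coordinates with a flat metric -/

section Key

open TopologicalSpace Matrix

variable {n : ℕ} {U V : Opens (Fin n → ℂ)}

namespace HolMap

variable (ψ : HolMap U V) (φ : HolMap V U)

/-- The holomorphic Jacobian matrix. -/
def jacobian (x : Fin n → ℂ) : Matrix (Fin n) (Fin n) ℂ :=
  Matrix.of fun p i => (coordOp U (-1) i (ψ.coord p)).1 x

theorem jacobian_apply {x : Fin n → ℂ} (p i : Fin n) :
    ψ.jacobian x p i = (coordOp U (-1) i (ψ.coord p)).1 x := rfl

theorem jacobian_eq_fderiv {x : Fin n → ℂ} (hx : x ∈ U) (p i : Fin n) :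
    ψ.jacobian x p i = fderiv ℂ ψ.toFun x (Pi.single i 1) p := by
  rw [jacobian_apply, ← ψ.wirt_coord hx]
  exact wirtOp_apply hx _ _ _

variable {ψ φ} (hφψ : ∀ z ∈ U, φ.toFun (ψ.toFun z) = z)

include hφψ in
theorem jacobian_mul_jacobian {x : Fin n → ℂ} (hx : x ∈ U) :
    φ.jacobian (ψ.toFun x) * ψ.jacobian x = 1 := by
  ext i j
  rw [Matrix.mul_apply, Matrix.one_apply, ← coordOp_normalized hφψ hx, normalized, coordOp, map_sum,
    AddSubmonoidClass.coe_finsetSum, Finset.sum_apply]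
  refine Finset.sum_congr rfl fun c _ => ?_
  rw [map_smul, φ.jacobian_eq_fderiv (ψ.mapsTo x hx)]
  rfl

theorem foldr_normalized {x : Fin n → ℂ} (hx : x ∈ U) (A : Multiset (Fin n)) (i : Fin n) :
    (A.foldr (coordOp U (-1)) (normalized ψ φ (ψ.toFun x) i)).1 x =
      ∑ c, φ.jacobian (ψ.toFun x) i c * (A.foldr (coordOp U (-1)) (ψ.coord c)).1 x := by
  rw [← foldrOp_apply, normalized, map_sum, AddSubmonoidClass.coe_finsetSum, Finset.sum_apply]
  refine Finset.sum_congr rfl fun c _ => ?_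
  rw [map_smul, φ.jacobian_eq_fderiv (ψ.mapsTo x hx)]
  rfl

variable {G : (Fin n → ℂ) → Matrix (Fin n) (Fin n) ℂ}

theorem pullbackMetric_eq {x : Fin n → ℂ} (hx : x ∈ U) (hG : G (ψ.toFun x) = 1) :
    pullbackMetric ψ.toFun G x = (ψ.jacobian x)ᵀ * (ψ.jacobian x).map conj := by
  ext i j
  simp only [pullbackMetric, Matrix.of_apply, hG, Matrix.one_apply, ite_mul, one_mul, zero_mul,
    Finset.sum_ite_eq, Finset.mem_univ, if_true, ψ.dz_eq hx, Matrix.mul_apply,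
    Matrix.transpose_apply, Matrix.map_apply, jacobian_apply]

include hφψ in
theorem inv_pullbackMetric {x : Fin n → ℂ} (hx : x ∈ U) (hG : G (ψ.toFun x) = 1) :
    (pullbackMetric ψ.toFun G x)⁻¹ =
      (φ.jacobian (ψ.toFun x)).map conj * (φ.jacobian (ψ.toFun x))ᵀ := by
  refine Matrix.inv_eq_left_inv ?_
  have h1 := jacobian_mul_jacobian hφψ hx
  rw [pullbackMetric_eq hx hG, Matrix.mul_assoc, ← Matrix.mul_assoc _ _ ((ψ.jacobian x).map _),
    ← Matrix.transpose_mul, mul_eq_one_comm.1 h1, Matrix.transpose_one, Matrix.one_mul,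
    ← Matrix.map_mul, h1]
  exact Matrix.map_one _ (map_zero _) (map_one _)

-- The pulled back metric is `Jᵀ * conj J`, with `J` the Jacobian of `ψ`; its inverse cancels `conj
-- J` and leaves the Jacobian of `φ`. For `X p = ∂_A ψ_p` the left side is `∑_j g^{i j̄} g_{A j̄}`
-- and the right side is `∂_A` of the normalized coordinate.
include hφψ in
theorem sum_inv_pullbackMetric {x : Fin n → ℂ} (hx : x ∈ U) (hG : G (ψ.toFun x) = 1)
    (X : Fin n → ℂ) (i : Fin n) :
    ∑ j, (pullbackMetric ψ.toFun G x)⁻¹ j i * ∑ p, X p * conj (ψ.jacobian x p j) =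
      ∑ c, φ.jacobian (ψ.toFun x) i c * X c := by
  have h1 := jacobian_mul_jacobian hφψ hx
  have h2 : (ψ.jacobian x).map conj * (pullbackMetric ψ.toFun G x)⁻¹ =
      (φ.jacobian (ψ.toFun x))ᵀ := by
    rw [inv_pullbackMetric hφψ hx hG, ← Matrix.mul_assoc, ← Matrix.map_mul, mul_eq_one_comm.1 h1,
      Matrix.map_one _ (map_zero _) (map_one _), Matrix.one_mul]
  simp only [Finset.mul_sum]
  rw [Finset.sum_comm]
  refine Finset.sum_congr rfl fun p _ => ?_
  have h3 := congrFun (congrFun h2 p) i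
  rw [Matrix.mul_apply, Matrix.transpose_apply] at h3
  rw [← h3, Finset.sum_mul]
  refine Finset.sum_congr rfl fun j _ => ?_
  rw [Matrix.map_apply]
  ring

include hφψ in
theorem inv_pullbackMetric_conj {x : Fin n → ℂ} (hx : x ∈ U) (hG : G (ψ.toFun x) = 1)
    (i j : Fin n) : conj ((pullbackMetric ψ.toFun G x)⁻¹ i j) =
      (pullbackMetric ψ.toFun G x)⁻¹ j i := by
  rw [inv_pullbackMetric hφψ hx hG]
  simp only [Matrix.mul_apply, Matrix.map_apply, Matrix.transpose_apply, map_sum, map_mul,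
    Complex.conj_conj]
  exact Finset.sum_congr rfl fun _ _ => mul_comm _ _

theorem metricJet_singleton (hG : IsKahlerOn V G) {x : Fin n → ℂ} (hx : x ∈ U) {N : ℕ}
    (hN : IsNormalAt N G (ψ.toFun x)) (A : Multiset (Fin n)) (hA : 1 ≤ A.card) (hA' : A.card ≤ N)
    (j : Fin n) : metricJet (pullbackMetric ψ.toFun G) (A.sort (· ≤ ·))
      (({j} : Multiset (Fin n)).sort (· ≤ ·)) x =
    ∑ p, (A.foldr (coordOp U (-1)) (ψ.coord p)).1 x * conj (ψ.jacobian x p j) := by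
  have h1 : ((A.sort (· ≤ ·) : List (Fin n)) : Multiset (Fin n)) = A := Multiset.sort_eq A _
  rw [Multiset.sort_singleton]
  cases hL : A.sort (· ≤ ·) with
  | nil =>
    rw [hL] at h1
    rw [← h1] at hA
    exact absurd hA (by simp)
  | cons i L =>
    rw [hL] at h1
    rw [← h1] at hA' ⊢
    exact ψ.iterD_pullbackMetric_of_flat hG hx
      (fun p q => isNormalAt_flat (ψ.mapsTo x hx) hG hN p q) L
        (by rw [Multiset.coe_card, List.length_cons] at hA'; omega) i j

theorem metricJet_singleton_left (hG : IsKahlerOn V G) {x : Fin n → ℂ} (hx : x ∈ U)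
    (A : Multiset (Fin n)) (j : Fin n) : metricJet (pullbackMetric ψ.toFun G)
      (({j} : Multiset (Fin n)).sort (· ≤ ·)) (A.sort (· ≤ ·)) x =
    conj (metricJet (pullbackMetric ψ.toFun G) (A.sort (· ≤ ·))
      (({j} : Multiset (Fin n)).sort (· ≤ ·)) x) := by
  rw [Multiset.sort_singleton]
  cases A.sort (· ≤ ·) with
  | nil => exact (map_zero _).symm
  | cons i L => exact ψ.iterD_pullbackMetric_conj hG hx L j i

variable (hψφ : ∀ z ∈ V, ψ.toFun (φ.toFun z) = z)

include hφψ hψφ in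
/-- In coordinates `ψ` in which the metric is flat, the sum over trees is the tensor of the
derivatives of the function. -/
theorem evalAt_treeSum {k m N : ℕ} (hG : IsKahlerOn V G) {F : (Fin n → ℂ) → ℂ}
    (hF : ContDiffOn ℝ ∞ F V) {x : Fin n → ℂ} (hx : x ∈ U) (hN : IsNormalAt N G (ψ.toFun x))
    (hkm : 2 * (k + m) ≤ N) (a : Fin k → Fin n) (b : Fin m → Fin n) :
    evalAt (pullbackMetric ψ.toFun G) (fun z => F (ψ.toFun z)) x (treeSum n k m a b) =
      ∑ c : Fin k → Fin n, ∑ d : Fin m → Fin n,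
        (∏ i, dz (a i) (fun w => ψ.toFun w (c i)) x) *
        (∏ j, conj (dz (b j) (fun w => ψ.toFun w (d j)) x)) *
        evalAt G F (ψ.toFun x) (MvPolynomial.X (.func (indices c) (indices d))) := by
  have hy := ψ.mapsTo x hx
  let F' : Smooth V := ⟨F, hF⟩
  have key := sum_iterated_eq_forestSum hψφ hφψ hx a b (ψ.comp F')
  have h1 : ∀ A B : Multiset (Fin n), evalAt G F (ψ.toFun x) (MvPolynomial.X (.func A B)) =
      (A.foldr (coordOp V (-1)) (B.foldr (coordOp V 1) (φ.comp (ψ.comp F')))).1 (ψ.toFun x) := by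
    intro A B
    have h2 := iterD_eq (A.sort (· ≤ ·)) (B.sort (· ≤ ·)) (φ.comp (ψ.comp F')) hy
    rw [Multiset.sort_eq, Multiset.sort_eq] at h2
    rw [← h2, evalAt, MvPolynomial.eval_X]
    refine iterD_congr ?_ _ _
    filter_upwards [V.isOpen.mem_nhds hy] with z hz
    exact (congrArg F (hψφ z hz)).symm
  simp only [h1]
  rw [key, evalAt]
  -- A metric vertex contracted with its edge is the weight that Lagrange inversion puts on a forest
  -- vertex. The inward forest gets the conjugate weights by Hermitian symmetry.
  have hW₁ : ∀ (i : Fin n) (A : Multiset (Fin n)), 1 ≤ A.card → A.card ≤ N →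
      ∑ j, (pullbackMetric ψ.toFun G x)⁻¹ j i * metricJet (pullbackMetric ψ.toFun G)
        (A.sort (· ≤ ·)) (({j} : Multiset (Fin n)).sort (· ≤ ·)) x =
      (A.foldr (coordOp U (-1)) (normalized ψ φ (ψ.toFun x) i)).1 x := by
    intro i A hA hA'
    simp only [metricJet_singleton hG hx hN A hA hA']
    rw [sum_inv_pullbackMetric hφψ hx hN.1, foldr_normalized hx]
  rw [eval_treeSum a b _
    (fun i A => (A.foldr (coordOp U (-1)) (normalized ψ φ (ψ.toFun x) i)).1 x)
    (fun i B => conj ((B.foldr (coordOp U (-1)) (normalized ψ φ (ψ.toFun x) i)).1 x))]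
  · congr 1
    funext B
    congr 1
    funext A
    have h2 := iterD_eq (A.sort (· ≤ ·)) (B.sort (· ≤ ·)) (ψ.comp F') hx
    rw [Multiset.sort_eq, Multiset.sort_eq] at h2
    exact h2
  · intro i A hA hA'
    exact hW₁ i A (hA i).1 (hA'.trans hkm)
  · intro i B hB hB'
    rw [← hW₁ i B (hB i).2.1 (hB'.trans hkm), map_sum]
    refine Finset.sum_congr rfl fun j _ => ?_
    rw [map_mul, inv_pullbackMetric_conj hφψ hx hN.1, ← metricJet_singleton_left hG hx]
    rfl

end HolMap

end Key

/-! ### Pullbacks of Kähler metrics -/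

section PullbackKahler

open TopologicalSpace Matrix

variable {n : ℕ} {U V : Opens (Fin n → ℂ)}

theorem IsKahlerOn.mono {U V : Set (Fin n → ℂ)} {g : (Fin n → ℂ) → Matrix (Fin n) (Fin n) ℂ}
    (hg : IsKahlerOn U g) (hV : IsOpen V) (h : V ⊆ U) : IsKahlerOn V g where
  isOpen := hV
  smooth i j := (hg.smooth i j).mono h
  posDef z hz := hg.posDef z (h hz)
  closed z hz := hg.closed z (h hz)
  closed_bar z hz := hg.closed_bar z (h hz)

variable {g : (Fin n → ℂ) → Matrix (Fin n) (Fin n) ℂ}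

theorem IsKahlerOn.coordOp_entry (hg : IsKahlerOn U g) (i j l : Fin n) :
    coordOp U (-1) l (hg.entry i j) = coordOp U (-1) i (hg.entry l j) := by
  refine Smooth.ext_wirtOp (fun z hz => ?_) fun z hz => wirtOp_apply_of_notMem hz _ _ _
  have h := hg.closed z hz i j l
  rw [dz_eq_wirt, dz_eq_wirt] at h
  rw [wirtOp_apply hz]
  exact h.trans (wirtOp_apply hz _ _ (hg.entry l j)).symm

namespace HolMap

variable (φ : HolMap V U)

/-- The antiholomorphic factor is not differentiated. The two remaining sums are symmetric in `i`
and `l`, by closedness of `g` and by commutation of derivatives, which yields closedness of the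
pullback. -/
theorem coordOp_pullback (hg : IsKahlerOn U g) (i j l : Fin n) :
    coordOp V (-1) l (φ.pullback hg.entry i j) =
      (∑ q, ∑ p, ∑ r, coordOp V (-1) l (φ.coord r) * φ.comp (coordOp U (-1) r (hg.entry p q)) *
        coordOp V (-1) i (φ.coord p) * conjOp (coordOp V (-1) j (φ.coord q))) +
      ∑ q, ∑ p, φ.comp (hg.entry p q) * coordOp V (-1) l (coordOp V (-1) i (φ.coord p)) *
        conjOp (coordOp V (-1) j (φ.coord q)) := by
  rw [pullback, Finset.sum_comm, ← Finset.sum_add_distrib, coordOp, map_sum]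
  refine Finset.sum_congr rfl fun q _ => ?_
  rw [← Finset.sum_add_distrib, map_sum]
  refine Finset.sum_congr rfl fun p _ => ?_
  have h0 := φ.coordOp_conj_coord l q j
  rw [coordOp] at h0
  rw [wirtOp_mul, h0, mul_zero, add_zero, wirtOp_mul, wirtOp_comp, add_mul, Finset.sum_mul,
    Finset.sum_mul]

theorem coordOp_pullback_comm (hg : IsKahlerOn U g) (i j l : Fin n) :
    coordOp V (-1) l (φ.pullback hg.entry i j) = coordOp V (-1) i (φ.pullback hg.entry l j) := by
  rw [coordOp_pullback, coordOp_pullback]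
  congr 1
  · refine Finset.sum_congr rfl fun q _ => ?_
    rw [Finset.sum_comm]
    refine Finset.sum_congr rfl fun r _ => Finset.sum_congr rfl fun p _ => ?_
    rw [hg.coordOp_entry p q r]
    ring
  · refine Finset.sum_congr rfl fun q _ => Finset.sum_congr rfl fun p _ => ?_
    rw [show coordOp V (-1) l (coordOp V (-1) i (φ.coord p)) =
      coordOp V (-1) i (coordOp V (-1) l (φ.coord p)) from wirtOp_comm _ _ _ _ _]

theorem dz_pullbackMetric (hg : IsKahlerOn U g) {z : Fin n → ℂ} (hz : z ∈ V) (i j l : Fin n) :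
    dz l (fun w => pullbackMetric φ.toFun g w i j) z =
      (coordOp V (-1) l (φ.pullback hg.entry i j)).1 z :=
  φ.iterD_pullbackMetric hg hz [l] [] i j

theorem dzbar_pullbackMetric (hg : IsKahlerOn U g) {z : Fin n → ℂ} (hz : z ∈ V)
    (i j l : Fin n) : dzbar l (fun w => pullbackMetric φ.toFun g w i j) z =
      conj ((coordOp V (-1) l (φ.pullback hg.entry j i)).1 z) := by
  rw [← dz_pullbackMetric φ hg hz]
  exact φ.iterD_pullbackMetric_conj hg hz [l] i j

theorem pullbackMetric_eq_mul {z : Fin n → ℂ} (hz : z ∈ V) : pullbackMetric φ.toFun g z =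
    ((φ.jacobian z).map conj)ᴴ * g (φ.toFun z) * (φ.jacobian z).map conj := by
  ext i j
  simp only [pullbackMetric, Matrix.of_apply, Matrix.mul_apply, Matrix.conjTranspose_apply,
    Matrix.map_apply, φ.dz_eq hz, jacobian_apply, Finset.sum_mul, RCLike.star_def,
    Complex.conj_conj]
  rw [Finset.sum_comm]
  refine Finset.sum_congr rfl fun q _ => Finset.sum_congr rfl fun p _ => ?_
  ring

variable {φ} {ψ : HolMap U V} (hψφ : ∀ z ∈ V, ψ.toFun (φ.toFun z) = z)

include hψφ in
theorem isKahlerOn_pullbackMetric (hg : IsKahlerOn U g) :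
    IsKahlerOn V (pullbackMetric φ.toFun g) where
  isOpen := V.isOpen
  smooth i j := (φ.pullback hg.entry i j).2.congr fun z hz => (φ.pullback_apply hg hz i j).symm
  posDef z hz := by
    rw [φ.pullbackMetric_eq_mul hz]
    refine (hg.posDef _ (φ.mapsTo z hz)).conjTranspose_mul_mul_same ?_
    refine Matrix.mulVec_injective_of_isUnit ?_
    have h1 := jacobian_mul_jacobian (ψ := φ) (φ := ψ) hψφ hz
    refine IsUnit.of_mul_eq_one_right ((ψ.jacobian (φ.toFun z)).map conj) ?_
    rw [← Matrix.map_mul, h1, Matrix.map_one _ (map_zero _) (map_one _)]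
  closed z hz i j l := by
    rw [dz_pullbackMetric φ hg hz, dz_pullbackMetric φ hg hz, coordOp_pullback_comm]
  closed_bar z hz i j l := by
    rw [dzbar_pullbackMetric φ hg hz, dzbar_pullbackMetric φ hg hz, coordOp_pullback_comm]

/-- Unbarred derivatives suffice, since Hermitian symmetry makes the barred ones their conjugates.
-/
theorem isNormalAt_of_flat (hg : IsKahlerOn U g) {y : Fin n → ℂ} (hy : y ∈ V) {N : ℕ}
    (h : ∀ i j, Flat y N (φ.pullback hg.entry i j -
      algebraMap ℂ (Smooth V) (if i = j then 1 else 0))) :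
    IsNormalAt N (pullbackMetric φ.toFun g) y := by
  have key : ∀ i j (L : List (Fin n)), 1 ≤ L.length → L.length ≤ N →
      iterD L [] (fun z => pullbackMetric φ.toFun g z i j) y = 0 := by
    intro i j L hL hN
    rw [φ.iterD_pullbackMetric hg hy]
    have h1 := (h i j).foldr (A := (L : Multiset (Fin n))) hN
    rw [← foldrOp_apply, map_sub] at h1
    have h2 : foldrOp V (-1) (L : Multiset (Fin n))
        (algebraMap ℂ (Smooth V) (if i = j then 1 else 0)) = 0 := by
      cases L with
      | nil => exact absurd hL (by simp)
      | cons l L =>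
        rw [foldrOp_apply, ← Multiset.cons_coe, foldr_cons_eq, coordOp, wirtOp_algebraMap,
          ← foldrOp_apply, map_zero]
    rw [h2, sub_zero] at h1
    exact h1
  refine ⟨?_, fun i j L hL hN => ⟨key i j L hL hN, ?_⟩⟩
  · ext i j
    rw [← φ.pullback_apply hg hy, Matrix.one_apply]
    exact sub_eq_zero.1 (h i j).apply
  · rw [φ.iterD_pullbackMetric_conj hg hy, key j i L hL hN, map_zero]

variable (hφψ : ∀ z ∈ U, φ.toFun (ψ.toFun z) = z)

include hψφ in
theorem coordOp_comp_sum_coord (C : Fin n → ℂ) (c : Fin n) {z : Fin n → ℂ} (hz : z ∈ V) :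
    (coordOp V (-1) c (φ.comp (∑ e, C e • ψ.coord e))).1 z = C c := by
  let idV : HolMap V V := ⟨id, fun _ h => h, analyticOnNhd_id⟩
  have h1 : coordOp V (-1) c (φ.comp (∑ e, C e • ψ.coord e)) =
      wirtOp V (-1) (Pi.single c 1) (∑ e, C e • idV.coord e) := by
    refine wirtOp_congr (fun w hw => ?_) _ _
    simp only [comp, coord, AddSubmonoidClass.coe_finsetSum, Finset.sum_apply,
      SetLike.val_smul, Pi.smul_apply, hψφ w hw]
    rfl
  rw [h1, map_sum, AddSubmonoidClass.coe_finsetSum, Finset.sum_apply]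
  simp only [map_smul, SetLike.val_smul, Pi.smul_apply, smul_eq_mul, wirtOp_apply hz,
    wirt_coord idV hz]
  simp [idV, Pi.single_apply]

include hψφ hφψ in
/-- A criterion for normal coordinates. -/
theorem isNormalAt_pullbackMetric (hg : IsKahlerOn U g) {x : Fin n → ℂ} (hx : x ∈ U) {N : ℕ}
    (h : ∀ i q, Flat x N (hg.entry i q -
      coordOp U (-1) i (∑ e, conj (ψ.jacobian x e q) • ψ.coord e))) :
    IsNormalAt N (pullbackMetric φ.toFun g) (ψ.toFun x) := by
  have hy := ψ.mapsTo x hx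
  refine isNormalAt_of_flat hg hy fun c d => ?_
  set θ : Fin n → Smooth U := fun q => ∑ e, conj (ψ.jacobian x e q) • ψ.coord e with hθ
  set R : Smooth V := ∑ q, coordOp V (-1) c (φ.comp (θ q)) *
    conjOp (coordOp V (-1) d (φ.coord q)) with hR
  -- Modulo flat functions `g_{i q̄}` may be replaced by `∂_i θ_q`, and the chain rule collapses the
  -- sum over `i` to `∂_c (θ_q ∘ φ)`. This is constant because `θ_q ∘ φ` is linear, so `R` is
  -- antiholomorphic, with value `δ_cd` at `ψ x`.
  have h1 : φ.pullback hg.entry c d - algebraMap ℂ (Smooth V) (if c = d then 1 else 0) =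
      (∑ q, ∑ i, φ.comp (hg.entry i q - coordOp U (-1) i (θ q)) *
        (coordOp V (-1) c (φ.coord i) * conjOp (coordOp V (-1) d (φ.coord q)))) +
      (R - algebraMap ℂ (Smooth V) (if c = d then 1 else 0)) := by
    rw [← add_sub_assoc]
    congr 1
    rw [hR, pullback, Finset.sum_comm, ← Finset.sum_add_distrib]
    refine Finset.sum_congr rfl fun q _ => ?_
    have h2 : coordOp V (-1) c (φ.comp (θ q)) =
        ∑ i, coordOp V (-1) c (φ.coord i) * φ.comp (coordOp U (-1) i (θ q)) :=
      φ.wirtOp_comp _ _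
    rw [h2, Finset.sum_mul, ← Finset.sum_add_distrib]
    refine Finset.sum_congr rfl fun i _ => ?_
    have h3 : φ.comp (hg.entry i q - coordOp U (-1) i (θ q)) =
      φ.comp (hg.entry i q) - φ.comp (coordOp U (-1) i (θ q)) := rfl
    rw [h3]
    ring
  rw [h1]
  refine (Flat.sum _ fun q _ => Flat.sum _ fun i _ => Flat.mul_right (Flat.comp φ ?_) _).add
    (Flat.of_coordOp_eq_zero ?_ fun p => ?_)
  · rw [hφψ x hx]
    exact h i q
  · have h2 : (R.1 (ψ.toFun x)) = if c = d then 1 else 0 := by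
      have h3 := mul_eq_one_comm.1 (jacobian_mul_jacobian hφψ hx)
      have h4 := congrArg conj (congrFun (congrFun h3 c) d)
      rw [Matrix.mul_apply, Matrix.one_apply, map_sum] at h4
      rw [hR, AddSubmonoidClass.coe_finsetSum, Finset.sum_apply]
      refine Eq.trans (Finset.sum_congr rfl fun q _ => ?_) (h4.trans (by split_ifs <;> simp))
      rw [map_mul]
      exact congrArg₂ (fun u v : ℂ => u * v)
        (coordOp_comp_sum_coord hψφ (fun e => conj (ψ.jacobian x e q)) c hy) rfl
    exact sub_eq_zero.2 h2
  · have h2 : ∀ q, coordOp V (-1) p (coordOp V (-1) c (φ.comp (θ q))) = 0 := by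
      intro q
      rw [coordOp, wirtOp_congr (k := algebraMap ℂ (Smooth V) (conj (ψ.jacobian x c q)))
        (fun z hz => coordOp_comp_sum_coord hψφ _ c hz), wirtOp_algebraMap]
    rw [coordOp, map_sub, wirtOp_algebraMap, sub_zero, hR, map_sum]
    refine Finset.sum_eq_zero fun q _ => ?_
    have h3 := φ.coordOp_conj_coord p q d
    have h4 := h2 q
    rw [coordOp] at h3 h4
    rw [wirtOp_mul, h3, h4, zero_mul, mul_zero, add_zero]

end HolMap

end PullbackKahler

/-! ### Existence of normal coordinates -/

section NormalCoordinates

open TopologicalSpace Matrix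

variable {n : ℕ} {U V : Opens (Fin n → ℂ)}

theorem foldr_coordOp_congr {h : Smooth U} {k : Smooth V} {x : Fin n → ℂ} (hU : x ∈ U)
    (hV : x ∈ V) (hk : h.1 =ᶠ[nhds x] k.1) (A : Multiset (Fin n)) :
    (A.foldr (coordOp U (-1)) h).1 x = (A.foldr (coordOp V (-1)) k).1 x := by
  induction A using Quotient.inductionOn with
  | _ L => exact (iterD_eq L [] h hU).symm.trans ((iterD_congr hk L []).trans (iterD_eq L [] k hV))

section Taylor

variable (x : Fin n → ℂ)

/-- The translation which moves `x` to the origin. -/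
def translation : HolMap (⊤ : Opens (Fin n → ℂ)) ⊤ where
  toFun z := z - x
  mapsTo _ _ := trivial
  analytic := analyticOnNhd_id.sub analyticOnNhd_const

theorem coordOp_translation (p q : Fin n) : coordOp ⊤ (-1) p ((translation x).coord q) =
    if q = p then 1 else 0 := by
  refine Smooth.ext_wirtOp (fun z hz => ?_) fun z hz => absurd trivial hz
  rw [wirtOp_apply hz, HolMap.wirt_coord _ hz]
  have : fderiv ℂ (translation x).toFun z = ContinuousLinearMap.id ℂ _ :=
    ((hasFDerivAt_id z).sub_const x).fderiv
  rw [this, ContinuousLinearMap.id_apply, Pi.single_apply]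
  split_ifs <;> rfl

/-- The homogeneous polynomial of degree `r` with the derivatives `T` at `x`. -/
def taylorTerm : ℕ → (Multiset (Fin n) → ℂ) → Smooth (⊤ : Opens (Fin n → ℂ))
  | 0, T => algebraMap ℂ _ (T 0)
  -- Euler's identity for homogeneous polynomials of degree `r + 1`, the derivative along `p` being
  -- given by recursion.
  | r + 1, T => ((r + 1 : ℂ)⁻¹) • ∑ p, (translation x).coord p *
      taylorTerm r fun A => T (p ::ₘ A)

theorem taylorTerm_succ (r : ℕ) (T : Multiset (Fin n) → ℂ) : taylorTerm x (r + 1) T =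
    ((r + 1 : ℂ)⁻¹) • ∑ p, (translation x).coord p * taylorTerm x r fun A => T (p ::ₘ A) := rfl

/-- In degree `r + 2` the product rule gives one copy of the answer from the linear factor and `r +
1` copies from Euler's identity for the derivative. The latter needs the symmetry of mixed
derivatives, built in because `T` takes multisets. -/
theorem coordOp_taylorTerm_succ (p : Fin n) (r : ℕ) (T : Multiset (Fin n) → ℂ) :
    coordOp ⊤ (-1) p (taylorTerm x (r + 1) T) = taylorTerm x r fun A => T (p ::ₘ A) := by
  have h0 : ∀ q, wirtOp (⊤ : Opens (Fin n → ℂ)) (-1) (Pi.single p 1) ((translation x).coord q) =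
      if q = p then 1 else 0 := coordOp_translation x p
  induction r generalizing T with
  | zero =>
    rw [taylorTerm_succ, coordOp, map_smul, map_sum]
    simp only [taylorTerm, wirtOp_mul, wirtOp_algebraMap, h0, mul_zero, add_zero, ite_mul,
      one_mul, zero_mul, Finset.sum_ite_eq', Finset.mem_univ, if_true]
    simp
  | succ r ih =>
    have ih' : ∀ T, wirtOp (⊤ : Opens (Fin n → ℂ)) (-1) (Pi.single p 1)
      (taylorTerm x (r + 1) T) = taylorTerm x r fun A => T (p ::ₘ A) := ih
    rw [taylorTerm_succ, coordOp, map_smul, map_sum]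
    simp only [wirtOp_mul, h0, ih', ite_mul, one_mul, zero_mul, Finset.sum_add_distrib,
      Finset.sum_ite_eq', Finset.mem_univ, if_true]
    have h1 : ∑ q, (translation x).coord q * taylorTerm x r (fun A => T (q ::ₘ p ::ₘ A)) =
        (r + 1 : ℂ) • taylorTerm x (r + 1) fun A => T (p ::ₘ A) := by
      rw [taylorTerm_succ, smul_smul, mul_inv_cancel₀ (by exact_mod_cast Nat.succ_ne_zero r), one_smul]
      simp only [Multiset.cons_swap]
    rw [h1, ← one_smul ℂ (taylorTerm x (r + 1) fun A => T (p ::ₘ A)), smul_smul, mul_one, ← add_smul,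
      smul_smul]
    have h2 : ((r + 1 : ℕ) + 1 : ℂ)⁻¹ * (1 + (r + 1)) = 1 := by
      rw [add_comm (1 : ℂ), Nat.cast_succ]
      exact inv_mul_cancel₀ (by exact_mod_cast Nat.succ_ne_zero (r + 1))
    rw [h2, one_smul]

theorem taylorTerm_succ_apply (r : ℕ) (T : Multiset (Fin n) → ℂ) :
    (taylorTerm x (r + 1) T).1 x = 0 := by
  rw [taylorTerm]
  simp only [SetLike.val_smul, Pi.smul_apply, AddSubmonoidClass.coe_finsetSum, Finset.sum_apply,
    MulMemClass.coe_mul, Pi.mul_apply, HolMap.coord, translation, Pi.sub_apply, sub_self, zero_mul,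
    Finset.sum_const_zero, smul_zero]

theorem analyticOnNhd_taylorTerm (r : ℕ) (T : Multiset (Fin n) → ℂ) :
    AnalyticOnNhd ℂ (taylorTerm x r T).1 Set.univ := by
  induction r generalizing T with
  | zero => exact analyticOnNhd_const
  | succ r ih =>
    have h1 : (taylorTerm x (r + 1) T).1 = fun z => ((r + 1 : ℂ)⁻¹) * ∑ p, (z p - x p) *
        (taylorTerm x r fun A => T (p ::ₘ A)).1 z := by
      funext z
      rw [taylorTerm]
      simp only [SetLike.val_smul, Pi.smul_apply, AddSubmonoidClass.coe_finsetSum,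
        Finset.sum_apply, MulMemClass.coe_mul, Pi.mul_apply, HolMap.coord, translation,
        Pi.sub_apply, smul_eq_mul]
    rw [h1]
    refine analyticOnNhd_const.mul (Finset.analyticOnNhd_fun_sum _ fun p _ => ?_)
    refine AnalyticOnNhd.mul ?_ (ih _)
    exact ((ContinuousLinearMap.proj (R := ℂ) (φ := fun _ : Fin n => ℂ) p).analyticOnNhd _).sub
      analyticOnNhd_const

theorem foldr_sum_taylorTerm (M : ℕ) (T : Multiset (Fin n) → ℂ) (A : Multiset (Fin n))
    (hA : A.card ≤ M) :
    (A.foldr (coordOp ⊤ (-1)) (∑ r ∈ Finset.range (M + 1), taylorTerm x r T)).1 x = T A := by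
  induction M generalizing T A with
  | zero =>
    obtain rfl := Multiset.card_eq_zero.1 (Nat.le_zero.1 hA)
    simp [taylorTerm]
  | succ M ih =>
    induction A using Multiset.induction_on with
    | empty =>
      rw [Multiset.foldr_zero, Finset.sum_range_succ', AddMemClass.coe_add, Pi.add_apply,
        AddSubmonoidClass.coe_finsetSum, Finset.sum_apply]
      simp only [taylorTerm_succ_apply, Finset.sum_const_zero, zero_add]
      simp [taylorTerm]
    | cons p A _ =>
      rw [foldr_cons_eq, coordOp, map_sum, Finset.sum_range_succ']
      have h0 : wirtOp ⊤ (-1) (Pi.single p 1) (taylorTerm x 0 T) = 0 := wirtOp_algebraMap _ _ _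
      have h1 : ∀ r, wirtOp ⊤ (-1) (Pi.single p 1) (taylorTerm x (r + 1) T) =
        taylorTerm x r fun A => T (p ::ₘ A) := fun r => coordOp_taylorTerm_succ x p r T
      simp only [h0, h1, add_zero]
      exact ih _ A (by rw [Multiset.card_cons] at hA; omega)

/-- There are polynomials with arbitrary derivatives at `x`. -/
theorem exists_foldr_eq (M : ℕ) (T : Multiset (Fin n) → ℂ) :
    ∃ w : Smooth (⊤ : Opens (Fin n → ℂ)), AnalyticOnNhd ℂ w.1 Set.univ ∧
      ∀ A : Multiset (Fin n), A.card ≤ M → (A.foldr (coordOp ⊤ (-1)) w).1 x = T A := by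
  refine ⟨_, ?_, foldr_sum_taylorTerm x M T⟩
  have h1 : (∑ r ∈ Finset.range (M + 1), taylorTerm x r T).1 =
      fun z => ∑ r ∈ Finset.range (M + 1), (taylorTerm x r T).1 z := by
    funext z
    rw [AddSubmonoidClass.coe_finsetSum, Finset.sum_apply]
  rw [h1]
  exact Finset.analyticOnNhd_fun_sum _ fun r _ => analyticOnNhd_taylorTerm x r T

end Taylor

variable {g : (Fin n → ℂ) → Matrix (Fin n) (Fin n) ℂ}

/-- Two decompositions of one multiset differ at most by exchanging the metric index with a
derivative, which closedness permits. Hence the unbarred jet of `g_{i q̄}` at a point is that of a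
gradient. -/
theorem IsKahlerOn.foldr_entry (hg : IsKahlerOn U g) (q : Fin n) {i j : Fin n}
    {A B : Multiset (Fin n)} (h : i ::ₘ A = j ::ₘ B) :
    A.foldr (coordOp U (-1)) (hg.entry i q) = B.foldr (coordOp U (-1)) (hg.entry j q) := by
  rcases Multiset.cons_eq_cons.1 h with ⟨rfl, rfl⟩ | ⟨-, C, rfl, rfl⟩
  · rfl
  · rw [foldr_cons_eq, foldr_cons_eq, hg.coordOp_entry]

theorem IsKahlerOn.exists_jet (hg : IsKahlerOn U g) (x : Fin n → ℂ) (q : Fin n) :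
    ∃ T : Multiset (Fin n) → ℂ, ∀ i A,
      T (i ::ₘ A) = (A.foldr (coordOp U (-1)) (hg.entry i q)).1 x := by
  classical
  refine ⟨fun B => if h : ∃ iA : Fin n × Multiset (Fin n), iA.1 ::ₘ iA.2 = B then
    (h.choose.2.foldr (coordOp U (-1)) (hg.entry h.choose.1 q)).1 x else 0, fun i A => ?_⟩
  have h : ∃ iA : Fin n × Multiset (Fin n), iA.1 ::ₘ iA.2 = i ::ₘ A := ⟨(i, A), rfl⟩
  refine (dif_pos h).trans ?_
  rw [hg.foldr_entry q h.choose_spec]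

open MatrixOrder in
theorem exists_eq_conjTranspose_mul_self {S : Matrix (Fin n) (Fin n) ℂ} (hS : S.PosDef) :
    ∃ B : Matrix (Fin n) (Fin n) ℂ, S = Bᴴ * B :=
  CStarAlgebra.nonneg_iff_eq_star_mul_self.1 hS.posSemidef.nonneg

/-- A holomorphic map with invertible Jacobian is locally biholomorphic. -/
theorem exists_openPartialHomeomorph (Φ : HolMap (⊤ : Opens (Fin n → ℂ)) ⊤) {x : Fin n → ℂ}
    (hx : x ∈ U) {K : Matrix (Fin n) (Fin n) ℂ} (hK : K * Φ.jacobian x = 1) :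
    ∃ ψ : OpenPartialHomeomorph (Fin n → ℂ) (Fin n → ℂ), AnalyticOnNhd ℂ ψ ψ.source ∧
      AnalyticOnNhd ℂ ψ.symm ψ.target ∧ x ∈ ψ.source ∧ ψ.source ⊆ U ∧ ⇑ψ = Φ.toFun := by
  have hxt : x ∈ (⊤ : Opens (Fin n → ℂ)) := trivial
  have h1 : ∀ v, fderiv ℂ Φ.toFun x v = Φ.jacobian x *ᵥ v := by
    intro v
    have hv : v = ∑ i, v i • (Pi.single i 1 : Fin n → ℂ) := by
      funext j
      simp [Finset.sum_apply, Pi.single_apply]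
    funext p
    conv_lhs => rw [hv, map_sum]
    rw [Finset.sum_apply, Matrix.mulVec, dotProduct]
    refine Finset.sum_congr rfl fun i _ => ?_
    rw [map_smul, Φ.jacobian_eq_fderiv hxt, Pi.smul_apply, smul_eq_mul, mul_comm]
  let L : (Fin n → ℂ) ≃L[ℂ] (Fin n → ℂ) := ContinuousLinearEquiv.equivOfInverse
    (fderiv ℂ Φ.toFun x) (LinearMap.toContinuousLinearMap (Matrix.mulVecLin K))
    (fun v => by
      rw [h1, LinearMap.coe_toContinuousLinearMap', Matrix.mulVecLin_apply, Matrix.mulVec_mulVec, hK,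
        Matrix.one_mulVec])
    (fun v => by
      rw [h1, LinearMap.coe_toContinuousLinearMap', Matrix.mulVecLin_apply, Matrix.mulVec_mulVec,
        mul_eq_one_comm.1 hK, Matrix.one_mulVec])
  have ha : AnalyticAt ℂ Φ.toFun x := Φ.analytic x hxt
  have hL : HasStrictFDerivAt Φ.toFun (L : (Fin n → ℂ) →L[ℂ] (Fin n → ℂ)) x :=
    ha.hasStrictFDerivAt
  let e := hL.toOpenPartialHomeomorph Φ.toFun
  have hxe : x ∈ e.source := hL.mem_toOpenPartialHomeomorph_source
  have hsymm : AnalyticAt ℂ e.symm (Φ.toFun x) :=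
    e.analyticAt_symm' (i := L) hxe ha rfl
  -- The inverse is analytic at `Φ x`, hence on a neighbourhood; restricting to it makes the chart
  -- analytic in both directions.
  let O : Set (Fin n → ℂ) := {y | AnalyticAt ℂ e.symm y}
  have hO : IsOpen O := isOpen_analyticAt ℂ e.symm
  let ψ := (e.symm.restrOpen O hO).symm.restrOpen U U.isOpen
  refine ⟨ψ, fun z _ => Φ.analytic z trivial, fun y hy => ?_, ?_, ?_, rfl⟩
  · exact hy.1.2
  · exact ⟨⟨hxe, hsymm⟩, hx⟩
  · exact fun z hz => hz.2

/-- The holomorphic map given by a biholomorphic coordinate system. -/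
def HolMap.ofOpenPartialHomeomorph (ψ : OpenPartialHomeomorph (Fin n → ℂ) (Fin n → ℂ))
    (hψ : AnalyticOnNhd ℂ ψ ψ.source) :
    HolMap ⟨ψ.source, ψ.open_source⟩ ⟨ψ.target, ψ.open_target⟩ where
  toFun := ψ
  mapsTo _ hz := ψ.map_source hz
  analytic := hψ

/-- Normal coordinates of any order exist. -/
theorem IsKahlerOn.exists_isNormalAt (hg : IsKahlerOn U g) {x : Fin n → ℂ} (hx : x ∈ U) (N : ℕ) :
    ∃ ψ : OpenPartialHomeomorph (Fin n → ℂ) (Fin n → ℂ), AnalyticOnNhd ℂ ψ ψ.source ∧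
      AnalyticOnNhd ℂ ψ.symm ψ.target ∧ x ∈ ψ.source ∧ ψ.source ⊆ U ∧
      IsKahlerOn ψ.target (pullbackMetric ψ.symm g) ∧
      IsNormalAt N (pullbackMetric ψ.symm g) (ψ x) := by
  have hxt : x ∈ (⊤ : Opens (Fin n → ℂ)) := trivial
  choose T hT using fun q => hg.exists_jet x q
  -- `w q` is a polynomial potential: `∂_i (w q)` and `g_{i q̄}` have the same unbarred derivatives
  -- at `x` up to order `N`, which takes `N + 1` derivatives of `w q`.
  choose w hw hwT using fun q => exists_foldr_eq x (N + 1) (T q)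
  obtain ⟨B, hB⟩ := exists_eq_conjTranspose_mul_self (hg.posDef x hx)
  have hST : (g x)ᵀ = Bᵀ * B.map conj := by
    rw [hB, Matrix.transpose_mul]
    rfl
  have hdet : IsUnit ((g x)ᵀ).det := by
    rw [Matrix.det_transpose, isUnit_iff_ne_zero]
    exact (hg.posDef x hx).det_pos.ne'
  -- The coordinates `M w` have Jacobian `M * (g x)ᵀ = conj B` at `x`. As `Bᵀ * M = 1`, the
  -- combinations of coordinates required by `isNormalAt_pullbackMetric` are the `w q` themselves.
  set M : Matrix (Fin n) (Fin n) ℂ := B.map conj * ((g x)ᵀ)⁻¹ with hM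
  have hM1 : M * (g x)ᵀ = B.map conj := by
    rw [hM, Matrix.mul_assoc, Matrix.nonsing_inv_mul _ hdet, Matrix.mul_one]
  have hM2 : Bᵀ * M = 1 := by
    rw [hM, ← Matrix.mul_assoc, ← hST, Matrix.mul_nonsing_inv _ hdet]
  let Φ : HolMap (⊤ : Opens (Fin n → ℂ)) ⊤ :=
    { toFun := fun z c => ∑ q, M c q * (w q).1 z
      mapsTo := fun _ _ => trivial
      analytic := analyticOnNhd_pi_iff.2 fun c => Finset.analyticOnNhd_fun_sum _ fun q _ =>
        analyticOnNhd_const.mul fun z _ => hw q z trivial }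
  have hΦ : ∀ c, Φ.coord c = ∑ q, M c q • w q := by
    intro c
    ext z
    rw [AddSubmonoidClass.coe_finsetSum, Finset.sum_apply]
    rfl
  have hJ : Φ.jacobian x = B.map conj := by
    ext c i
    rw [← hM1, HolMap.jacobian_apply, hΦ, coordOp, map_sum, AddSubmonoidClass.coe_finsetSum,
      Finset.sum_apply, Matrix.mul_apply]
    refine Finset.sum_congr rfl fun q _ => ?_
    rw [map_smul]
    have h1 := hwT q {i} (by simp)
    rw [← Multiset.cons_zero, hT] at h1
    exact congrArg (M c q * ·) h1
  obtain ⟨ψ, hψ, hψ', hxψ, hψU, hψΦ⟩ := exists_openPartialHomeomorph Φ hx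
    (K := ((g x)ᵀ)⁻¹ * Bᵀ) (by
      rw [hJ, Matrix.mul_assoc, ← hST, Matrix.nonsing_inv_mul _ hdet])
  refine ⟨ψ, hψ, hψ', hxψ, hψU, ?_⟩
  let ψ₁ := HolMap.ofOpenPartialHomeomorph ψ hψ
  let φ₁ := HolMap.ofOpenPartialHomeomorph ψ.symm hψ'
  have hg' : IsKahlerOn ψ.source g := hg.mono ψ.open_source hψU
  have h1 : ∀ z ∈ ψ.target, ψ (ψ.symm z) = z := fun z hz => ψ.right_inv hz
  have h2 : ∀ z ∈ ψ.source, ψ.symm (ψ z) = z := fun z hz => ψ.left_inv hz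
  refine ⟨HolMap.isKahlerOn_pullbackMetric (φ := φ₁) (ψ := ψ₁) h1 hg',
    HolMap.isNormalAt_pullbackMetric (φ := φ₁) (ψ := ψ₁) h1 h2 hg' hxψ fun i q => ?_⟩
  have hJ' : ∀ e q, conj (ψ₁.jacobian x e q) = B e q := by
    intro e q
    have h3 : ψ₁.jacobian x e q = Φ.jacobian x e q := by
      rw [ψ₁.jacobian_eq_fderiv hxψ, Φ.jacobian_eq_fderiv hxt]
      exact congrArg (fun f : (Fin n → ℂ) → (Fin n → ℂ) => fderiv ℂ f x (Pi.single q 1) e) hψΦ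
    rw [h3, hJ, Matrix.map_apply, Complex.conj_conj]
  have hθ : (∑ e, conj (ψ₁.jacobian x e q) • ψ₁.coord e).1 = (w q).1 := by
    funext z
    have h3 : ∀ e, (ψ₁.coord e).1 z = ∑ q', M e q' * (w q').1 z := fun e =>
      congrArg (fun f : (Fin n → ℂ) → (Fin n → ℂ) => f z e) hψΦ
    simp only [AddSubmonoidClass.coe_finsetSum, Finset.sum_apply, SetLike.val_smul,
      Pi.smul_apply, smul_eq_mul, hJ', h3, Finset.mul_sum]
    rw [Finset.sum_comm]
    have h4 : ∀ q', ∑ e, B e q * (M e q' * (w q').1 z) = if q = q' then (w q').1 z else 0 := by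
      intro q'
      have h5 := congrFun (congrFun hM2 q) q'
      rw [Matrix.mul_apply, Matrix.one_apply] at h5
      simp only [Matrix.transpose_apply] at h5
      simp only [← mul_assoc]
      rw [← Finset.sum_mul, h5, ite_mul, one_mul, zero_mul]
    simp only [h4, Finset.sum_ite_eq, Finset.mem_univ, if_true]
  refine Flat.of_foldr fun A hA => ?_
  rw [← foldrOp_apply, map_sub, foldrOp_apply, foldrOp_apply, ← foldr_cons_eq]
  refine sub_eq_zero.2 ?_
  refine (foldr_coordOp_congr (U := ⟨ψ.source, ψ.open_source⟩) hxψ hx (k := hg.entry i q) Filter.EventuallyEq.rfl A).trans ?_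
  rw [← hT, ← hwT q _ (by rw [Multiset.card_cons]; omega)]
  exact foldr_coordOp_congr hxt hxψ (Filter.EventuallyEq.of_eq hθ.symm) _

end NormalCoordinates

/-! ### The canonical invariant -/

section Canonical

open TopologicalSpace Matrix

variable {n : ℕ}

theorem evalAt_congr {g g' : (Fin n → ℂ) → Matrix (Fin n) (Fin n) ℂ} {f f' : (Fin n → ℂ) → ℂ}
    {x : Fin n → ℂ} (hg : g =ᶠ[nhds x] g') (hf : f =ᶠ[nhds x] f')
    (P : MvPolynomial (JetVar n) ℂ) : evalAt g f x P = evalAt g' f' x P := by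
  have h : jetValue g f x = jetValue g' f' x := by
    funext v
    cases v with
    | inv i j => simp only [jetValue, hg.eq_of_nhds]
    | metric A B _ =>
      simp only [jetValue]
      cases A.sort (· ≤ ·) with
      | nil => rfl
      | cons i L =>
        cases B.sort (· ≤ ·) with
        | nil => rfl
        | cons j L' =>
          refine iterD_congr ?_ L L'
          filter_upwards [hg] with z hz
          rw [hz]
    | func A B => exact iterD_congr hf _ _
  rw [evalAt, evalAt, h]

theorem IsNormalAt.mono {g : (Fin n → ℂ) → Matrix (Fin n) (Fin n) ℂ} {x : Fin n → ℂ} {N M : ℕ}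
    (h : IsNormalAt N g x) (hM : M ≤ N) : IsNormalAt M g x :=
  ⟨h.1, fun i j L h1 h2 => h.2 i j L h1 (h2.trans hM)⟩

namespace HolMap

variable {U V W : Opens (Fin n → ℂ)}

/-- The composition of holomorphic maps. -/
def trans (ψ : HolMap W V) (φ : HolMap V U) : HolMap W U where
  toFun z := φ.toFun (ψ.toFun z)
  mapsTo z hz := φ.mapsTo _ (ψ.mapsTo z hz)
  analytic := φ.analytic.comp ψ.analytic ψ.mapsTo

theorem jacobian_trans (ψ : HolMap W V) (φ : HolMap V U) (z : Fin n → ℂ) :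
    (ψ.trans φ).jacobian z = φ.jacobian (ψ.toFun z) * ψ.jacobian z := by
  ext e i
  rw [jacobian_apply, show (ψ.trans φ).coord e = ψ.comp (φ.coord e) from rfl, coordOp,
    wirtOp_comp, AddSubmonoidClass.coe_finsetSum, Finset.sum_apply, Matrix.mul_apply]
  exact Finset.sum_congr rfl fun p _ => mul_comm _ _

theorem pullbackMetric_trans (ψ : HolMap W V) (φ : HolMap V U)
    (g : (Fin n → ℂ) → Matrix (Fin n) (Fin n) ℂ) {z : Fin n → ℂ} (hz : z ∈ W) :
    pullbackMetric (ψ.trans φ).toFun g z =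
      pullbackMetric ψ.toFun (pullbackMetric φ.toFun g) z := by
  rw [pullbackMetric_eq_mul _ hz, pullbackMetric_eq_mul _ hz,
    pullbackMetric_eq_mul _ (ψ.mapsTo z hz), jacobian_trans ψ φ z, Matrix.map_mul,
    Matrix.conjTranspose_mul]
  simp only [Matrix.mul_assoc]
  rfl

theorem pullbackMetric_of_jacobian_eq_one (φ : HolMap V U)
    (g : (Fin n → ℂ) → Matrix (Fin n) (Fin n) ℂ) {z : Fin n → ℂ} (hz : z ∈ V)
    (h : φ.jacobian z = 1) : pullbackMetric φ.toFun g z = g (φ.toFun z) := by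
  rw [pullbackMetric_eq_mul _ hz, h, Matrix.map_one _ (map_zero _) (map_one _),
    Matrix.conjTranspose_one, Matrix.one_mul, Matrix.mul_one]

end HolMap

variable {k m : ℕ}

/-- The sum over trees in a biholomorphic coordinate system `χ` which is normal at `χ x`. -/
theorem evalAt_treeSum_of_normal (χ : OpenPartialHomeomorph (Fin n → ℂ) (Fin n → ℂ))
    (hχ : AnalyticOnNhd ℂ χ χ.source) (hχ' : AnalyticOnNhd ℂ χ.symm χ.target)
    {g G : (Fin n → ℂ) → Matrix (Fin n) (Fin n) ℂ} {f F : (Fin n → ℂ) → ℂ}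
    (hG : IsKahlerOn χ.target G) (hF : ContDiffOn ℝ ∞ F χ.target) {x : Fin n → ℂ}
    (hx : x ∈ χ.source) {N : ℕ} (hN : IsNormalAt N G (χ x)) (hkm : 2 * (k + m) ≤ N)
    (hg : ∀ z ∈ χ.source, g z = pullbackMetric χ G z) (hf : ∀ z ∈ χ.source, f z = F (χ z))
    (a : Fin k → Fin n) (b : Fin m → Fin n) :
    evalAt g f x (treeSum n k m a b) = ∑ c : Fin k → Fin n, ∑ d : Fin m → Fin n,
      (∏ i, dz (a i) (fun w => χ w (c i)) x) *
      (∏ j, conj (dz (b j) (fun w => χ w (d j)) x)) *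
      evalAt G F (χ x) (MvPolynomial.X (.func (indices c) (indices d))) := by
  refine Eq.trans ?_ (HolMap.evalAt_treeSum (ψ := .ofOpenPartialHomeomorph χ hχ)
    (φ := .ofOpenPartialHomeomorph χ.symm hχ') (fun z hz => χ.left_inv hz)
    (fun z hz => χ.right_inv hz) hG hF hx hN hkm a b)
  have h := χ.open_source.mem_nhds hx
  refine evalAt_congr ?_ ?_ _
  · filter_upwards [h] with z hz using hg z hz
  · filter_upwards [h] with z hz using hf z hz

/-- Every Kähler metric and every smooth function are pulled back from a normal coordinate
system. -/
theorem exists_normalCoordinates {U : Set (Fin n → ℂ)}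
    {g : (Fin n → ℂ) → Matrix (Fin n) (Fin n) ℂ} {f : (Fin n → ℂ) → ℂ} (hg : IsKahlerOn U g)
    (hf : ContDiffOn ℝ ∞ f U) {x : Fin n → ℂ} (hx : x ∈ U) (N : ℕ) :
    ∃ (ψ : OpenPartialHomeomorph (Fin n → ℂ) (Fin n → ℂ))
      (G : (Fin n → ℂ) → Matrix (Fin n) (Fin n) ℂ) (F : (Fin n → ℂ) → ℂ),
      AnalyticOnNhd ℂ ψ ψ.source ∧ AnalyticOnNhd ℂ ψ.symm ψ.target ∧ x ∈ ψ.source ∧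
      ψ.source ⊆ U ∧ IsKahlerOn ψ.target G ∧ ContDiffOn ℝ ∞ F ψ.target ∧
      IsNormalAt N G (ψ x) ∧ (∀ z ∈ ψ.source, g z = pullbackMetric ψ G z) ∧
      ∀ z ∈ ψ.source, f z = F (ψ z) := by
  obtain ⟨ψ, hψ, hψ', hxψ, hψU, hG, hN⟩ :=
    IsKahlerOn.exists_isNormalAt (U := ⟨U, hg.isOpen⟩) hg hx N
  let ψ₁ := HolMap.ofOpenPartialHomeomorph ψ hψ
  let φ₁ := HolMap.ofOpenPartialHomeomorph ψ.symm hψ'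
  refine ⟨ψ, _, fun z => f (ψ.symm z), hψ, hψ', hxψ, hψU, hG, ?_, hN, fun z hz => ?_,
    fun z hz => ?_⟩
  · exact ContDiffOn.comp (g := f) hf φ₁.contDiffOn fun z hz => hψU (ψ.map_target hz)
  · have h1 : pullbackMetric (ψ₁.trans φ₁).toFun g z =
        pullbackMetric ψ (pullbackMetric ψ.symm g) z := HolMap.pullbackMetric_trans ψ₁ φ₁ g hz
    rw [← h1, HolMap.pullbackMetric_of_jacobian_eq_one _ g hz]
    · exact congrArg g (ψ.left_inv hz).symm
    · rw [HolMap.jacobian_trans ψ₁ φ₁ z]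
      exact HolMap.jacobian_mul_jacobian (ψ := ψ₁) (φ := φ₁) (fun z hz => ψ.left_inv hz) hz
  · exact congrArg f (ψ.left_inv hz).symm

theorem sum_sum_comm {α β M : Type*} [Fintype α] [Fintype β] [AddCommMonoid M]
    (F : α → β → α → β → M) :
    ∑ c, ∑ d, ∑ e, ∑ e', F c d e e' = ∑ e, ∑ e', ∑ c, ∑ d, F c d e e' := by
  have h : ∑ P : α × β, ∑ Q : α × β, F P.1 P.2 Q.1 Q.2 =
      ∑ Q : α × β, ∑ P : α × β, F P.1 P.2 Q.1 Q.2 := Finset.sum_comm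
  simpa only [Fintype.sum_prod_type] using h

theorem prod_mul_apply {R : Type*} [CommSemiring R] (A B : Matrix (Fin n) (Fin n) R)
    (a c : Fin k → Fin n) :
    ∏ i, (A * B) (c i) (a i) = ∑ e : Fin k → Fin n, (∏ i, A (c i) (e i)) * ∏ i, B (e i) (a i) := by
  simp only [Matrix.mul_apply, Finset.prod_univ_sum, Fintype.piFinset_univ,
    Finset.prod_mul_distrib]

theorem sum_tensor_mul (A B : Matrix (Fin n) (Fin n) ℂ) (a : Fin k → Fin n) (b : Fin m → Fin n)
    (t : (Fin k → Fin n) → (Fin m → Fin n) → ℂ) :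
    ∑ c, ∑ d, (∏ i, (A * B) (c i) (a i)) * (∏ j, conj ((A * B) (d j) (b j))) * t c d =
      ∑ c : Fin k → Fin n, ∑ d : Fin m → Fin n,
        (∏ i, B (c i) (a i)) * (∏ j, conj (B (d j) (b j))) *
        ∑ c', ∑ d', (∏ i, A (c' i) (c i)) * (∏ j, conj (A (d' j) (d j))) * t c' d' := by
  simp only [← map_prod, prod_mul_apply, map_sum, map_mul]
  have h1 : ∀ c d, (∑ e : Fin k → Fin n, (∏ i, A (c i) (e i)) * ∏ i, B (e i) (a i)) *
      (∑ e : Fin m → Fin n, conj (∏ j, A (d j) (e j)) * conj (∏ j, B (e j) (b j))) * t c d =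
      ∑ e : Fin k → Fin n, ∑ e' : Fin m → Fin n, (∏ i, B (e i) (a i)) *
        conj (∏ j, B (e' j) (b j)) *
        ((∏ i, A (c i) (e i)) * conj (∏ j, A (d j) (e' j)) * t c d) := by
    intro c d
    rw [Finset.sum_mul_sum, Finset.sum_mul]
    refine Finset.sum_congr rfl fun e _ => ?_
    rw [Finset.sum_mul]
    exact Finset.sum_congr rfl fun e' _ => by ring
  refine (Finset.sum_congr rfl fun c _ => Finset.sum_congr rfl fun d _ => h1 c d).trans ?_
  simp only [Finset.mul_sum]
  exact sum_sum_comm _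

/-- If `ψ` is normal for `g` at `φ x`, then `ψ ∘ φ` is normal for the pulled back metric at `x`,
with the same `G` and `F`. Both tree sums transport the same tensor, through Jacobians that differ
by the factor of `φ`. -/
theorem isInvariant_treeSum : IsInvariant (treeSum n k m) := by
  intro φ hφ hφ' g f hg hf x hx a b
  obtain ⟨ψ, G, F, hψ, hψ', hxψ, hψU, hG, hF, hN, hgG, hfF⟩ :=
    exists_normalCoordinates hg hf (φ.map_source hx) (2 * (k + m))
  have h1 := fun c d => evalAt_treeSum_of_normal (k := k) (m := m) ψ hψ hψ' hG hF hxψ hN le_rfl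
    hgG hfF c d
  have hsource : (φ.trans ψ).source = φ.source ∩ φ ⁻¹' ψ.source := φ.trans_source ψ
  have htarget : (φ.trans ψ).target = ψ.target ∩ ψ.symm ⁻¹' φ.target := φ.trans_target ψ
  let φ₁ : HolMap ⟨(φ.trans ψ).source, (φ.trans ψ).open_source⟩ ⟨ψ.source, ψ.open_source⟩ :=
    ⟨φ, fun z hz => (hsource ▸ hz : z ∈ φ.source ∩ φ ⁻¹' ψ.source).2,
      hφ.mono fun z hz => (hsource ▸ hz : z ∈ φ.source ∩ φ ⁻¹' ψ.source).1⟩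
  let ψ₁ := HolMap.ofOpenPartialHomeomorph ψ hψ
  have hx' : x ∈ (φ.trans ψ).source := hsource ▸ ⟨hx, hxψ⟩
  have h2 := evalAt_treeSum_of_normal (k := k) (m := m) (φ.trans ψ) (φ₁.trans ψ₁).analytic
    (hφ'.comp (hψ'.mono fun z hz => (htarget ▸ hz : z ∈ ψ.target ∩ ψ.symm ⁻¹' φ.target).1)
      fun z hz => (htarget ▸ hz : z ∈ ψ.target ∩ ψ.symm ⁻¹' φ.target).2)
    (hG.mono (φ.trans ψ).open_target fun z hz =>
      (htarget ▸ hz : z ∈ ψ.target ∩ ψ.symm ⁻¹' φ.target).1)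
    (hF.mono fun z hz => (htarget ▸ hz : z ∈ ψ.target ∩ ψ.symm ⁻¹' φ.target).1)
    hx' hN le_rfl (g := pullbackMetric φ g) (f := f ∘ φ) (fun z hz => by
      refine Eq.trans ?_ (HolMap.pullbackMetric_trans φ₁ ψ₁ G hz).symm
      have h3 := hgG (φ z) (φ₁.mapsTo z hz)
      ext i j
      simp only [pullbackMetric, Matrix.of_apply, h3]
      rfl)
    (fun z hz => hfF (φ z) (φ₁.mapsTo z hz)) a b
  rw [h2]
  simp only [h1]
  have e1 : ∀ i p, dz i (fun w => (φ.trans ψ) w p) x = (ψ₁.jacobian (φ x) * φ₁.jacobian x) p i :=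
    fun i p => ((φ₁.trans ψ₁).dz_eq hx' i p).trans
      (congrFun (congrFun (HolMap.jacobian_trans φ₁ ψ₁ x) p) i)
  have e2 : ∀ i p, dz i (fun w => ψ w p) (φ x) = ψ₁.jacobian (φ x) p i := fun i p =>
    ψ₁.dz_eq hxψ i p
  have e3 : ∀ i p, dz i (fun w => φ w p) x = φ₁.jacobian x p i := fun i p => φ₁.dz_eq hx' i p
  simp only [e1, e2, e3]
  exact sum_tensor_mul _ _ a b _

/-- The given coordinates serve as their own normal chart; its Jacobian is the identity, which
leaves only the term `c = a`, `d = b`. -/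
theorem evalAt_treeSum_of_isNormalAt {U : Set (Fin n → ℂ)}
    {g : (Fin n → ℂ) → Matrix (Fin n) (Fin n) ℂ} {f : (Fin n → ℂ) → ℂ} (hg : IsKahlerOn U g)
    (hf : ContDiffOn ℝ ∞ f U) {x : Fin n → ℂ} (hx : x ∈ U) (hN : IsNormalAt (2 * (k + m)) g x)
    (a : Fin k → Fin n) (b : Fin m → Fin n) : evalAt g f x (treeSum n k m a b) =
      evalAt g f x (MvPolynomial.X (.func (indices a) (indices b))) := by
  let ι₁ : HolMap ⟨U, hg.isOpen⟩ ⟨U, hg.isOpen⟩ := ⟨id, fun _ h => h, analyticOnNhd_id⟩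
  have hJ : ∀ z ∈ U, ι₁.jacobian z = 1 := by
    intro z hz
    ext p i
    rw [ι₁.jacobian_eq_fderiv hz, Matrix.one_apply]
    simp [ι₁, Pi.single_apply]
  have h := evalAt_treeSum_of_normal (k := k) (m := m) (OpenPartialHomeomorph.ofSet U hg.isOpen)
    analyticOnNhd_id analyticOnNhd_id hg hf hx hN le_rfl (g := g) (f := f)
    (fun z hz => (ι₁.pullbackMetric_of_jacobian_eq_one g hz (hJ z hz)).symm) (fun _ _ => rfl) a b
  have e : ∀ i p, dz i (fun w => (OpenPartialHomeomorph.ofSet U hg.isOpen) w p) x =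
      if p = i then 1 else 0 := fun i p => (ι₁.dz_eq hx i p).trans
    ((congrFun (congrFun (hJ x hx) p) i).trans Matrix.one_apply)
  simp only [e] at h
  rw [h, Finset.sum_eq_single a, Finset.sum_eq_single b]
  · simp
  · intro d _ hd
    obtain ⟨j, hj⟩ := Function.ne_iff.1 hd
    rw [Finset.prod_eq_zero (Finset.mem_univ j) (by rw [if_neg hj, map_zero]), mul_zero, zero_mul]
  · exact fun hb => absurd (Finset.mem_univ b) hb
  · intro c _ hc
    obtain ⟨i, hi⟩ := Function.ne_iff.1 hc
    refine Finset.sum_eq_zero fun d _ => ?_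
    rw [Finset.prod_eq_zero (Finset.mem_univ i) (if_neg hi), zero_mul, zero_mul]
  · exact fun ha => absurd (Finset.mem_univ a) ha

theorem isCanonicalInvariant_treeSum : IsCanonicalInvariant (treeSum n k m) :=
  ⟨isInvariant_treeSum, 2 * (k + m), fun _ _ _ hg hf _ hx hN a b =>
    evalAt_treeSum_of_isNormalAt hg hf hx hN a b⟩

/-- Every canonical invariant is the sum over trees. -/
theorem IsCanonicalInvariant.evalAt_eq {D : PolyTensor n k m} (hD : IsCanonicalInvariant D)
    {U : Set (Fin n → ℂ)} {g : (Fin n → ℂ) → Matrix (Fin n) (Fin n) ℂ} {f : (Fin n → ℂ) → ℂ}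
    (hg : IsKahlerOn U g) (hf : ContDiffOn ℝ ∞ f U) {x : Fin n → ℂ} (hx : x ∈ U)
    (a : Fin k → Fin n) (b : Fin m → Fin n) :
    evalAt g f x (D a b) = evalAt g f x (treeSum n k m a b) := by
  obtain ⟨hinv, N, hN⟩ := hD
  obtain ⟨ψ, G, F, hψ, hψ', hxψ, hψU, hG, hF, hnorm, hgG, hfF⟩ :=
    -- One normal chart of an order sufficient both for `D` and for the sum over trees.
    exists_normalCoordinates hg hf hx (max N (2 * (k + m)))
  rw [evalAt_treeSum_of_normal ψ hψ hψ' hG hF hxψ hnorm (le_max_right _ _) hgG hfF]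
  have h := ψ.open_source.mem_nhds hxψ
  have h1 : evalAt g f x (D a b) = evalAt (pullbackMetric ψ G) (F ∘ ψ) x (D a b) := by
    refine evalAt_congr ?_ ?_ _
    · filter_upwards [h] with z hz using hgG z hz
    · filter_upwards [h] with z hz using hfF z hz
  rw [h1, hinv ψ hψ hψ' G F hG hF x hxψ a b]
  simp only [hN ψ.target G F hG hF (ψ x) (ψ.map_source hxψ) (hnorm.mono (le_max_left _ _))]

end Canonical

end

end KahlerJets

theorem theorem4p3 (n k m : ℕ) :
    KahlerJets.IsCanonicalInvariant (KahlerJets.treeSum n k m) ∧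
    ∀ D : KahlerJets.PolyTensor n k m, KahlerJets.IsCanonicalInvariant D →
      ∀ (U : Set (Fin n → ℂ)) (g : (Fin n → ℂ) → Matrix (Fin n) (Fin n) ℂ)
        (f : (Fin n → ℂ) → ℂ), KahlerJets.IsKahlerOn U g → ContDiffOn ℝ ∞ f U →
      ∀ x ∈ U, ∀ (a : Fin k → Fin n) (b : Fin m → Fin n),
        KahlerJets.evalAt g f x (D a b) =
          KahlerJets.evalAt g f x
            (∑ t : KahlerJets.TreeClass k m, (-1) ^ t.numVertices * t.poly a b) :=
  ⟨KahlerJets.isCanonicalInvariant_treeSum,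
    fun _ hD _ _ _ hg hf _ hx a b => hD.evalAt_eq hg hf hx a b⟩
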